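/- Machines are randomised multi-tape Turing machines (in every step a fair coin is tossed, and the step may depend on it); "$M(x,y)$ outputs $w$ within $t$ steps with probability at least $2/3$" refers to these coins. For a machine $U$, a string $x\in\{0,1\}^*$ and $t\in\mathbb{N}$ let $\mathsf{rK}^t_U(x)$ be the minimum length of a program $p\in\{0,1\}^*$ such that $U(p,\epsilon)$ outputs $x$ within $t$ steps with probability at least $2/3$ ($\infty$ if there is none). Call $U$ *time-optimal* if for every machine $M$ there is a constant $c$ with $\mathsf{rK}^{c\cdot(t\log t+1)}_U(x)\le \mathsf{rK}^{t}_M(x)+c$ for all $x$ and all $t\ge |x|$. Fix any time-optimal machine $U$, and let $$\mathsf{rKt}(x)=\min_{p\in\{0,1\}^*,\ t\ge 1}\bigl\{|p|+\lceil \log_2 t\rceil \;\bigm|\; U(p,\epsilon)\text{ outputs }x\text{ within }t\text{ steps with probability}\ge 2/3\bigr\}.$$ A function $t\colon\mathbb{N}\to\mathbb{N}$ is *constructive* if a deterministic machine computes the binary representation of $t(n)$ from $1^n$ in $O(t(n))$ steps. $\mathsf{BPTIME}[T]$ is the class of languages decided with error probability at most $1/3$ by a randomised machine that halts on every computation path within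 $O(T(n))$ steps on inputs of length $n$. $\mathsf{BPTIME}[T]/a$ is defined in the same way, where the machine also receives an advice string $\alpha_n$ of length at most $a(n)$ depending only on the input length $n$ (and the requirements are imposed only for these advice strings). $\mathsf{i.o.}\mathcal{C}$ is the class of languages that agree, on infinitely many input lengths, with some language in $\mathcal{C}$. **Theorem.** The following statements are equivalent. 1. (*Pseudodeterministic construction of strings of large $\mathsf{rKt}$ complexity.*) There are a constant $\varepsilon>0$ and a randomised algorithm $A$ that, given $1^m$ (for any $m\in\mathbb{N}$), runs in time $2^{O(m)}$ on every computation path (i.e. at most $2^{cm+c}$ steps for a constant $c$) and outputs with probability at least $2/3$ a fixed $m$-bit string $w_m$ such that $\mathsf{rKt}(w_m)\ge \varepsilon m$. 2. (*Strong time hierarchy theorem for probabilistic computation.*) There are constants $k\ge 1$ and $\lambda>0$ for which the following holds. For every constructive function $t\colon\mathbb{N}\to\mathbb{N}$ with $n\le t(n)\le 2^{\lambda\cdot 2^n}$ for all sufficiently large $n$, there is a language $L\in\mathsf{BPTIME}[t(n)^k]$ such that $L\notin \mathsf{i.o.}\mathsf{BPTIME}[t(n)]/\log t(n)$ (logarithms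 are to base 2). -/

import Mathlib

open Filter
open scoped ENNReal

/-- A randomised Turing machine, in Mathlib's multi-stack form `Turing.TM2` (linear-time equivalent
to multi-tape machines), with finitely many stacks, finite alphabets and finite control.
In every step a fair coin `b` is tossed and the step is made according to the program `prog b`
(a machine with two transition functions).
`kIn` holds the (main) input and `kAux` the second input, and `kOut` the output; bits are
represented by two distinct symbols on each of these stacks. -/
structure RTM where
  /-- the index type of the stacks -/
  K : Type
  [decEqK : DecidableEq K]
  [finK : Fintype K]
  /-- the stack alphabets -/
  Γ : K → Type
  [finΓ : ∀ k, Fintype (Γ k)]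
  /-- the labels of the program -/
  Λ : Type
  [finΛ : Fintype Λ]
  /-- the internal states -/
  σ : Type
  [finσ : Fintype σ]
  /-- the label at which the execution starts -/
  start : Λ
  /-- the internal state at the start -/
  init : σ
  kIn : K
  kAux : K
  kOut : K
  kIn_ne_kAux : kIn ≠ kAux
  bitIn : Bool ↪ Γ kIn
  bitAux : Bool ↪ Γ kAux
  bitOut : Bool ↪ Γ kOut
  /-- the program, depending on the coin tossed in the current step -/
  prog : Bool → Λ → Turing.TM2.Stmt Γ Λ σ

namespace RTM

attribute [instance] RTM.decEqK RTM.finK RTM.finΓ RTM.finΛ RTM.finσ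

/-- Configurations: the current label (`none` once the machine has halted), the internal state and
the contents of the stacks (the head of a list is the top of the stack). -/
abbrev Cfg (M : RTM) : Type := Turing.TM2.Cfg M.Γ M.Λ M.σ

/-- The initial configuration on the input `x` and the second input `y`. -/
def initCfg (M : RTM) (x y : List Bool) : M.Cfg where
  l := some M.start
  var := M.init
  stk := Function.update (Function.update (fun _ => []) M.kAux (y.map M.bitAux))
    M.kIn (x.map M.bitIn)

/-- One step with coin `b`; a halted machine stays where it is. -/
def step (M : RTM) (b : Bool) (c : M.Cfg) : M.Cfg :=
  (Turing.TM2.step (M.prog b) c).getD c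

/-- The configuration reached from the inputs `x`, `y` after `t` steps with coins `r`. -/
def run (M : RTM) (x y : List Bool) {t : ℕ} (r : Fin t → Bool) : M.Cfg :=
  (List.ofFn r).foldl (fun c b => M.step b c) (M.initCfg x y)

/-- `M` halts on `(x, y)` within `t` steps, whatever the coins are. -/
def HaltsWithin (M : RTM) (x y : List Bool) (t : ℕ) : Prop :=
  ∀ r : Fin t → Bool, (M.run x y r).l = none

/-- With coins `r : Fin t → Bool`, `M` halts on `(x, y)` within `t` steps with output `w`. -/
def OutputsOn (M : RTM) (x y : List Bool) {t : ℕ} (r : Fin t → Bool) (w : List Bool) : Prop :=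
  (M.run x y r).l = none ∧ (M.run x y r).stk M.kOut = w.map M.bitOut

open Classical in
/-- The probability that `M(x, y)` outputs `w` within `t` steps. -/
noncomputable def probOutput (M : RTM) (x y : List Bool) (t : ℕ) (w : List Bool) : ℝ :=
  ((Finset.univ.filter fun r : Fin t → Bool => M.OutputsOn x y r w).card : ℝ) / 2 ^ t

/-- `M` ignores its coins. -/
def Deterministic (M : RTM) : Prop := M.prog false = M.prog true

/-- Randomised Kolmogorov complexity of `x` with time bound `t` with respect to `U`: the least
length of a program `p` such that `U(p, ε)` outputs `x` within `t` steps with probability at least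
`2/3` (`⊤` if there is none). -/
noncomputable def rK (U : RTM) (t : ℕ) (x : List Bool) : ℕ∞ :=
  ⨅ (p : List Bool) (_ : 2 / 3 ≤ U.probOutput p [] t x), (p.length : ℕ∞)

/-- `U` is a time-optimal (universal) randomised machine: every randomised machine `M` is simulated
with an additive constant in the program length and time overhead `O(t log t)`. -/
def TimeOptimal (U : RTM) : Prop :=
  ∀ M : RTM, ∃ c : ℕ, ∀ (x : List Bool) (t : ℕ), x.length ≤ t →
    U.rK (c * (t * Nat.log 2 t + 1)) x ≤ M.rK t x + c

/-- `rKt` complexity with respect to `U`: the minimum of `|p| + ⌈log t⌉` over all programs `p` and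
`t ≥ 1` such that `U(p, ε)` outputs `x` within `t` steps with probability at least `2/3`. -/
noncomputable def rKt (U : RTM) (x : List Bool) : ℕ∞ :=
  ⨅ (p : List Bool) (t : ℕ) (_ : 1 ≤ t) (_ : 2 / 3 ≤ U.probOutput p [] t x),
    ((p.length + Nat.clog 2 t : ℕ) : ℕ∞)

end RTM

/-- `t` is (time-)constructive: some deterministic machine computes, on input `1ⁿ`, the binary
representation of `t n` in `O(t n)` steps. -/
def Constructive (t : ℕ → ℕ) : Prop :=
  ∃ (M : RTM) (C : ℕ), M.Deterministic ∧ ∀ n : ℕ, ∀ r : Fin (C * t n + C) → Bool,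
    M.OutputsOn (List.replicate n true) [] r (t n).bits

open Classical in
/-- The answer (as a string of length one) to the question whether `x ∈ L`. -/
noncomputable def answer (L : Language Bool) (x : List Bool) : List Bool := [decide (x ∈ L)]

/-- `BPTIME[T]`: languages decided with error at most `1/3` by a randomised machine that halts in
`O(T(n))` steps on every computation path. -/
def BPTIME (T : ℕ → ℕ) : Set (Language Bool) :=
  {L | ∃ (M : RTM) (C : ℕ), ∀ x : List Bool,
    M.HaltsWithin x [] (C * T x.length + C) ∧
    2 / 3 ≤ M.probOutput x [] (C * T x.length + C) (answer L x)}

/-- `BPTIME[T]/a`: on inputs of length `n` the machine also receives an advice string of length at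
most `a n` that depends on `n` only; the requirements are imposed for this advice string. -/
def BPTIMEAdvice (T a : ℕ → ℕ) : Set (Language Bool) :=
  {L | ∃ (M : RTM) (C : ℕ) (α : ℕ → List Bool), (∀ n, (α n).length ≤ a n) ∧
    ∀ x : List Bool,
      M.HaltsWithin x (α x.length) (C * T x.length + C) ∧
      2 / 3 ≤ M.probOutput x (α x.length) (C * T x.length + C) (answer L x)}

/-- `i.o.𝒞`: languages that agree with some language in `𝒞` on infinitely many input lengths. -/
def io (𝒞 : Set (Language Bool)) : Set (Language Bool) :=
  {L | ∃ L' ∈ 𝒞, ∃ᶠ n in atTop, ∀ x : List Bool, x.length = n → (x ∈ L ↔ x ∈ L')}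

/-! Strings and languages are exchanged through truth tables: a string of length `m` is read as the
table of a language on the strings of length about `log m`.

From construction to hierarchy (`exists_language_of_construction`): let `l` be the bit length of `t
n` and let `L` at length `n` have the table `w_{Kl}`, for a large constant `K`. Computing `t n`,
running the construction on `1^{Kl}` and looking up a bit takes time polynomial in `2^l`, hence in
`t n`. If a machine `M` with advice `α` decided `L` at length `n` in time `O(t n)`, then `l`, `n`,
`α` and the fixed `M` would describe `w_{Kl}`: about `4l` bits of program and, after amplification,
time `4^l`. Time-optimality of `U` turns this into a `U`-program of length `4l + O(1)` running in
time `2^{3l}`, so `rKt(w_{Kl}) ≤ 7l + O(1) < 8l ≤ εKl`, which is impossible for large `n`.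

From hierarchy to construction (`exists_construction_of_language`): take the hard language `L` for
`t n = 2^{2^{n-q}}` and let `w_m` be one bit `b` followed by the first `m - 1` values of `L` from
the string `0^n` on, where `2^n` is of order `m`. Amplified evaluation takes time `2^{O(m)}`. A
program `p` and a time bound `2^l` showing that `rKt(w_m)` is small relative to `m` fit into an
advice string of at most `log t n` bits, from which every value of `L` at length `n` is recovered in
time `O(t n)`. Hence this happens for only finitely many `m`. For the remaining `m` a lower bound of
`1` suffices, and a suitable `b` provides it (`exists_bit_one_le_rKt`).

Most of the file constructs the machines. Programs act on abstract states and are analysed by `wp`,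
the expected value of a cost at the final state, with `⊤` for paths that have not halted. A finite
bound on `wp` therefore proves halting on every path, and a bound `1/3` on the indicator of failure
gives the success probability at the same time (`compile_spec`). The calculus rests on `wp_seq`,
`wp_loop` and `wp_exec`, the last one for calling a given machine as a subroutine. Amplification
(`wp_trials`, `wp_tabulate`) uses an exponential weight on the votes and a union bound. -/

/-! ### Expectations over sequences of coin tosses -/

/-- The expectation of `F` after `t` steps of the random walk which in every step tosses a fair coin
`b` and applies `ν b`. -/
noncomputable def ex {C : Type*} (ν : Bool → C → C) : ℕ → C → (C → ℝ≥0∞) → ℝ≥0∞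
  | 0, c, F => F c
  | t + 1, c, F => (ex ν t (ν false c) F + ex ν t (ν true c) F) / 2

section Expectation

variable {C C' : Type*} {ν : Bool → C → C}

lemma half_add_half (a : ℝ≥0∞) : (a + a) / 2 = a := by
  rw [← two_mul, mul_comm, ENNReal.mul_div_cancel_right (by simp) (by simp)]

lemma ex_mono {F G : C → ℝ≥0∞} (h : ∀ c, F c ≤ G c) (t : ℕ) (c : C) :
    ex ν t c F ≤ ex ν t c G := by
  induction t generalizing c with
  | zero => exact h c
  | succ t ih => simp only [ex]; gcongr <;> apply ih

/-- Simulation principle: a map commuting with the steps transports expectations. It serves both for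
compilation and for embedded machines. -/
lemma ex_map {ν' : Bool → C' → C'} (h : C → C') (hh : ∀ b c, ν' b (h c) = h (ν b c))
    (F : C' → ℝ≥0∞) (t : ℕ) (c : C) : ex ν' t (h c) F = ex ν t c (fun c => F (h c)) := by
  induction t generalizing c with
  | zero => rfl
  | succ t ih => simp only [ex, hh, ih]

lemma ex_fixed {c : C} (h : ∀ b, ν b c = c) (F : C → ℝ≥0∞) (t : ℕ) : ex ν t c F = F c := by
  induction t with
  | zero => rfl
  | succ t ih => simp only [ex, h, ih, half_add_half]

lemma ex_affine (F : C → ℝ≥0∞) (a b : ℝ≥0∞) (t : ℕ) (c : C) :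
    ex ν t c (fun c => a + b * F c) = a + b * ex ν t c F := by
  induction t generalizing c with
  | zero => rfl
  | succ t ih =>
    simp only [ex, ih]
    rw [show a + b * ex ν t (ν false c) F + (a + b * ex ν t (ν true c) F)
      = (a + a) + b * (ex ν t (ν false c) F + ex ν t (ν true c) F) by ring,
      ENNReal.add_div, half_add_half, mul_div_assoc]

lemma ex_eq_sum (F : C → ℝ≥0∞) (t : ℕ) (c : C) :
    ex ν t c F = (∑ r : Fin t → Bool, F ((List.ofFn r).foldl (fun c b => ν b c) c)) / 2 ^ t := by
  induction t generalizing c with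
  | zero => simp [ex]
  | succ t ih =>
    rw [ex, ih, ih, ← (Fin.consEquiv fun _ : Fin (t + 1) => Bool).sum_comp,
      Fintype.sum_prod_type, Fintype.sum_bool, add_comm, ← ENNReal.add_div,
      pow_succ, ENNReal.div_eq_inv_mul, ENNReal.div_eq_inv_mul, ENNReal.div_eq_inv_mul, ← mul_assoc,
      ENNReal.mul_inv (by simp) (by simp), mul_comm (2⁻¹ : ℝ≥0∞)]
    simp [Fin.consEquiv, List.ofFn_succ]

end Expectation

/-! ### Success probabilities of randomised machines as expectations -/

namespace RTM

variable (M : RTM)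

lemma step_halted (b : Bool) {c : M.Cfg} (h : c.l = none) : M.step b c = c := by
  obtain ⟨l, v, S⟩ := c
  simp only at h
  subst h
  rfl

/-- `F` on halted configurations, `⊤` elsewhere. -/
noncomputable def onHalt {M : RTM} (F : M.Cfg → ℝ≥0∞) (c : M.Cfg) : ℝ≥0∞ :=
  if c.l = none then F c else ⊤

lemma ex_ite (E : M.Cfg → Prop) [DecidablePred E] (x y : List Bool) (t : ℕ) :
    ex M.step t (M.initCfg x y) (fun c => if E c then 0 else 1)
      = 1 - ((Finset.univ.filter fun r : Fin t → Bool => E (M.run x y r)).card : ℝ≥0∞) / 2 ^ t := by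
  rw [ex_eq_sum]
  have h1 : (∑ r : Fin t → Bool, (if E (M.run x y r) then (0 : ℝ≥0∞) else 1))
      = ((Finset.univ.filter fun r : Fin t → Bool => ¬ E (M.run x y r)).card : ℝ≥0∞) := by
    simp only [Finset.card_filter, Nat.cast_sum]
    exact Finset.sum_congr rfl fun r _ => by split_ifs <;> simp_all
  have h2 := Finset.card_filter_add_card_filter_not (s := (Finset.univ : Finset (Fin t → Bool)))
    (fun r => E (M.run x y r))
  simp only [Finset.card_univ, Fintype.card_fun, Fintype.card_bool, Fintype.card_fin] at h2
  unfold RTM.run at h1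
  rw [h1]
  have h3 : (((Finset.univ.filter fun r : Fin t → Bool => E (M.run x y r)).card : ℝ≥0∞)
      + ((Finset.univ.filter fun r : Fin t → Bool => ¬ E (M.run x y r)).card : ℝ≥0∞)) / 2 ^ t
      = 1 := by
    rw [← Nat.cast_add, h2]; simp [ENNReal.div_self]
  rw [ENNReal.add_div] at h3
  refine ENNReal.eq_sub_of_add_eq ?_ (by rw [add_comm]; exact h3)
  exact ENNReal.div_ne_top (by simp) (by simp)

-- Passage from counting coin sequences in `ℝ` to the failure indicator in `ℝ≥0∞`, where upper
-- bounds are easy to compose.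
open Classical in
lemma probOutput_iff (x y : List Bool) (t : ℕ) (w : List Bool) :
    2 / 3 ≤ M.probOutput x y t w ↔
    ex M.step t (M.initCfg x y)
      (fun c => if c.l = none ∧ c.stk M.kOut = w.map M.bitOut then 0 else 1) ≤ 1 / 3 := by
  rw [ex_ite, RTM.probOutput]
  set N := (Finset.univ.filter fun r : Fin t → Bool => M.OutputsOn x y r w).card with hN
  suffices H : 2 / 3 ≤ (N : ℝ) / 2 ^ t ↔ 1 - (N : ℝ≥0∞) / 2 ^ t ≤ 1 / 3 by
    convert H; rfl
  have : (N : ℝ≥0∞) / 2 ^ t = ENNReal.ofReal ((N : ℝ) / 2 ^ t) := by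
    rw [ENNReal.ofReal_div_of_pos (by positivity), ENNReal.ofReal_pow (by norm_num)]; simp
  rw [this, show (1 / 3 : ℝ≥0∞) = ENNReal.ofReal (1 / 3) by
      rw [ENNReal.ofReal_div_of_pos (by positivity)]; simp,
    ← ENNReal.ofReal_one, ← ENNReal.ofReal_sub _ (by positivity),
    ENNReal.ofReal_le_ofReal_iff (by norm_num)]
  constructor <;> intro h <;> linarith

lemma ex_lt_top {x y : List Bool} {t : ℕ} {F : M.Cfg → ℝ≥0∞}
    (h : ex M.step t (M.initCfg x y) F < ⊤) (r : Fin t → Bool) : F (M.run x y r) < ⊤ := by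
  rw [ex_eq_sum] at h
  by_contra hF
  have h2 : (∑ r : Fin t → Bool, F ((List.ofFn r).foldl (fun c b => M.step b c)
      (M.initCfg x y))) = ⊤ :=
    ENNReal.sum_eq_top.2 ⟨r, Finset.mem_univ _, by simpa [RTM.run] using hF⟩
  rw [h2, ENNReal.top_div_of_ne_top (by simp)] at h
  exact lt_irrefl _ h

-- Since every path halts, the value `⊤` of `onHalt` is never met, and the bound is just the failure
-- probability.
open Classical in
lemma ex_onHalt_le {x y : List Bool} {t : ℕ} {w : List Bool} (h : M.HaltsWithin x y t)
    (h' : 2 / 3 ≤ M.probOutput x y t w) :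
    ex M.step t (M.initCfg x y)
      (onHalt fun c => if c.stk M.kOut = w.map M.bitOut then 0 else 1) ≤ 1 / 3 := by
  refine le_trans (le_of_eq ?_) ((M.probOutput_iff x y t w).1 h')
  rw [ex_eq_sum, ex_eq_sum]
  congr 1
  refine Finset.sum_congr rfl fun r _ => ?_
  have := h r
  unfold RTM.run at this
  simp [onHalt, this]

lemma ex_le_of_forall_run {x y : List Bool} {t : ℕ} {F : M.Cfg → ℝ≥0∞} {v : ℝ≥0∞}
    (h : ∀ r : Fin t → Bool, F (M.run x y r) ≤ v) : ex M.step t (M.initCfg x y) F ≤ v := by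
  rw [ex_eq_sum]
  refine (ENNReal.div_le_div_right (Finset.sum_le_sum fun r _ => h r) _).trans ?_
  simp only [Finset.sum_const, Finset.card_univ, Fintype.card_fun, Fintype.card_bool,
    Fintype.card_fin, nsmul_eq_mul, Nat.cast_pow, Nat.cast_ofNat]
  rw [mul_comm, mul_div_assoc, ENNReal.div_self (by simp) (by simp), mul_one]

-- A halted machine stays put, so a success within `t` steps persists.
open Classical in
lemma probOutput_mono {x y : List Bool} {t t' : ℕ} {w : List Bool} (htt : t ≤ t')
    (h : 2 / 3 ≤ M.probOutput x y t w) : 2 / 3 ≤ M.probOutput x y t' w := by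
  rw [probOutput_iff] at *
  refine le_trans ?_ h
  generalize M.initCfg x y = c
  induction htt with
  | refl => exact le_rfl
  | @step m hm ih =>
    refine le_trans ?_ ih
    clear h ih hm
    induction m generalizing c with
    | zero =>
      simp only [ex]
      split_ifs with h1 h2 h3 h3 h2 h3 h3
      all_goals try simp_all [step_halted]
      all_goals exact (ENNReal.div_le_of_le_mul (by norm_num))
    | succ m ih => exact ENNReal.div_le_div_right (add_le_add (ih _) (ih _)) _

/-- Two disjoint events cannot both have probability at least `2/3`. -/
lemma probOutput_unique {x y : List Bool} {t : ℕ} {w w' : List Bool}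
    (h : 2 / 3 ≤ M.probOutput x y t w) (h' : 2 / 3 ≤ M.probOutput x y t w') : w = w' := by
  classical
  by_contra hne
  unfold RTM.probOutput at h h'
  have hd : Disjoint (Finset.univ.filter fun r : Fin t → Bool => M.OutputsOn x y r w)
      (Finset.univ.filter fun r : Fin t → Bool => M.OutputsOn x y r w') := by
    rw [Finset.disjoint_filter]
    intro r _ h1 h2
    have := h1.2.symm.trans h2.2
    exact hne (List.map_injective_iff.2 M.bitOut.injective this)
  have hc := Finset.card_union_of_disjoint hd
  have hle := Finset.card_le_univ ((Finset.univ.filter fun r : Fin t → Bool => M.OutputsOn x y r w)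
    ∪ (Finset.univ.filter fun r : Fin t → Bool => M.OutputsOn x y r w'))
  rw [hc] at hle
  simp only [Fintype.card_fun, Fintype.card_bool, Fintype.card_fin] at hle
  have hle' : (((Finset.univ.filter fun r : Fin t → Bool => M.OutputsOn x y r w).card : ℝ)
    + ((Finset.univ.filter fun r : Fin t → Bool => M.OutputsOn x y r w').card : ℝ)) ≤ 2 ^ t := by
    exact_mod_cast hle
  rw [le_div_iff₀ (by positivity)] at h h'
  have : (0 : ℝ) < 2 ^ t := by positivity
  linarith

end RTM

/-! ### Programs on abstract states -/

open Turing (TM2.Stmt TM2.stepAux TM2.Cfg)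
open Turing.TM2

namespace Turing.TM2

variable {K : Type} {Γ : K → Type} {Λ Λ' σ : Type}

/-- Renames the labels of a statement and replaces `halt` by the statement `h`. -/
def Stmt.relabel (f : Λ → Λ') : Stmt Γ Λ σ → Stmt Γ Λ' σ → Stmt Γ Λ' σ
  | .push k g q, h => .push k g (q.relabel f h)
  | .peek k g q, h => .peek k g (q.relabel f h)
  | .pop k g q, h => .pop k g (q.relabel f h)
  | .load g q, h => .load g (q.relabel f h)
  | .branch p q₁ q₂, h => .branch p (q₁.relabel f h) (q₂.relabel f h)
  | .goto l, _ => .goto fun v => f (l v)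
  | .halt, h => h

/-- Replacing `halt` inside the statement lets control pass to the next program without an extra
step, so running times of composed programs simply add. -/
lemma stepAux_relabel [DecidableEq K] (f : Λ → Λ') (h : Stmt Γ Λ' σ) (q : Stmt Γ Λ σ) (v : σ)
    (S : ∀ k, List (Γ k)) :
    stepAux (q.relabel f h) v S =
      match stepAux q v S with
      | ⟨some l, v', S'⟩ => ⟨some (f l), v', S'⟩
      | ⟨none, v', S'⟩ => stepAux h v' S' := by
  induction q generalizing v S with
  | push k g q ih => simp only [Stmt.relabel, stepAux, ih]
  | peek k g q ih => simp only [Stmt.relabel, stepAux, ih]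
  | pop k g q ih => simp only [Stmt.relabel, stepAux, ih]
  | load g q ih => simp only [Stmt.relabel, stepAux, ih]
  | branch p q₁ q₂ ih₁ ih₂ => cases hp : p v <;> simp [Stmt.relabel, stepAux, hp, ih₁, ih₂]
  | goto l => simp [Stmt.relabel, stepAux]
  | halt => simp [Stmt.relabel, stepAux]

end Turing.TM2

/-- The entries of a list above the first `none`. -/
def visible {α : Type} : List (Option α) → List α
  | [] => []
  | none :: _ => []
  | some a :: l => a :: visible l

namespace Frame

variable {I : Type} (Ms : I → RTM)

/-- The stacks of a machine with twelve work stacks and the stacks of the machines `Ms i`. -/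
abbrev K : Type := Fin 12 ⊕ (Σ i, (Ms i).K)

/-- Work stacks hold bits; the stacks of `Ms i` hold their own symbols and bottom markers `none`. -/
abbrev Γ : K Ms → Type
  | .inl _ => Bool
  | .inr p => Option ((Ms p.1).Γ p.2)

/-- Internal states: a flag for the use within one step, two registers and the internal states of the
machines `Ms i`. -/
structure Var where
  flag : Bool
  r1 : Option Bool
  r2 : Option Bool
  v : ∀ i, (Ms i).σ

/-- The abstract state of a machine that uses the machines `Ms i` as subroutines: two registers,
the internal states of the subroutines, the work stacks and the stacks of the subroutines. -/
structure St where
  r1 : Option Bool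
  r2 : Option Bool
  v : ∀ i, (Ms i).σ
  w : Fin 12 → List Bool
  s : ∀ i k, List ((Ms i).Γ k)

variable {Ms}

/-- The abstract state represented by the internal state `v` and the stacks `S`. -/
def view (v : Var Ms) (S : ∀ k, List (Γ Ms k)) : St Ms where
  r1 := v.r1
  r2 := v.r2
  v := v.v
  w a := S (.inl a)
  s i k := visible (S (.inr ⟨i, k⟩))

variable [DecidableEq I]

/-- A transformation of abstract states that can be carried out within one step. -/
def Implementable (op : St Ms → St Ms) : Prop :=
  ∃ B : ∀ Λ : Type, Stmt (Γ Ms) Λ (Var Ms) → Stmt (Γ Ms) Λ (Var Ms), ∀ Λ q v S, ∃ v' S',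
    stepAux (B Λ q) v S = stepAux q v' S' ∧ view v' S' = op (view v S)

lemma Implementable.comp {f g : St Ms → St Ms} (hf : Implementable f) (hg : Implementable g) :
    Implementable (fun s => g (f s)) := by
  obtain ⟨B, hB⟩ := hf
  obtain ⟨C, hC⟩ := hg
  refine ⟨fun Λ q => B Λ (C Λ q), fun Λ q v S => ?_⟩
  obtain ⟨v', S', h1, h2⟩ := hB Λ (C Λ q) v S
  obtain ⟨v'', S'', h3, h4⟩ := hC Λ q v' S'
  exact ⟨v'', S'', h1.trans h3, by rw [h4, h2]⟩

/-- A step from abstract states to labels (`none` for halting) and abstract states that is carried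
out by some statement. -/
def Realizable {Λ : Type} (φ : St Ms → Option Λ × St Ms) : Prop :=
  ∃ q : Stmt (Γ Ms) Λ (Var Ms), ∀ v S,
    ((stepAux q v S).l, view (stepAux q v S).var (stepAux q v S).stk) = φ (view v S)

variable (Ms) in
/-- A program on abstract states each of whose steps is carried out by a statement. -/
structure Prog where
  Λ : Type
  [finΛ : Fintype Λ]
  start : Λ
  step : Bool → Λ → St Ms → Option Λ × St Ms
  real : ∀ b l, Realizable (step b l)

attribute [instance] Prog.finΛ

/-! ### The expectation calculus for sequences and loops -/

namespace Prog

/-- The transitions of a program. -/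
def trans (P : Prog Ms) (b : Bool) : Option P.Λ × St Ms → Option P.Λ × St Ms
  | (none, s) => (none, s)
  | (some l, s) => P.step b l s

/-- `f` on halted configurations, `⊤` elsewhere. -/
def halted {Λ : Type} (f : St Ms → ℝ≥0∞) : Option Λ × St Ms → ℝ≥0∞
  | (none, s) => f s
  | (some _, _) => ⊤

/-- The expectation of `f` at the final state of `P` started at `s`, with the value `⊤` if `P` does
not halt within `t` steps. -/
noncomputable def wp (P : Prog Ms) (t : ℕ) (s : St Ms) (f : St Ms → ℝ≥0∞) : ℝ≥0∞ :=
  ex P.trans t (some P.start, s) (halted f)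

lemma ex_none (P : Prog Ms) (t : ℕ) (s : St Ms) (f : St Ms → ℝ≥0∞) :
    ex P.trans t (none, s) (halted f) = f s :=
  ex_fixed (by simp [trans]) _ _

/-- Further steps leave halted paths unchanged and can only lower the value `⊤` of the others. -/
lemma ex_anti (P : Prog Ms) (f : St Ms → ℝ≥0∞) {t t' : ℕ} (h : t ≤ t')
    (c : Option P.Λ × St Ms) : ex P.trans t' c (halted f) ≤ ex P.trans t c (halted f) := by
  induction t generalizing t' c with
  | zero =>
    obtain ⟨_ | l, s⟩ := c
    · rw [ex_none, ex_none]
    · exact le_top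
  | succ t ih =>
    obtain ⟨u, rfl⟩ : ∃ u, t' = u + 1 := ⟨t' - 1, by omega⟩
    have hu : t ≤ u := by omega
    exact ENNReal.div_le_div_right (add_le_add (ih hu _) (ih hu _)) _

lemma wp_anti {P : Prog Ms} {t t' : ℕ} (h : t ≤ t') (s : St Ms) (f : St Ms → ℝ≥0∞) :
    P.wp t' s f ≤ P.wp t s f := P.ex_anti f h _

omit [DecidableEq I] in
/-- Programs that do not depend on the coins. -/
def Coinless (P : Prog Ms) : Prop := P.step false = P.step true

/-- The program that carries out `op` in one step. -/
def prim (op : St Ms → St Ms) (h : Implementable op) : Prog Ms where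
  Λ := Unit
  start := ()
  step _ _ s := (none, op s)
  real _ _ := by
    obtain ⟨B, hB⟩ := h
    refine ⟨B Unit .halt, fun v S => ?_⟩
    obtain ⟨v', S', h1, h2⟩ := hB Unit .halt v S
    simp [h1, h2]

lemma prim_coinless {op : St Ms → St Ms} (h : Implementable op) : (prim op h).Coinless := rfl

lemma wp_prim {op : St Ms → St Ms} {h : Implementable op} (s : St Ms) (f : St Ms → ℝ≥0∞) :
    (prim op h).wp 1 s f = f (op s) := by
  simp [wp, ex, trans, prim, halted, half_add_half]

/-- Run `P`, then `Q`. -/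
def seq (P Q : Prog Ms) : Prog Ms where
  Λ := P.Λ ⊕ Q.Λ
  start := .inl P.start
  step b
    | .inl l, s => match P.step b l s with
      | (some l', s') => (some (.inl l'), s')
      | (none, s') => (some (.inr Q.start), s')
    | .inr l, s => ((Q.step b l s).1.map .inr, (Q.step b l s).2)
  real b l := by
    rcases l with l | l
    · obtain ⟨q, hq⟩ := P.real b l
      refine ⟨q.relabel .inl (.goto fun _ => .inr Q.start), fun v S => ?_⟩
      rw [stepAux_relabel]
      simp only [← hq v S]
      rcases stepAux q v S with ⟨_ | l, v', S'⟩ <;> rfl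
    · obtain ⟨q, hq⟩ := Q.real b l
      refine ⟨q.relabel .inr .halt, fun v S => ?_⟩
      rw [stepAux_relabel]
      simp only [← hq v S]
      rcases stepAux q v S with ⟨_ | l, v', S'⟩ <;> rfl

lemma Coinless.seq {P Q : Prog Ms} (hP : P.Coinless) (hQ : Q.Coinless) : (P.seq Q).Coinless := by
  unfold Coinless Prog.seq at *
  simp only [hP, hQ]

/-- If `P` stops early on some path, `Q` has more than `t'` steps left there, which is harmless by
`ex_anti`. -/
lemma wp_seq {P Q : Prog Ms} (t t' : ℕ) (s : St Ms) (f : St Ms → ℝ≥0∞) :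
    (P.seq Q).wp (t + t') s f ≤ P.wp t s fun s' => Q.wp t' s' f := by
  have hQ : ∀ (t : ℕ) (c : Option Q.Λ × St Ms),
      ex (P.seq Q).trans t (c.1.map .inr, c.2) (halted f) = ex Q.trans t c (halted f) := by
    intro t c
    rw [ex_map (ν := Q.trans) (ν' := (P.seq Q).trans) (fun c => (c.1.map Sum.inr, c.2))]
    · congr 1
      ext ⟨_ | l, s⟩ <;> rfl
    · rintro b ⟨_ | l, s⟩ <;> rfl
  suffices H : ∀ (t : ℕ) (l : P.Λ) (s : St Ms),
      ex (P.seq Q).trans (t + t') (some (.inl l), s) (halted f)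
        ≤ ex P.trans t (some l, s) (halted fun s' => Q.wp t' s' f) from H t _ s
  intro t
  induction t with
  | zero => intros; exact le_top
  | succ t ih =>
    intro l s
    rw [show t + 1 + t' = (t + t') + 1 by omega, ex, ex]
    have key : ∀ b, ex (P.seq Q).trans (t + t') ((P.seq Q).trans b (some (.inl l), s)) (halted f)
        ≤ ex P.trans t (P.trans b (some l, s)) (halted fun s' => Q.wp t' s' f) := by
      intro b
      simp only [trans, Prog.seq]
      rcases P.step b l s with ⟨_ | l', s'⟩
      · rw [ex_none]
        exact (hQ (t + t') (some Q.start, s')).trans_le (Q.ex_anti f (by omega) _)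
      · exact ih l' s'
    gcongr <;> apply key

/-- Run `H`; if afterwards the registers satisfy `c`, run `B` and repeat; otherwise halt. -/
def loop (H : Prog Ms) (c : Option Bool → Option Bool → Bool) (B : Prog Ms) : Prog Ms where
  Λ := H.Λ ⊕ B.Λ
  start := .inl H.start
  step b
    | .inl l, s => match H.step b l s with
      | (some l', s') => (some (.inl l'), s')
      | (none, s') => (if c s'.r1 s'.r2 then some (.inr B.start) else none, s')
    | .inr l, s => match B.step b l s with
      | (some l', s') => (some (.inr l'), s')
      | (none, s') => (some (.inl H.start), s')
  real b l := by
    rcases l with l | l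
    · obtain ⟨q, hq⟩ := H.real b l
      refine ⟨q.relabel .inl (.branch (fun v => c v.r1 v.r2) (.goto fun _ => .inr B.start) .halt),
        fun v S => ?_⟩
      rw [stepAux_relabel]
      simp only [← hq v S]
      rcases stepAux q v S with ⟨_ | l, v', S'⟩
      · cases h : c v'.r1 v'.r2 <;> simp [view, h]
      · rfl
    · obtain ⟨q, hq⟩ := B.real b l
      refine ⟨q.relabel .inr (.goto fun _ => .inl H.start), fun v S => ?_⟩
      rw [stepAux_relabel]
      simp only [← hq v S]
      rcases stepAux q v S with ⟨_ | l, v', S'⟩ <;> rfl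

lemma Coinless.loop {P Q : Prog Ms} (hP : P.Coinless) (hQ : Q.Coinless)
    (c : Option Bool → Option Bool → Bool) : (P.loop c Q).Coinless := by
  unfold Coinless Prog.loop at *
  simp only [hP, hQ]

/-- One unfolding of the loop: `t₁` steps for the test, `t₂` for the body and `t'` for the remaining
rounds. Loops are then treated by induction on the number of rounds. -/
lemma wp_loop {H B : Prog Ms} {c : Option Bool → Option Bool → Bool} (t₁ t₂ t' : ℕ) (s : St Ms)
    (f : St Ms → ℝ≥0∞) :
    (H.loop c B).wp (t₁ + (t₂ + t')) s f ≤ H.wp t₁ s fun s' =>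
      if c s'.r1 s'.r2 then B.wp t₂ s' fun s'' => (H.loop c B).wp t' s'' f else f s' := by
  have hB : ∀ (t : ℕ) (l : B.Λ) (s : St Ms),
      ex (H.loop c B).trans (t + t') (some (.inr l), s) (halted f)
        ≤ ex B.trans t (some l, s) (halted fun s' => (H.loop c B).wp t' s' f) := by
    intro t
    induction t with
    | zero => intros; exact le_top
    | succ t ih =>
      intro l s
      rw [show t + 1 + t' = (t + t') + 1 by omega, ex, ex]
      have key : ∀ b, ex (H.loop c B).trans (t + t')
          ((H.loop c B).trans b (some (.inr l), s)) (halted f)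
          ≤ ex B.trans t (B.trans b (some l, s)) (halted fun s' => (H.loop c B).wp t' s' f) := by
        intro b
        simp only [trans, Prog.loop]
        rcases B.step b l s with ⟨_ | l', s'⟩
        · rw [ex_none]
          exact (H.loop c B).ex_anti f (by omega) _
        · exact ih l' s'
      gcongr <;> apply key
  suffices HH : ∀ (t : ℕ) (l : H.Λ) (s : St Ms),
      ex (H.loop c B).trans (t + (t₂ + t')) (some (.inl l), s) (halted f)
        ≤ ex H.trans t (some l, s) (halted fun s' =>
          if c s'.r1 s'.r2 then B.wp t₂ s' fun s'' => (H.loop c B).wp t' s'' f else f s')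
      from HH t₁ _ s
  intro t
  induction t with
  | zero => intros; exact le_top
  | succ t ih =>
    intro l s
    rw [show t + 1 + (t₂ + t') = (t + (t₂ + t')) + 1 by omega, ex, ex]
    have key : ∀ b, ex (H.loop c B).trans (t + (t₂ + t'))
        ((H.loop c B).trans b (some (.inl l), s)) (halted f)
        ≤ ex H.trans t (H.trans b (some l, s)) (halted fun s' =>
          if c s'.r1 s'.r2 then B.wp t₂ s' fun s'' => (H.loop c B).wp t' s'' f else f s') := by
      intro b
      simp only [trans, Prog.loop]
      rcases H.step b l s with ⟨_ | l', s'⟩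
      · rw [ex_none]
        dsimp only
        split_ifs with hc
        · exact ((H.loop c B).ex_anti f (by omega) _).trans (hB t₂ B.start s')
        · exact ((H.loop c B).ex_none _ _ _).le
      · exact ih l' s'
    gcongr <;> apply key

end Prog

/-! ### Compilation of programs to machines -/

section Compile

open Classical in
/-- A statement that carries out `φ` (if there is any). -/
noncomputable def stmtOf {Λ : Type} (φ : St Ms → Option Λ × St Ms) :
    Stmt (Γ Ms) Λ (Var Ms) :=
  if h : Realizable φ then h.choose else .halt

lemma stmtOf_spec {Λ : Type} {φ : St Ms → Option Λ × St Ms} (h : Realizable φ)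
    (v : Var Ms) (S : ∀ k, List (Γ Ms k)) :
    ((stepAux (stmtOf φ) v S).l, view (stepAux (stmtOf φ) v S).var (stepAux (stmtOf φ) v S).stk)
      = φ (view v S) := by
  rw [stmtOf, dif_pos h]
  exact h.choose_spec v S

variable [Fintype I]

instance instFintypeΓ : ∀ k : K Ms, Fintype (Γ Ms k)
  | .inl _ => inferInstanceAs (Fintype Bool)
  | .inr p => inferInstanceAs (Fintype (Option ((Ms p.1).Γ p.2)))

noncomputable instance instFintypeVar : Fintype (Var Ms) :=
  Fintype.ofInjective
    (fun v : Var Ms => (v.flag, v.r1, v.r2, v.v)) (by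
      rintro ⟨a, b, c, d⟩ ⟨a', b', c', d'⟩ h
      simp_all)

variable (Ms) in
/-- The initial abstract state with inputs `x` and `y`. -/
def initSt (x y : List Bool) : St Ms where
  r1 := none
  r2 := none
  v i := (Ms i).init
  w := Function.update (Function.update (fun _ => []) 1 y) 0 x
  s _ _ := []

/-- The machine that runs the program `P`, with inputs on the work stacks `0` and `1` and output on
the work stack `2`. -/
noncomputable def Prog.compile (P : Prog Ms) : RTM where
  K := K Ms
  Γ := Γ Ms
  Λ := P.Λ
  σ := Var Ms
  start := P.start
  init := ⟨false, none, none, fun i => (Ms i).init⟩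
  kIn := .inl 0
  kAux := .inl 1
  kOut := .inl 2
  kIn_ne_kAux := by simp
  bitIn := Function.Embedding.refl Bool
  bitAux := Function.Embedding.refl Bool
  bitOut := Function.Embedding.refl Bool
  prog b l := stmtOf (P.step b l)

lemma Prog.Coinless.deterministic {P : Prog Ms} (h : P.Coinless) : P.compile.Deterministic := by
  unfold Prog.Coinless at h
  simp only [RTM.Deterministic, Prog.compile, h]

/-- `view` commutes with the steps of the compiled machine, so `ex_map` applies; what `view` forgets
never matters. -/
lemma Prog.ex_compile (P : Prog Ms) (t : ℕ) (x y : List Bool)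
    (F : Option P.Λ × St Ms → ℝ≥0∞) :
    ex P.compile.step t (P.compile.initCfg x y) (fun c => F (c.l, view (Ms := Ms) c.var c.stk))
      = ex P.trans t (some P.start, initSt Ms x y) F := by
  rw [← ex_map (ν := P.compile.step) (ν' := P.trans)
    (fun c => (c.l, view (Ms := Ms) c.var c.stk))]
  · congr 2
    simp only [view, RTM.initCfg, Prog.compile, initSt]
    congr 1
    · ext1 a
      by_cases h0 : a = 0
      · subst h0
        rw [Function.update_self]
        erw [Function.update_self]
        exact List.map_id x
      by_cases h1 : a = 1
      · subst h1
        rw [Function.update_of_ne h0, Function.update_self]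
        erw [Function.update_of_ne (by simp), Function.update_self]
        exact List.map_id y
      simp [Function.update, h0, h1]
  · rintro b ⟨_ | l, v, S⟩
    · rfl
    · exact (stmtOf_spec (P.real b l) v S).symm

end Compile

end Frame

/-! ### One-step operations and embedded machines -/

namespace Frame

variable {I : Type} {Ms : I → RTM} [DecidableEq I]

namespace St

/-- Pop the work stack `a` into the first register. -/
def pop (a : Fin 12) (s : St Ms) : St Ms :=
  { s with r1 := (s.w a).head?, w := Function.update s.w a (s.w a).tail }

/-- Pop the work stack `a` into the second register. -/
def pop2 (a : Fin 12) (s : St Ms) : St Ms :=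
  { s with r2 := (s.w a).head?, w := Function.update s.w a (s.w a).tail }

/-- Push a bit that depends on the registers (or nothing) onto the work stack `a`. -/
def push (a : Fin 12) (f : Option Bool → Option Bool → Option Bool) (s : St Ms) : St Ms :=
  { s with w := Function.update s.w a ((f s.r1 s.r2).toList ++ s.w a) }

/-- Prepare the machine `i` for a new computation. -/
def reset (i : I) (s : St Ms) : St Ms :=
  { s with v := Function.update s.v i (Ms i).init, s := Function.update s.s i fun _ => [] }

/-- Push a symbol that depends on the registers (or nothing) onto the stack `k` of machine `i`. -/
def spush (i : I) (k : (Ms i).K) (f : Option Bool → Option Bool → Option ((Ms i).Γ k))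
    (s : St Ms) : St Ms :=
  { s with
    s := Function.update s.s i
      (Function.update (s.s i) k ((f s.r1 s.r2).toList ++ s.s i k)) }

/-- Pop the stack `k` of machine `i` into the first register. -/
def spop (i : I) (k : (Ms i).K) (d : (Ms i).Γ k → Bool) (s : St Ms) : St Ms :=
  { s with
    r1 := (s.s i k).head?.map d
    s := Function.update s.s i (Function.update (s.s i) k (s.s i k).tail) }

end St

omit [DecidableEq I] in
lemma update_inl_inr (S : ∀ k, List (Γ Ms k)) [DecidableEq (K Ms)] (a : Fin 12) (l : List Bool)
    (p : Σ i, (Ms i).K) :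
    Function.update S (.inl a) l (.inr p) = S (.inr p) :=
  Function.update_of_ne (by simp) _ _

lemma view_update_inl (v : Var Ms) (S : ∀ k, List (Γ Ms k)) (a : Fin 12) (l : List Bool) :
    view v (Function.update S (.inl a) l)
      = { view v S with w := Function.update (view v S).w a l } := by
  simp only [view, update_inl_inr, St.mk.injEq, true_and, and_true]
  ext1 b
  by_cases h : b = a
  · subst h; rw [Function.update_self, Function.update_self]
  · rw [Function.update_of_ne h, Function.update_of_ne (by simpa using h)]

lemma view_update_inr (v : Var Ms) (S : ∀ k, List (Γ Ms k)) (i : I) (k : (Ms i).K)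
    (l : List (Option ((Ms i).Γ k))) :
    view v (Function.update S (.inr ⟨i, k⟩) l)
      = { view v S with
          s := Function.update (view v S).s i
            (Function.update ((view v S).s i) k (visible l)) } := by
  simp only [view, St.mk.injEq, true_and]
  refine ⟨?_, ?_⟩
  · ext1 b
    rw [Function.update_of_ne (by simp)]
  · ext1 j
    by_cases h : j = i
    · subst h
      rw [Function.update_self]
      ext1 k'
      by_cases h : k' = k
      · subst h; rw [Function.update_self, Function.update_self]
      · rw [Function.update_of_ne h, Function.update_of_ne (by simpa using h)]
    · rw [Function.update_of_ne h]
      ext1 k'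
      rw [Function.update_of_ne]
      intro h'
      simp only [Sum.inr.injEq, Sigma.mk.injEq] at h'
      exact h h'.1

lemma implementable_pop (a : Fin 12) : Implementable (St.pop (Ms := Ms) a) :=
  ⟨fun _ q => .pop (.inl a) (fun v o => { v with r1 := o }) q, fun _ _ v S =>
    ⟨_, _, by rw [stepAux], by rw [view_update_inl]; rfl⟩⟩

lemma implementable_pop2 (a : Fin 12) : Implementable (St.pop2 (Ms := Ms) a) :=
  ⟨fun _ q => .pop (.inl a) (fun v o => { v with r2 := o }) q, fun _ _ v S =>
    ⟨_, _, by rw [stepAux], by rw [view_update_inl]; rfl⟩⟩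

lemma implementable_push (a : Fin 12) (f : Option Bool → Option Bool → Option Bool) :
    Implementable (St.push (Ms := Ms) a f) := by
  refine ⟨fun _ q => .branch (fun v => (f v.r1 v.r2).isSome)
    (.push (.inl a) (fun v => (f v.r1 v.r2).getD false) q) q, fun _ q v S => ?_⟩
  rcases h : f v.r1 v.r2 with _ | b
  · exact ⟨v, S, by simp [h], by simp [St.push, view, h]⟩
  · exact ⟨v, Function.update S (.inl a) (b :: S (.inl a)), by simp [h],
      by rw [view_update_inl]; simp [St.push, view, h]⟩

lemma implementable_spush (i : I) (k : (Ms i).K)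
    (f : Option Bool → Option Bool → Option ((Ms i).Γ k)) :
    Implementable (St.spush (Ms := Ms) i k f) := by
  refine ⟨fun _ q => .branch (fun v => (f v.r1 v.r2).isSome)
    (.push (.inr ⟨i, k⟩) (fun v => f v.r1 v.r2) q) q, fun _ q v S => ?_⟩
  rcases h : f v.r1 v.r2 with _ | b
  · exact ⟨v, S, by simp [h], by simp [St.spush, view, h]⟩
  · refine ⟨v, Function.update S (.inr ⟨i, k⟩) (some b :: S (.inr ⟨i, k⟩)), by simp [h], ?_⟩
    rw [view_update_inr]
    simp [St.spush, view, h, visible]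

/-- Pop the stack `k` of machine `i`, but leave the bottom marker where it is. -/
def popStmt {Λ : Type} (i : I) (k : (Ms i).K)
    (g : Var Ms → Option ((Ms i).Γ k) → Var Ms) (q : Stmt (Γ Ms) Λ (Var Ms)) :
    Stmt (Γ Ms) Λ (Var Ms) :=
  .pop (.inr ⟨i, k⟩) (fun v o => { g v o.join with
    flag := match o with
      | some none => true
      | _ => false })
    (.branch (fun v => v.flag) (.push (.inr ⟨i, k⟩) (fun _ => none) q) q)

/-- The flag is set and read within a single step and is invisible to `view`, so its final value may
stay unspecified. -/
lemma stepAux_popStmt {Λ : Type} (i : I) (k : (Ms i).K)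
    (g : Var Ms → Option ((Ms i).Γ k) → Var Ms) (q : Stmt (Γ Ms) Λ (Var Ms)) (v : Var Ms)
    (S : ∀ k, List (Γ Ms k)) : ∃ b S', stepAux (popStmt i k g q) v S
      = stepAux q { g v ((view v S).s i k).head? with flag := b } S' ∧
      ∀ v, view v S' = { view v S with
        s := Function.update (view v S).s i
          (Function.update ((view v S).s i) k ((view v S).s i k).tail) } := by
  rcases h : S (.inr ⟨i, k⟩) with _ | ⟨_ | a, l⟩
  · refine ⟨false, Function.update S (.inr ⟨i, k⟩) [], ?_, fun v => ?_⟩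
    · simp [popStmt, h, view, visible]
    · rw [view_update_inr]
      simp [view, h, visible]
  · refine ⟨true, S, ?_, fun v => ?_⟩
    · simp only [popStmt, h, view, visible, stepAux, List.head?, List.tail, Option.join, cond,
        Function.update_self, Function.update_idem]
      rw [← h, Function.update_eq_self]
      rfl
    · simp [view, h, visible]
  · refine ⟨false, Function.update S (.inr ⟨i, k⟩) l, ?_, fun v => ?_⟩
    · simp [popStmt, h, view, visible]
    · rw [view_update_inr]
      simp [view, h, visible]

lemma implementable_spop (i : I) (k : (Ms i).K) (d : (Ms i).Γ k → Bool) :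
    Implementable (St.spop (Ms := Ms) i k d) := by
  refine ⟨fun _ q => popStmt i k (fun v o => { v with r1 := o.map d }) q, fun _ q v S => ?_⟩
  obtain ⟨b, S', h1, h2⟩ := stepAux_popStmt i k (fun v o => { v with r1 := o.map d }) q v S
  refine ⟨_, _, h1, ?_⟩
  rw [h2]
  rfl

lemma implementable_id : Implementable (fun s : St Ms => s) :=
  ⟨fun _ q => q, fun _ _ v S => ⟨v, S, rfl, rfl⟩⟩

/-- Leftovers of an earlier computation need not be erased: a marker pushed on each of the finitely
many stacks hides them, all within one step. -/
lemma implementable_reset (i : I) : Implementable (St.reset (Ms := Ms) i) := by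
  have h1 : Implementable (fun s : St Ms =>
      { s with v := Function.update s.v i (Ms i).init }) :=
    ⟨fun _ q => .load (fun v => { v with v := Function.update v.v i (Ms i).init }) q,
      fun _ _ v S => ⟨_, _, by rw [stepAux], rfl⟩⟩
  have h2 : ∀ L : List (Ms i).K, Implementable (fun s : St Ms =>
      { s with s := Function.update s.s i fun k => if k ∈ L then [] else s.s i k }) := by
    intro L
    induction L with
    | nil => simpa using implementable_id
    | cons k L ih =>
      have h3 : Implementable (fun s : St Ms =>
          { s with s := Function.update s.s i (Function.update (s.s i) k []) }) :=
        ⟨fun _ q => .push (.inr ⟨i, k⟩) (fun _ => none) q, fun _ _ v S =>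
          ⟨_, _, by rw [stepAux], by rw [view_update_inr]; simp [visible]⟩⟩
      convert ih.comp h3 using 2 with s
      simp only [Function.update_self, Function.update_idem, St.mk.injEq, true_and]
      congr 1
      ext1 k'
      by_cases hk : k' = k
      · subst hk; simp
      · simp [hk]
  convert (h2 Finset.univ.toList).comp h1 using 2 with s
  simp [St.reset]

/-- The statement `q` of the machine `i` as a statement of the large machine. -/
def lift (i : I) : Stmt (Ms i).Γ (Ms i).Λ (Ms i).σ → Stmt (Γ Ms) (Ms i).Λ (Var Ms)
  | .push k f q => .push (.inr ⟨i, k⟩) (fun v => some (f (v.v i))) (lift i q)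
  | .peek k f q => .peek (.inr ⟨i, k⟩)
      (fun v o => { v with v := Function.update v.v i (f (v.v i) o.join) }) (lift i q)
  | .pop k f q => popStmt i k
      (fun v o => { v with v := Function.update v.v i (f (v.v i) o) }) (lift i q)
  | .load f q => .load (fun v => { v with v := Function.update v.v i (f (v.v i)) }) (lift i q)
  | .branch p q₁ q₂ => .branch (fun v => p (v.v i)) (lift i q₁) (lift i q₂)
  | .goto l => .goto fun v => l (v.v i)
  | .halt => .halt

/-- The state with the internal state and the stacks of machine `i` replaced by those of `c`. -/
def St.setSlot (s : St Ms) (i : I) (c : (Ms i).Cfg) : St Ms :=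
  { s with v := Function.update s.v i c.var, s := Function.update s.s i c.stk }

/-- The embedded machine cannot notice the bottom markers: on its visible stacks and internal state
the lifted statement acts exactly as the original one. -/
lemma stepAux_lift (i : I) (q : Stmt (Ms i).Γ (Ms i).Λ (Ms i).σ) (v : Var Ms)
    (S : ∀ k, List (Γ Ms k)) :
    ((stepAux (lift i q) v S).l, view (stepAux (lift i q) v S).var (stepAux (lift i q) v S).stk)
      = ((stepAux q ((view v S).v i) ((view v S).s i)).l,
        (view v S).setSlot i (stepAux q ((view v S).v i) ((view v S).s i))) := by
  induction q generalizing v S with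
  | push k f q ih =>
    simp only [lift, stepAux]
    rw [ih, view_update_inr]
    simp [St.setSlot, view, visible]
  | peek k f q ih =>
    simp only [lift, stepAux]
    rw [ih]
    have : (S (.inr ⟨i, k⟩)).head?.join = (visible (S (.inr ⟨i, k⟩))).head? := by
      rcases S (.inr ⟨i, k⟩) with _ | ⟨_ | a, l⟩ <;> rfl
    simp [St.setSlot, view, this]
  | pop k f q ih =>
    simp only [lift, stepAux]
    obtain ⟨b, S', h1, h2⟩ := stepAux_popStmt i k
      (fun v o => { v with v := Function.update v.v i (f (v.v i) o) }) (lift i q) v S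
    rw [h1, ih, h2]
    simp [St.setSlot, view]
  | load f q ih =>
    simp only [lift, stepAux]
    rw [ih]
    simp [St.setSlot, view]
  | branch p q₁ q₂ ih₁ ih₂ =>
    simp only [lift, stepAux]
    cases h : p (v.v i)
    · have h' : p ((view v S).v i) = false := h
      simp only [h', cond, ih₂]
    · have h' : p ((view v S).v i) = true := h
      simp only [h', cond, ih₁]
  | goto l => simp [lift, St.setSlot, view]
  | halt => simp [lift, St.setSlot, view]

namespace Prog

variable (Ms) in
/-- Run the machine `i` on its current stacks. -/
def exec (i : I) : Prog Ms where
  Λ := (Ms i).Λ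
  start := (Ms i).start
  step b l s := ((stepAux ((Ms i).prog b l) (s.v i) (s.s i)).l,
    s.setSlot i (stepAux ((Ms i).prog b l) (s.v i) (s.s i)))
  real b l := ⟨lift i ((Ms i).prog b l), fun v S => stepAux_lift i _ v S⟩

variable (Ms) in
/-- Run the machine `i` on its current stacks, for at most as many steps as the work stack `a` has
symbols. -/
def execClocked (i : I) (a : Fin 12) : Prog Ms where
  Λ := (Ms i).Λ
  start := (Ms i).start
  step b l s := if (s.w a).head?.isSome then
      ((stepAux ((Ms i).prog b l) (s.v i) (s.s i)).l,
        (s.pop a).setSlot i (stepAux ((Ms i).prog b l) (s.v i) (s.s i)))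
    else (none, s.pop a)
  real b l := by
    refine ⟨.pop (.inl a) (fun v o => { v with r1 := o })
      (.branch (fun v => v.r1.isSome) (lift i ((Ms i).prog b l)) .halt), fun v S => ?_⟩
    simp only [stepAux]
    have hv : view (Ms := Ms) { v with r1 := (S (.inl a)).head? }
        (Function.update S (.inl a) (S (.inl a)).tail) = (view v S).pop a := by
      rw [view_update_inl]; rfl
    change (_, _) = if (S (.inl a)).head?.isSome = true then _ else _
    cases h : (S (.inl a)).head?.isSome
    · simp [← hv]
    · simp only [cond, if_true]
      rw [stepAux_lift, hv]
      rfl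

lemma wp_exec (i : I) (t : ℕ) (s : St Ms) (f : St Ms → ℝ≥0∞) :
    (exec Ms i).wp t s f = ex (Ms i).step t ⟨some (Ms i).start, s.v i, s.s i⟩
      (RTM.onHalt fun c => f (s.setSlot i c)) := by
  have hs : s = s.setSlot i ⟨some (Ms i).start, s.v i, s.s i⟩ := by simp [St.setSlot]
  have key := ex_map (ν := (Ms i).step) (ν' := (exec Ms i).trans)
    (fun c => (c.l, s.setSlot i c)) (by
      rintro b ⟨_ | l, v, S⟩
      · rfl
      · simp [trans, exec, RTM.step, St.setSlot]) (halted f) t ⟨some (Ms i).start, s.v i, s.s i⟩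
  simp only [← hs] at key
  refine Eq.trans key ?_
  congr 1
  ext1 ⟨l, v, S⟩
  rcases l with _ | l <;> simp [halted, RTM.onHalt]

/-- The clock forces a halt, so `F` is evaluated on all configurations, halted or not. The
additional step is the one that finds the clock empty. -/
lemma wp_execClocked (i : I) (a : Fin 12) (s : St Ms) (f : St Ms → ℝ≥0∞)
    (F : (Ms i).Cfg → ℝ≥0∞)
    (h : ∀ r l c, f (({ s with r1 := r, w := Function.update s.w a l } : St Ms).setSlot i c)
      ≤ F c) :
    (execClocked Ms i a).wp ((s.w a).length + 1) s f
      ≤ ex (Ms i).step (s.w a).length ⟨some (Ms i).start, s.v i, s.s i⟩ F := by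
  suffices H : ∀ (N : ℕ) (r : Option Bool) (l : List Bool) (c : (Ms i).Cfg), l.length = N →
      ex (execClocked Ms i a).trans (N + 1)
        (c.l, ({ s with r1 := r, w := Function.update s.w a l } : St Ms).setSlot i c) (halted f)
        ≤ ex (Ms i).step N c F by
    have := H _ s.r1 (s.w a) ⟨some (Ms i).start, s.v i, s.s i⟩ rfl
    simp only [St.setSlot, Function.update_eq_self] at this
    exact this
  intro N
  induction N with
  | zero =>
    rintro r l ⟨_ | m, v, S⟩ hl
    · exact ((execClocked Ms i a).ex_none _ _ _).trans_le (h _ _ _)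
    · rw [List.length_eq_zero_iff] at hl
      subst hl
      simp only [ex, trans, execClocked, St.setSlot, Function.update_self, List.head?,
        Option.isSome]
      simpa [half_add_half, halted, St.pop, St.setSlot] using h none [] ⟨some m, v, S⟩
  | succ N ih =>
    rintro r l ⟨_ | m, v, S⟩ hl
    · rw [ex_fixed (ν := (Ms i).step) (by intro b; rfl)]
      exact ((execClocked Ms i a).ex_none _ _ _).trans_le (h _ _ _)
    · obtain ⟨x, l, rfl⟩ := List.exists_cons_of_length_eq_add_one hl
      have key : ∀ b, ex (execClocked Ms i a).trans (N + 1)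
          ((execClocked Ms i a).trans b (some m,
            ({ s with r1 := r, w := Function.update s.w a (x :: l) } : St Ms).setSlot i
              ⟨some m, v, S⟩)) (halted f)
          ≤ ex (Ms i).step N ((Ms i).step b ⟨some m, v, S⟩) F := by
        intro b
        refine le_trans (le_of_eq ?_) (ih (some x) l _ (by simpa using hl))
        congr 1
        simp [trans, execClocked, St.setSlot, St.pop, RTM.step]
      exact ENNReal.div_le_div_right (add_le_add (key false) (key true)) _

end Prog

end Frame

/-! ### Deterministic stack routines -/

/-- The next string in the length-lexicographic order (least significant bit first). -/
def bsucc : List Bool → List Bool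
  | [] => [false]
  | false :: l => true :: l
  | true :: l => false :: bsucc l

/-- The number with binary digits `x` (least significant bit first). -/
def bval : List Bool → ℕ
  | [] => 0
  | b :: l => b.toNat + 2 * bval l

namespace Frame

variable {I : Type} {Ms : I → RTM} [DecidableEq I]

namespace Prog

/-- `P` leads within `t` steps from `s` to `s'`, whatever the coins are. -/
def Det (P : Prog Ms) (t : ℕ) (s s' : St Ms) : Prop := ∀ f, P.wp t s f ≤ f s'

lemma Det.mono {P : Prog Ms} {t t' : ℕ} {s s' : St Ms} (h : P.Det t s s') (ht : t ≤ t') :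
    P.Det t' s s' := fun f => (wp_anti ht s f).trans (h f)

lemma Det.conv {P : Prog Ms} {t t' : ℕ} {s s₁ s' : St Ms} (h : P.Det t s s₁) (ht : t ≤ t')
    (hs : s₁ = s') : P.Det t' s s' := hs ▸ h.mono ht

lemma Det.seq {P Q : Prog Ms} {t t' : ℕ} {s s' s'' : St Ms} (hP : P.Det t s s')
    (hQ : Q.Det t' s' s'') : (P.seq Q).Det (t + t') s s'' := fun f =>
  (wp_seq _ _ _ _).trans ((hP _).trans (hQ f))

lemma Det.wp_seq_le {P Q : Prog Ms} {t t' : ℕ} {s s' : St Ms} (hP : P.Det t s s')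
    (f : St Ms → ℝ≥0∞) : (P.seq Q).wp (t + t') s f ≤ Q.wp t' s' f :=
  (wp_seq _ _ _ _).trans (hP _)

lemma Det.prim {op : St Ms → St Ms} {h : Implementable op} {s : St Ms} :
    (prim op h).Det 1 s (op s) := fun f => (wp_prim s f).le

lemma Det.loop_step {H B : Prog Ms} {c : Option Bool → Option Bool → Bool} {t₁ t₂ t' : ℕ}
    {s s₁ s₂ s' : St Ms} (hH : H.Det t₁ s s₁) (hc : c s₁.r1 s₁.r2 = true) (hB : B.Det t₂ s₁ s₂)
    (h : (H.loop c B).Det t' s₂ s') : (H.loop c B).Det (t₁ + (t₂ + t')) s s' := fun f => by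
  refine (wp_loop _ _ _ _ _).trans ((hH _).trans ?_)
  simp only [hc, if_true]
  exact (hB _).trans (h f)

lemma Det.loop_exit {H B : Prog Ms} {c : Option Bool → Option Bool → Bool} {t₁ : ℕ}
    {s s₁ : St Ms} (hH : H.Det t₁ s s₁) (hc : c s₁.r1 s₁.r2 = false) :
    (H.loop c B).Det t₁ s s₁ := fun f => by
  refine (wp_loop t₁ 0 0 _ _).trans ((hH _).trans ?_)
  simp [hc]

variable (Ms) in
/-- Pop the work stack `a` into the first register. -/
def pop (a : Fin 12) : Prog Ms := prim (St.pop a) (implementable_pop a)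

variable (Ms) in
/-- Pop the work stack `a` into the second register. -/
def pop2 (a : Fin 12) : Prog Ms := prim (St.pop2 a) (implementable_pop2 a)

variable (Ms) in
/-- Push a bit that depends on the registers onto the work stack `a`. -/
def push (a : Fin 12) (f : Option Bool → Option Bool → Option Bool) : Prog Ms :=
  prim (St.push a f) (implementable_push a f)

/-- Pop `a` as long as possible and carry out `B` for every symbol. -/
def each (a : Fin 12) (B : Prog Ms) : Prog Ms := (pop Ms a).loop (fun r _ => r.isSome) B

lemma Coinless.each {B : Prog Ms} (h : B.Coinless) (a : Fin 12) : (each a B).Coinless :=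
  (prim_coinless _).loop h _

lemma _root_.Function.update_nil_of_eq {α β : Type*} [DecidableEq α] {w : α → List β} {a : α}
    (h : w a = []) : Function.update w a [] = w := by
  rw [← h, Function.update_eq_self]

lemma Det.each_nil {a : Fin 12} {B : Prog Ms} {s : St Ms} (h : s.w a = []) :
    (each a B).Det 1 s { s with r1 := none } := by
  refine Det.loop_exit (s₁ := { s with r1 := none }) ?_ rfl
  refine Det.prim.conv le_rfl ?_
  simp [St.pop, h, Function.update_nil_of_eq h]

lemma Det.each_cons {a : Fin 12} {B : Prog Ms} {s s₂ s' : St Ms} {x : Bool} {l : List Bool}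
    {t t' : ℕ} (h : s.w a = x :: l)
    (hB : B.Det t { s with r1 := some x, w := Function.update s.w a l } s₂)
    (h' : (each a B).Det t' s₂ s') : (each a B).Det (1 + (t + t')) s s' := by
  refine Det.loop_step (s₁ := { s with r1 := some x, w := Function.update s.w a l }) ?_ rfl hB h'
  refine Det.prim.conv le_rfl ?_
  simp [St.pop, h]

/-- The invariant `G l s` is the final state of the loop started at `s` with `l` on the stack. -/
lemma Det.each_of {a : Fin 12} {B : Prog Ms} (G : List Bool → St Ms → St Ms) (Inv : St Ms → Prop)
    (t : ℕ) (h0 : ∀ s, Inv s → s.w a = [] → G [] s = { s with r1 := none })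
    (h1 : ∀ x l s, Inv s → s.w a = x :: l → ∃ s₂,
      B.Det t { s with r1 := some x, w := Function.update s.w a l } s₂ ∧ Inv s₂ ∧ s₂.w a = l ∧
      G (x :: l) s = G l s₂) (s : St Ms) (hs : Inv s) :
    (each a B).Det ((s.w a).length * (t + 1) + 1) s (G (s.w a) s) := by
  generalize hl : s.w a = l
  induction l generalizing s with
  | nil =>
    rw [h0 s hs hl]
    exact (Det.each_nil hl).mono (by simp)
  | cons x l ih =>
    obtain ⟨s₂, hB, hi, hw, hG⟩ := h1 x l s hs hl
    rw [hG]
    refine (Det.each_cons hl hB (ih s₂ hi hw)).mono ?_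
    simp only [List.length_cons]
    ring_nf
    omega

lemma wp_each_nil {a : Fin 12} {B : Prog Ms} {s : St Ms} (h : s.w a = []) (f : St Ms → ℝ≥0∞) :
    (each a B).wp 1 s f ≤ f { s with r1 := none } := Det.each_nil h f

lemma wp_each_cons {a : Fin 12} {B : Prog Ms} {s : St Ms} {x : Bool} {l : List Bool}
    (t t' : ℕ) (h : s.w a = x :: l) (f : St Ms → ℝ≥0∞) :
    (each a B).wp (1 + (t + t')) s f ≤
      B.wp t { s with r1 := some x, w := Function.update s.w a l }
        fun s' => (each a B).wp t' s' f := by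
  refine (wp_loop _ _ _ _ _).trans ?_
  refine (wp_prim _ _).trans_le ?_
  simp [St.pop, h, each]

variable (Ms) in
/-- Move the symbols of the work stack `a` to the work stack `b` (in reverse order), replacing them
by `o` if this is not `none`. -/
def move (a b : Fin 12) (o : Option Bool) : Prog Ms := each a (push Ms b fun r _ => o.or r)

lemma move_coinless (a b : Fin 12) (o : Option Bool) : (move Ms a b o).Coinless :=
  (prim_coinless _).each a

lemma det_move {a b : Fin 12} (hab : a ≠ b) (o : Option Bool) (s : St Ms) :
    (move Ms a b o).Det (2 * (s.w a).length + 1) s { s with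
      r1 := none
      w := Function.update (Function.update s.w a []) b
        ((s.w a).reverse.map (fun x => o.getD x) ++ s.w b) } := by
  refine (Det.each_of (fun l s => { s with
      r1 := none
      w := Function.update (Function.update s.w a []) b
        (l.reverse.map (fun x => o.getD x) ++ s.w b) }) (fun _ => True) 1 ?_ ?_ s trivial).mono
    (by omega)
  · intro s _ h
    simp [Function.update_nil_of_eq h]
  · intro x l s _ h
    refine ⟨_, Det.prim, trivial, ?_, ?_⟩
    · simp [St.push, hab]
    · simp only [St.push, St.mk.injEq, true_and, and_true]
      rw [Function.update_of_ne hab.symm, Function.update_self]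
      cases o <;>
        simp [Function.update_comm hab]

variable (Ms) in
/-- Move the symbols of the work stack `a` to the work stacks `b` and `c` (in reverse order),
replacing those on `c` by `o` if this is not `none`. -/
def move2 (a b c : Fin 12) (o : Option Bool) : Prog Ms :=
  each a ((push Ms b fun r _ => r).seq (push Ms c fun r _ => o.or r))

lemma det_move2 {a b c : Fin 12} (hab : a ≠ b) (hac : a ≠ c) (hbc : b ≠ c) (o : Option Bool)
    (s : St Ms) :
    (move2 Ms a b c o).Det (3 * (s.w a).length + 1) s { s with
      r1 := none
      w := Function.update (Function.update (Function.update s.w a []) b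
        ((s.w a).reverse ++ s.w b)) c ((s.w a).reverse.map (fun x => o.getD x) ++ s.w c) } := by
  refine (Det.each_of (fun l s => { s with
      r1 := none
      w := Function.update (Function.update (Function.update s.w a []) b
        (l.reverse ++ s.w b)) c (l.reverse.map (fun x => o.getD x) ++ s.w c) })
        (fun _ => True) 2 ?_ ?_ s trivial).mono (by omega)
  · intro s _ h
    simp [Function.update_nil_of_eq h]
  · intro x l s _ h
    refine ⟨_, Det.prim.seq Det.prim, trivial, ?_, ?_⟩
    · simp [St.push, hab, hac]
    · simp only [St.push, St.mk.injEq, true_and, and_true]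
      ext1 z
      by_cases hz1 : z = c
      · subst hz1; cases o <;> simp [hac.symm, hbc.symm]
      by_cases hz2 : z = b
      · subst hz2; simp [hz1, hab.symm]
      by_cases hz3 : z = a
      · subst hz3; simp [hz1, hz2]
      simp [hz1, hz2, hz3]

variable (Ms) in
/-- Copy the work stack `a` onto the work stack `b`, replacing the symbols by `o` if this is not
`none`; `t` is an empty stack. -/
def copy (a b t : Fin 12) (o : Option Bool) : Prog Ms := (move Ms a t none).seq (move2 Ms t a b o)

lemma det_copy {a b t : Fin 12} (hab : a ≠ b) (hat : a ≠ t) (hbt : b ≠ t) (o : Option Bool)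
    (s : St Ms) (ht : s.w t = []) :
    (copy Ms a b t o).Det (5 * (s.w a).length + 2) s { s with
      r1 := none
      w := Function.update s.w b ((s.w a).map (fun x => o.getD x) ++ s.w b) } := by
  refine ((det_move hat none s).seq (det_move2 hat.symm hbt.symm hab o _)).conv ?_ ?_
  · simp [ht]; omega
  · simp only [Function.update_self, ht, St.mk.injEq, true_and, and_true]
    ext1 z
    by_cases hz1 : z = b
    · subst hz1; simp [hab.symm, hbt]
    by_cases hz2 : z = a
    · subst hz2; simp [hz1, hat]
    by_cases hz3 : z = t
    · subst hz3; simp [hz1, hz2, ht]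
    simp [hz1, hz2, hz3]

variable (Ms) in
/-- Copy the work stack `a` onto the stack `k` of machine `i` with the encoding `e`. -/
def copyTo (a t : Fin 12) (i : I) (k : (Ms i).K) (e : Bool → (Ms i).Γ k) : Prog Ms :=
  (move Ms a t none).seq (each t ((push Ms a fun r _ => r).seq
    (prim (St.spush i k fun r _ => r.map e) (implementable_spush i k _))))

lemma det_copyTo {a t : Fin 12} (hat : a ≠ t) (i : I) (k : (Ms i).K) (e : Bool → (Ms i).Γ k)
    (s : St Ms) (ht : s.w t = []) :
    (copyTo Ms a t i k e).Det (5 * (s.w a).length + 2) s { s with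
      r1 := none
      s := Function.update s.s i (Function.update (s.s i) k ((s.w a).map e ++ s.s i k)) } := by
  have h2 : ∀ s : St Ms, (each t ((push Ms a fun r _ => r).seq
      (prim (St.spush i k fun r _ => r.map e) (implementable_spush i k _)))).Det
      (3 * (s.w t).length + 1) s { s with
        r1 := none
        w := Function.update (Function.update s.w t []) a ((s.w t).reverse ++ s.w a)
        s := Function.update s.s i
          (Function.update (s.s i) k ((s.w t).reverse.map e ++ s.s i k)) } := by
    intro s
    refine (Det.each_of (fun l s => { s with
        r1 := none
        w := Function.update (Function.update s.w t []) a (l.reverse ++ s.w a)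
        s := Function.update s.s i
          (Function.update (s.s i) k (l.reverse.map e ++ s.s i k)) })
          (fun _ => True) 2 ?_ ?_ s trivial).mono (by omega)
    · intro s _ h
      simp [Function.update_nil_of_eq h]
    · intro x l s _ h
      refine ⟨_, Det.prim.seq Det.prim, trivial, ?_, ?_⟩
      · simp [St.push, St.spush, hat.symm]
      · simp [St.push, St.spush, hat, Function.update_comm hat]
  refine ((det_move hat none s).seq (h2 _)).conv ?_ ?_
  · simp [ht]; omega
  · simp [ht]
    ext1 z
    by_cases hz2 : z = a
    · subst hz2; simp [hat]
    by_cases hz3 : z = t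
    · subst hz3; simp [hz2, ht]
    simp [hz2, hz3]

variable (Ms) in
/-- Pop the longest prefix of symbols `c` of the work stack `a` and one further symbol (into the
first register), and push `!c` on `t` for every symbol of the prefix. -/
def scan (a t : Fin 12) (c : Bool) : Prog Ms :=
  (pop Ms a).loop (fun r _ => r == some c) (push Ms t fun _ _ => some !c)

lemma det_scan {a t : Fin 12} (hat : a ≠ t) (c : Bool) (s : St Ms) :
    (scan Ms a t c).Det (2 * (s.w a).length + 1) s { s with
      r1 := ((s.w a).dropWhile (· = c)).head?
      w := Function.update (Function.update s.w a ((s.w a).dropWhile (· = c)).tail) t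
        (List.replicate ((s.w a).takeWhile (· = c)).length (!c) ++ s.w t) } := by
  generalize hl : s.w a = l
  induction l generalizing s with
  | nil =>
    refine (Det.loop_exit (s₁ := s.pop a) Det.prim (by simp [St.pop, hl])).conv (by simp) ?_
    simp [St.pop, hl, hat.symm]
  | cons x l ih =>
    by_cases hx : x = c
    · subst hx
      have := ih ((s.pop a).push t fun _ _ => some !x) (by simp [St.push, St.pop, hat, hl])
      refine (Det.loop_step (s₁ := s.pop a) Det.prim (by simp [St.pop, hl]) Det.prim this).conv
        ?_ ?_
      · simp only [List.length_cons]; omega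
      · simp [St.push, St.pop, hl, hat.symm, Function.update_comm hat, List.replicate_succ']
    · refine (Det.loop_exit (s₁ := s.pop a) Det.prim (by simp [St.pop, hl, hx])).conv (by simp) ?_
      simp [St.pop, hl, hx, hat.symm]

end Prog

end Frame

/-! ### Counters: successor, predecessor, unary conversion and table look-up -/

lemma bsucc_eq (x : List Bool) :
    bsucc x = List.replicate (x.takeWhile (· = true)).length false ++
      ((x.dropWhile (· = true)).head?.isSome :: (x.dropWhile (· = true)).tail) := by
  induction x with
  | nil => rfl
  | cons b l ih => cases b <;> simp [bsucc, ih, List.replicate_succ]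

lemma bval_replicate_false_append (n : ℕ) (l : List Bool) :
    bval (List.replicate n false ++ l) = 2 ^ n * bval l := by
  induction n with
  | zero => simp
  | succ n ih => simp [List.replicate_succ, bval, ih, pow_succ]; ring

lemma bval_replicate_true_append (n : ℕ) (l : List Bool) :
    bval (List.replicate n true ++ l) + 1 = 2 ^ n * (bval l + 1) := by
  induction n with
  | zero => simp
  | succ n ih => simp [List.replicate_succ, bval, pow_succ]; linarith

lemma takeWhile_false (x : List Bool) : x.takeWhile (· = false)
    = List.replicate (x.takeWhile (· = false)).length false := by
  rw [List.eq_replicate_iff]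
  exact ⟨rfl, fun b hb => by simpa using List.mem_takeWhile_imp hb⟩

/-- Either all bits of `x` vanish or `x` has a predecessor of the same length. -/
lemma bval_cases (x : List Bool) :
    ((x.dropWhile (· = false)).head? = none ∧ bval x = 0) ∨
    ((x.dropWhile (· = false)).head? = some true ∧
      bval x = bval (List.replicate (x.takeWhile (· = false)).length true ++
        false :: (x.dropWhile (· = false)).tail) + 1 ∧
      (List.replicate (x.takeWhile (· = false)).length true ++
        false :: (x.dropWhile (· = false)).tail).length = x.length) := by
  have hx := List.takeWhile_append_dropWhile (p := (· = false)) (l := x)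
  rw [takeWhile_false] at hx
  generalize (x.takeWhile (· = false)).length = n at *
  rcases h : x.dropWhile (· = false) with _ | ⟨b, l⟩
  · left
    rw [h] at hx
    refine ⟨rfl, ?_⟩
    rw [← hx, bval_replicate_false_append]
    rfl
  · right
    have hb : b = true := by
      have := List.head_dropWhile_not (p := (· = false)) (l := x) (by rw [h]; simp)
      simp only [h, List.head_cons] at this
      simpa using this
    subst hb
    rw [h] at hx
    refine ⟨rfl, ?_, by rw [← hx]; simp⟩
    rw [← hx, bval_replicate_false_append, List.tail_cons, bval_replicate_true_append]
    simp [bval]; ring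

namespace Frame

variable {I : Type} {Ms : I → RTM} [DecidableEq I]

namespace Prog

variable (Ms) in
/-- Replace the string on the stack `a` by the next one; `t` is an empty stack. -/
def succ (a t : Fin 12) : Prog Ms :=
  (scan Ms a t true).seq ((push Ms a fun r _ => some r.isSome).seq (move Ms t a none))

lemma det_succ {a t : Fin 12} (hat : a ≠ t) (s : St Ms) (ht : s.w t = []) :
    (succ Ms a t).Det (4 * (s.w a).length + 3) s { s with
      r1 := none
      w := Function.update s.w a (bsucc (s.w a)) } := by
  have hle : ((s.w a).takeWhile (· = true)).length ≤ (s.w a).length :=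
    (List.takeWhile_prefix _).length_le
  refine ((det_scan hat true s).seq (Det.prim.seq (det_move hat.symm none _))).conv ?_ ?_
  · simp [-Bool.decide_eq_true, St.push, ht, hat.symm]; omega
  · simp only [St.push, St.mk.injEq, true_and, and_true]
    ext1 z
    by_cases hz1 : z = a
    · subst hz1; simp [ht, bsucc_eq, hat.symm, hat]
    by_cases hz2 : z = t
    · subst hz2; simp [hz1, ht]
    simp [hz1, hz2]

variable (Ms) in
/-- Turn the binary number on the stack `y` (most significant bit on top) into a unary number on
the stack `x`; `t` is an empty stack. -/
def unary (y x t : Fin 12) : Prog Ms :=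
  each y ((push Ms t fun r _ => if r = some true then some false else none).seq
    ((each x ((push Ms t fun _ _ => some false).seq (push Ms t fun _ _ => some false))).seq
      (move Ms t x none)))

/-- The number with binary digits `y` (most significant bit first), prefixed with the number `n`. -/
def ofDigitsMSB (n : ℕ) : List Bool → ℕ
  | [] => n
  | b :: y => ofDigitsMSB (2 * n + b.toNat) y

lemma ofDigitsMSB_ge (y : List Bool) (n : ℕ) : n ≤ ofDigitsMSB n y := by
  induction y generalizing n with
  | nil => exact le_rfl
  | cons b y ih => exact (by omega : n ≤ 2 * n + b.toNat).trans (ih _)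

/-- Horner's scheme in unary: each digit doubles the number on `x` and adds the digit. -/
lemma det_unary {y x t : Fin 12} (hyx : y ≠ x) (hyt : y ≠ t) (hxt : x ≠ t) (s : St Ms) (n : ℕ)
    (hx : s.w x = List.replicate n false) (ht : s.w t = []) :
    (unary Ms y x t).Det ((s.w y).length * (5 * ofDigitsMSB n (s.w y) + 6) + 1) s { s with
      r1 := none
      w := Function.update (Function.update s.w y []) x
        (List.replicate (ofDigitsMSB n (s.w y)) false) } := by
  have hdup : ∀ s : St Ms, (each x ((push Ms t fun _ _ => some false).seq
      (push Ms t fun _ _ => some false))).Det (3 * (s.w x).length + 1) s { s with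
        r1 := none
        w := Function.update (Function.update s.w x []) t
          (List.replicate (2 * (s.w x).length) false ++ s.w t) } := by
    intro s
    refine (Det.each_of (fun l s => { s with
        r1 := none
        w := Function.update (Function.update s.w x []) t
          (List.replicate (2 * l.length) false ++ s.w t) })
          (fun _ => True) 2 ?_ ?_ s trivial).mono (by omega)
    · intro s _ h
      simp [Function.update_nil_of_eq h]
    · intro b l s _ h
      refine ⟨_, Det.prim.seq Det.prim, trivial, ?_, ?_⟩
      · simp [St.push, hxt]
      · simp [St.push, hxt.symm, Function.update_comm hxt, mul_add, List.replicate_add]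
  generalize hl : s.w y = l
  -- Intermediate values never exceed the final one, so a single bound `N` for the cost of a round
  -- survives the induction, while `n` changes.
  suffices H : ∀ N, ofDigitsMSB n l ≤ N → (unary Ms y x t).Det (l.length * (5 * N + 6) + 1) s
      { s with
        r1 := none
        w := Function.update (Function.update s.w y []) x
          (List.replicate (ofDigitsMSB n l) false) } from H _ le_rfl
  intro N hN
  induction l generalizing s n with
  | nil =>
    refine (Det.each_nil hl).conv (by simp) ?_
    simp [Function.update_nil_of_eq hl, ofDigitsMSB, ← hx]
  | cons b l ih =>
    rw [ofDigitsMSB] at hN ⊢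
    have hle := (ofDigitsMSB_ge l (2 * n + b.toNat)).trans hN
    have hbt := b.toNat_le
    let s₁ : St Ms := { s with
      r1 := none
      w := Function.update (Function.update s.w y l) x
        (List.replicate (2 * n + b.toNat) false) }
    have h1 : ((push Ms t fun r _ => if r = some true then some false else none).seq
        ((each x ((push Ms t fun _ _ => some false).seq (push Ms t fun _ _ => some false))).seq
        (move Ms t x none))).Det (5 * N + 5) { s with
          r1 := some b, w := Function.update s.w y l } s₁ := by
      refine (Det.prim.seq ((hdup _).seq (det_move hxt.symm none _))).conv ?_ ?_
      · cases b <;> simp [St.push, hyx.symm, hyt.symm, hxt, hx, ht] <;> simp at hle <;> omega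
      · simp only [St.push, s₁, St.mk.injEq, true_and, and_true]
        ext1 z
        by_cases hz1 : z = x
        · subst hz1
          cases b
          · simp [hxt, hyx.symm, hyt.symm, hx, ht]
          · simp [hxt, hyx.symm, hyt.symm, hx, ht]
            rw [← List.replicate_succ, List.replicate_succ']
        by_cases hz2 : z = t
        · subst hz2; simp [hz1, ht, hyt.symm]
        simp [hz1, hz2]
    have h2 := ih s₁ (2 * n + b.toNat) (by simp [s₁]) (by simp [s₁, hyt.symm, hxt.symm, ht])
      (by simp [s₁, hyx]) hN
    refine (Det.each_cons hl h1 h2).conv ?_ ?_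
    · simp only [List.length_cons]; ring_nf; omega
    · simp only [s₁, St.mk.injEq, true_and, and_true]
      ext1 z
      by_cases hz1 : z = x
      · subst hz1; simp
      by_cases hz2 : z = y
      · subst hz2; simp [hz1]
      simp [hz1, hz2]

/-- Find the entry with the number `bval (s.w a)` of the stack `k` of machine `i`, provided that
this number is less than the height of the stack `g`, and push it on the stack `o` (otherwise push
`false`); `t` is an empty stack. -/
def lookup (a g t o : Fin 12) (i : I) (k : (Ms i).K) (d : (Ms i).Γ k → Bool) : Prog Ms :=
  (((pop2 Ms g).seq (scan Ms a t false)).loop (fun r₁ r₂ => r₁.isSome && r₂.isSome)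
    ((push Ms a fun _ _ => some false).seq ((move Ms t a none).seq
      (prim (St.spop i k d) (implementable_spop i k d))))).seq
  ((prim (St.spop i k d) (implementable_spop i k d)).seq
    (push Ms o fun r₁ r₂ => some (r₂.isSome && r₁.getD false)))

/-- Each round decrements the binary index on `a` (turning its leading zeros into ones and its first
one into zero) and discards one entry of `k` and one symbol of `g`. The stack `g` caps the number of
rounds, so an index far beyond the table costs no more than the height of `g`; running out of `g`
leaves `none` in the second register. -/
lemma det_lookup {a g t o : Fin 12} (hag : a ≠ g) (hat : a ≠ t) (hgt : g ≠ t)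
    (hoa : o ≠ a) (hog : o ≠ g) (hot : o ≠ t) (i : I) (k : (Ms i).K) (d : (Ms i).Γ k → Bool)
    (s : St Ms) (ht : s.w t = []) : ∃ s', (lookup a g t o i k d).Det
      (((s.w g).length + 1) * (4 * (s.w a).length + 10)) s s' ∧
      s'.w o = (decide (bval (s.w a) < (s.w g).length) &&
        ((s.s i k).map d).getD (bval (s.w a)) false) :: s.w o := by
  suffices H : ∃ s', (((pop2 Ms g).seq (scan Ms a t false)).loop
      (fun r₁ r₂ => r₁.isSome && r₂.isSome)
      ((push Ms a fun _ _ => some false).seq ((move Ms t a none).seq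
        (prim (St.spop i k d) (implementable_spop i k d))))).Det
        (((s.w g).length + 1) * (4 * (s.w a).length + 8)) s s' ∧ s'.w o = s.w o ∧
        (s'.r2.isSome && ((s'.s i k).head?.map d).getD false) =
          (decide (bval (s.w a) < (s.w g).length) &&
            ((s.s i k).map d).getD (bval (s.w a)) false) by
    obtain ⟨s', h1, h2, h3⟩ := H
    refine ⟨_, (h1.seq (Det.prim.seq Det.prim)).conv ?_ rfl, ?_⟩
    · ring_nf; omega
    · rw [← h2, ← h3]
      simp [St.push, St.spop]
  generalize hg : s.w g = l
  induction l generalizing s with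
  | nil =>
    refine ⟨_, (Det.loop_exit (Det.prim.seq (det_scan hat false _)) ?_).conv ?_ rfl, ?_, ?_⟩
    · simp [St.pop2, hg]
    · simp [St.pop2, hag]; omega
    · simp [St.pop2, hoa, hog, hot]
    · simp [St.pop2, hg]
  | cons b l ih =>
    have hle : ((s.w a).takeWhile (· = false)).length ≤ (s.w a).length :=
      (List.takeWhile_prefix _).length_le
    rcases bval_cases (s.w a) with ⟨h1, h2⟩ | ⟨h1, h2, h3⟩
    · refine ⟨_, (Det.loop_exit (Det.prim.seq (det_scan hat false _)) ?_).conv ?_ rfl, ?_, ?_⟩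
      · simp only [St.pop2, Function.update_of_ne hag, h1]; rfl
      · simp [St.pop2, hag]; ring_nf; omega
      · simp [St.pop2, hoa, hog, hot]
      · simp only [St.pop2, hg, h2]
        rcases s.s i k <;> simp
    · set s₁ : St Ms := { s with
          r1 := some true
          r2 := some b
          w := Function.update (Function.update (Function.update s.w g l) a
            ((s.w a).dropWhile (· = false)).tail) t
            (List.replicate ((s.w a).takeWhile (· = false)).length true) } with hs₁
      have hH : ((pop2 Ms g).seq (scan Ms a t false)).Det (2 * (s.w a).length + 2) s s₁ := by
        refine (Det.prim.seq (det_scan hat false _)).conv ?_ ?_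
        · simp [St.pop2, hag]; omega
        · simp only [St.pop2, Function.update_of_ne hag, h1, hg, s₁, St.mk.injEq, true_and,
            and_true]
          simp [ht, hgt.symm]
      have hB := Det.prim (h := implementable_push (Ms := Ms) a fun _ _ => some false)
        (s := s₁) |>.seq
        ((det_move hat.symm none _).seq (Det.prim (h := implementable_spop i k d)))
      set s₂ := St.spop i k d _ with hs₂
      have hwa : s₂.w a = List.replicate ((s.w a).takeWhile (· = false)).length true ++
          false :: ((s.w a).dropWhile (· = false)).tail := by
        simp [hs₂, hs₁, St.spop, St.push, hat, hat.symm]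
      have hwg : s₂.w g = l := by
        simp [hs₂, hs₁, St.spop, St.push, hgt, hag.symm]
      have hwt : s₂.w t = [] := by
        simp [hs₂, hs₁, St.spop, St.push, hat.symm]
      have hwo : s₂.w o = s.w o := by
        simp [hs₂, hs₁, St.spop, St.push, hot, hoa, hog]
      have hws : s₂.s i k = (s.s i k).tail := by
        simp only [hs₂, St.spop, St.push, Function.update_self]
        rfl
      obtain ⟨s', h4, h5, h6⟩ := ih s₂ hwt hwg
      rw [← hwa] at h2 h3
      refine ⟨s', (Det.loop_step hH rfl hB h4).conv ?_ rfl, h5.trans hwo, ?_⟩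
      · simp only [St.push, s₁, Function.update_of_ne hat.symm, Function.update_self, h3,
          List.length_cons, List.length_replicate]
        ring_nf; omega
      · rw [h6, hws, h2]
        rcases s.s i k <;> simp

end Prog

end Frame

/-! ### Amplification by majority votes -/

/-- Add the vote `b` to a stack of equal votes; opposite votes cancel each other. -/
def addVote (b : Bool) : List Bool → List Bool
  | [] => [b]
  | a :: l => if a = b then b :: a :: l else l

/-- The weight of a vote when `a` is the right answer. -/
noncomputable def voteWeight (a b : Bool) : ℝ≥0∞ := if b = a then 2 / 3 else 3 / 2

/-- The weight of a stack of votes when `a` is the right answer. -/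
noncomputable def votesWeight (a : Bool) (l : List Bool) : ℝ≥0∞ := (l.map (voteWeight a)).prod

lemma two_thirds_mul : (2 / 3 : ℝ≥0∞) * (3 / 2) = 1 := by
  rw [show (2 / 3 : ℝ≥0∞) = ((2 / 3 : NNReal) : ℝ≥0∞) by simp,
    show (3 / 2 : ℝ≥0∞) = ((3 / 2 : NNReal) : ℝ≥0∞) by simp]
  norm_cast
  norm_num

lemma two_thirds_add : (2 / 3 : ℝ≥0∞) + 5 / 6 = 3 / 2 := by
  rw [show (2 / 3 : ℝ≥0∞) = ((2 / 3 : NNReal) : ℝ≥0∞) by simp,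
    show (3 / 2 : ℝ≥0∞) = ((3 / 2 : NNReal) : ℝ≥0∞) by simp,
    show (5 / 6 : ℝ≥0∞) = ((5 / 6 : NNReal) : ℝ≥0∞) by simp]
  norm_cast
  rw [← NNReal.coe_inj]
  push_cast
  norm_num

lemma two_thirds_add' : (2 / 3 : ℝ≥0∞) + 5 / 6 * (1 / 3) = 17 / 18 := by
  rw [show (2 / 3 : ℝ≥0∞) = ((2 / 3 : NNReal) : ℝ≥0∞) by simp,
    show (1 / 3 : ℝ≥0∞) = ((1 / 3 : NNReal) : ℝ≥0∞) by simp,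
    show (17 / 18 : ℝ≥0∞) = ((17 / 18 : NNReal) : ℝ≥0∞) by simp,
    show (5 / 6 : ℝ≥0∞) = ((5 / 6 : NNReal) : ℝ≥0∞) by simp]
  norm_cast
  rw [← NNReal.coe_inj]
  push_cast
  norm_num

/-- The two weights are inverse to each other, so cancelling opposite votes preserves the product.
Hence the weight is multiplicative over all votes cast. -/
lemma votesWeight_addVote (a b : Bool) (l : List Bool) :
    votesWeight a (addVote b l) = voteWeight a b * votesWeight a l := by
  rcases l with _ | ⟨c, l⟩
  · simp [addVote, votesWeight]
  · by_cases h : c = b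
    · subst h; simp [addVote, votesWeight]
    · have hw : voteWeight a b * voteWeight a c = 1 := by
        have := two_thirds_mul
        unfold voteWeight
        cases a <;> cases b <;> cases c <;> simp_all [mul_comm]
      simp [addVote, votesWeight, h, ← mul_assoc, hw]

lemma addVote_replicate (b c : Bool) (n : ℕ) :
    ∃ c' n', n' ≤ n + 1 ∧ addVote b (List.replicate n c) = List.replicate n' c' := by
  rcases n with _ | n
  · exact ⟨b, 1, le_rfl, rfl⟩
  · by_cases h : c = b
    · subst h
      exact ⟨c, n + 2, le_rfl, by simp [addVote, List.replicate_succ]⟩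
    · exact ⟨c, n, by omega, by simp [addVote, List.replicate_succ, h]⟩

/-- A wrong majority consists only of votes of weight `3/2`. A tie leaves the empty stack, read as
`false`, whose weight is `1`. -/
lemma one_le_votesWeight {a c : Bool} {n : ℕ}
    (h : (List.replicate n c).head?.getD false ≠ a) : 1 ≤ votesWeight a (List.replicate n c) := by
  rcases n with _ | n
  · simp [votesWeight]
  · have hc : c ≠ a := by simpa [List.replicate_succ] using h
    simp only [votesWeight, List.map_replicate, List.prod_replicate, voteWeight, if_neg hc]
    refine one_le_pow₀ ?_
    rw [← two_thirds_add, ← two_thirds_mul, ← two_thirds_add, mul_add]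
    calc (2 / 3 : ℝ≥0∞) * (2 / 3) + 2 / 3 * (5 / 6) ≤ 2 / 3 * 1 + 1 * (5 / 6) := by
          gcongr <;> exact ENNReal.div_le_of_le_mul (by norm_num)
      _ = _ := by rw [mul_one, one_mul]

namespace Frame

variable {I : Type} {Ms : I → RTM} [DecidableEq I]

open Classical in
variable (Ms) in
/-- The bit represented by a symbol of the output stack of machine `i`. -/
noncomputable def decode (i : I) (γ : (Ms i).Γ (Ms i).kOut) : Bool := decide (γ = (Ms i).bitOut true)

omit [DecidableEq I] in
@[simp] lemma decode_bitOut (i : I) (b : Bool) : decode Ms i ((Ms i).bitOut b) = b := by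
  cases b <;> simp [decode]

omit [DecidableEq I] in
lemma map_decode (i : I) (l : List Bool) : (l.map (Ms i).bitOut).map (decode Ms i) = l := by
  simp [Function.comp_def]

namespace Prog

variable (Ms) in
/-- Prepare machine `i` for the inputs on the work stacks `x` and `y`; `t` is an empty stack. -/
def load (x y t : Fin 12) (i : I) : Prog Ms :=
  (prim (St.reset i) (implementable_reset i)).seq
    ((copyTo Ms y t i (Ms i).kAux (Ms i).bitAux).seq (copyTo Ms x t i (Ms i).kIn (Ms i).bitIn))

lemma det_load {x y t : Fin 12} (hxt : x ≠ t) (hyt : y ≠ t) (i : I) (s : St Ms)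
    (ht : s.w t = []) :
    (load Ms x y t i).Det (5 * (s.w x).length + 5 * (s.w y).length + 5) s { s with
      r1 := none
      v := Function.update s.v i (Ms i).init
      s := Function.update s.s i ((Ms i).initCfg (s.w x) (s.w y)).stk } := by
  refine (Det.prim.seq ((det_copyTo hyt i _ _ _ (by simpa [St.reset] using ht)).seq
    (det_copyTo hxt i _ _ _ (by simpa [St.reset] using ht)))).conv ?_ ?_
  · simp only [St.reset]; omega
  · simp [St.reset, RTM.initCfg, (Ms i).kIn_ne_kAux]

variable (Ms) in
/-- Run machine `i` with the inputs on the work stacks `x` and `y`; `t` is an empty stack. -/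
def call (x y t : Fin 12) (i : I) : Prog Ms := (load Ms x y t i).seq (exec Ms i)

lemma wp_call {x y t : Fin 12} (hxt : x ≠ t) (hyt : y ≠ t) (i : I) (s : St Ms)
    (ht : s.w t = []) (τ : ℕ) (f : St Ms → ℝ≥0∞) :
    (call Ms x y t i).wp (5 * (s.w x).length + 5 * (s.w y).length + 5 + τ) s f ≤
      ex (Ms i).step τ ((Ms i).initCfg (s.w x) (s.w y))
        (RTM.onHalt fun c => f (({ s with r1 := none } : St Ms).setSlot i c)) := by
  refine ((det_load hxt hyt i s ht).wp_seq_le f).trans ?_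
  rw [wp_exec]
  simp [RTM.initCfg, St.setSlot]

variable (Ms) in
/-- Run machine `i` with the inputs on the work stacks `x` and `y` for as many steps as the work
stack `g` has symbols; `t` is an empty stack. -/
def callClocked (x y t g : Fin 12) (i : I) : Prog Ms :=
  (load Ms x y t i).seq (execClocked Ms i g)

lemma wp_callClocked {x y t g : Fin 12} (hxt : x ≠ t) (hyt : y ≠ t) (i : I) (s : St Ms)
    (ht : s.w t = []) (f : St Ms → ℝ≥0∞) (F : (Ms i).Cfg → ℝ≥0∞)
    (h : ∀ r l c, f (({ s with r1 := r, w := Function.update s.w g l } : St Ms).setSlot i c)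
      ≤ F c) :
    (callClocked Ms x y t g i).wp
      (5 * (s.w x).length + 5 * (s.w y).length + 5 + ((s.w g).length + 1)) s f ≤
      ex (Ms i).step (s.w g).length ((Ms i).initCfg (s.w x) (s.w y)) F := by
  refine ((det_load hxt hyt i s ht).wp_seq_le f).trans ?_
  refine (wp_execClocked i g ({ s with
      r1 := none
      v := Function.update s.v i (Ms i).init
      s := Function.update s.s i ((Ms i).initCfg (s.w x) (s.w y)).stk } : St Ms) f F ?_).trans
    (le_of_eq ?_)
  · intro r l c
    refine le_trans (le_of_eq ?_) (h r l c)
    simp [St.setSlot]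
  · simp [RTM.initCfg]

/-- Add the vote in the first register to the votes on the work stack `8`. -/
def castVote (s : St Ms) : St Ms :=
  (((s.pop2 8).push 8 fun r₁ r₂ => if r₂ = some (r₁.getD false) then r₂ else none).push 8
    fun r₁ r₂ => if r₂ = none ∨ r₂ = some (r₁.getD false) then some (r₁.getD false) else none)

lemma implementable_castVote : Implementable (castVote (Ms := Ms)) :=
  ((implementable_pop2 8).comp (implementable_push 8 _)).comp (implementable_push 8 _)

omit [DecidableEq I] in
lemma castVote_w (s : St Ms) :
    (castVote s).w = Function.update s.w 8 (addVote (s.r1.getD false) (s.w 8)) := by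
  rcases h : s.w 8 with _ | ⟨c, l⟩
  · simp [castVote, St.pop2, St.push, h, addVote]
  · by_cases hc : c = s.r1.getD false
    · simp [castVote, St.pop2, St.push, h, addVote, hc]
    · simp [castVote, St.pop2, St.push, h, addVote, hc]

variable (Ms) in
/-- Run machine `i` with the inputs on the work stacks `3` and `4` and cast its output bit as a
vote. -/
noncomputable def trial (i : I) : Prog Ms :=
  (call Ms 3 4 10 i).seq ((prim (St.spop i (Ms i).kOut (decode Ms i))
    (implementable_spop i _ _)).seq (prim castVote implementable_castVote))

/-- Machine `i` answers `a` on the inputs `x`, `y` with error probability at most `1/3` and always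
halts within `τ` steps. -/
def _root_.RTM.Answers (M : RTM) (x y : List Bool) (τ : ℕ) (a : Bool) : Prop :=
  M.HaltsWithin x y τ ∧ 2 / 3 ≤ M.probOutput x y τ [a]

/-- A wrong vote costs at most `D` more than a right one and has probability at most `1/3`. -/
lemma wp_trial {i : I} {s : St Ms} {τ : ℕ} {a : Bool} (h : (Ms i).Answers (s.w 3) (s.w 4) τ a)
    (ht : s.w 10 = []) {f : St Ms → ℝ≥0∞} {G : Bool → ℝ≥0∞} {D : ℝ≥0∞}
    (hf : ∀ b s', s'.w = Function.update s.w 8 (addVote b (s.w 8)) → f s' ≤ G b)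
    (hG : G (!a) ≤ G a + D) :
    (trial Ms i).wp (5 * (s.w 3).length + 5 * (s.w 4).length + 7 + τ) s f ≤ G a + D * (1 / 3) := by
  classical
  have e : 5 * (s.w 3).length + 5 * (s.w 4).length + 7 + τ
      = 5 * (s.w 3).length + 5 * (s.w 4).length + 5 + τ + (1 + 1) := by omega
  rw [e]
  refine (wp_seq _ _ _ _).trans ((wp_call (by decide) (by decide) i s ht τ _).trans ?_)
  have key : ∀ c : (Ms i).Cfg, c.l = none →
      ((prim (St.spop i (Ms i).kOut (decode Ms i)) (implementable_spop i _ _)).seq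
        (prim castVote implementable_castVote)).wp (1 + 1)
          (({ s with r1 := none } : St Ms).setSlot i c) f
        ≤ G a + D * (if c.stk (Ms i).kOut = [a].map (Ms i).bitOut then 0 else 1) := by
    intro c _
    refine (wp_seq 1 1 _ f).trans ((wp_prim _ _).trans_le ((wp_prim _ _).trans_le ?_))
    split_ifs with h2
    · rw [mul_zero, add_zero]
      refine hf a _ ?_
      rw [castVote_w]
      simp [St.spop, St.setSlot, h2]
    · refine (hf ((c.stk (Ms i).kOut).head?.map (decode Ms i) |>.getD false) _ ?_).trans ?_
      · rw [castVote_w]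
        simp [St.spop, St.setSlot]
      generalize Option.getD _ _ = b
      by_cases hb : b = a
      · subst hb; simp
      · rw [Bool.eq_not_of_ne hb, mul_one]; exact hG
  -- With `D = 0` the product `D * ⊤` vanishes and would lose the information on halting, which is
  -- then taken from `h.1` path by path.
  by_cases hD : D = 0
  · refine RTM.ex_le_of_forall_run _ fun r => ?_
    rw [RTM.onHalt, if_pos (h.1 r)]
    simpa [hD] using key _ (h.1 r)
  · refine le_trans ?_ (add_le_add_right (mul_le_mul_right ((Ms i).ex_onHalt_le h.1 h.2) D) _)
    rw [← ex_affine]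
    refine ex_mono (fun c => ?_) _ _
    unfold RTM.onHalt
    by_cases h1 : c.l = none
    · simpa only [if_pos h1] using key c h1
    · simp [h1, hD]

variable (Ms) in
/-- One trial for every symbol of the work stack `7`. -/
noncomputable def trials (i : I) : Prog Ms := each 7 (trial Ms i)

/-- Each trial multiplies the expected weight by at most `2/3 · 2/3 + 1/3 · 3/2 = 17/18`. The bound
`N` on the height of the vote stack is needed for the time to clear it. -/
lemma wp_trials {i : I} {s : St Ms} {τ : ℕ} {a c : Bool} {n N : ℕ}
    (h : (Ms i).Answers (s.w 3) (s.w 4) τ a) (ht : s.w 10 = [])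
    (h8 : s.w 8 = List.replicate n c) (hN : n + (s.w 7).length ≤ N)
    {f : St Ms → ℝ≥0∞} {A D : ℝ≥0∞}
    (hf : ∀ n c s', n ≤ N →
      s'.w = Function.update (Function.update s.w 7 []) 8 (List.replicate n c) →
      f s' ≤ A + D * votesWeight a (List.replicate n c)) :
    (trials Ms i).wp ((s.w 7).length * (5 * (s.w 3).length + 5 * (s.w 4).length + 8 + τ) + 1) s f ≤
      A + D * (17 / 18) ^ (s.w 7).length * votesWeight a (s.w 8) := by
  generalize hl : s.w 7 = l at hN ⊢
  induction l generalizing s n c with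
  | nil =>
    refine (wp_each_nil hl f |> (wp_anti (by simp) s f).trans).trans
      ((hf n c _ (by simpa using hN) ?_).trans ?_)
    · simp only
      rw [Function.update_nil_of_eq hl, ← h8, Function.update_eq_self]
    · simp [h8]
  | cons x l ih =>
    set T := 5 * (s.w 3).length + 5 * (s.w 4).length + 7 + τ with hT
    have hT' : 5 * (s.w 3).length + 5 * (s.w 4).length + 8 + τ = T + 1 := by omega
    refine (wp_anti (t := 1 + (T + (l.length * (T + 1) + 1))) ?_ s f).trans
      ((wp_each_cons _ _ hl f).trans ?_)
    · rw [hT', List.length_cons]; exact le_of_eq (by ring)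
    -- The continuation costs `A + C * 2/3` after a right vote and `A + C * 3/2` after a wrong one;
    -- the difference is `C * 5/6`.
    obtain ⟨C, hC⟩ : ∃ C, C = D * (17 / 18) ^ l.length * votesWeight a (s.w 8) := ⟨_, rfl⟩
    have := wp_trial (i := i) (s := { s with r1 := some x, w := Function.update s.w 7 l })
      (τ := τ) (a := a) (by simpa using h) (by simpa using ht)
      (f := fun s' => (trials Ms i).wp (l.length * (T + 1) + 1) s' f)
      (G := fun b => A + C * voteWeight a b) (D := C * (5 / 6)) (fun b s' hs' => ?_) ?_
    · refine (le_of_eq_of_le ?_ this).trans (le_of_eq ?_)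
      · simp [hT, trials]
      · have e : voteWeight a a = 2 / 3 := by simp [voteWeight]
        rw [e, add_assoc, mul_assoc C, ← mul_add, two_thirds_add', hC, List.length_cons, pow_succ]
        ring
    · simp only at hs'
      obtain ⟨c', n', hn', hcn⟩ := addVote_replicate b c n
      have h3 : s'.w 3 = s.w 3 := by simp [hs']
      have h4 : s'.w 4 = s.w 4 := by simp [hs']
      have := ih (s := s') (by rwa [h3, h4]) (by simpa [hs'] using ht) (c := c') (n := n')
        (by simp [hs', h8, hcn]) (fun n c s'' hn hs'' => hf n c s'' hn ?_) (by simp [hs'])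
        (by rw [List.length_cons] at hN; omega)
      · rw [h3, h4, hT'] at this
        refine this.trans (le_of_eq ?_)
        simp only [hs', hC, Function.update_self,
            Function.update_of_ne (show (8 : Fin 12) ≠ 7 by decide), votesWeight_addVote]
        ring
      · rw [hs'', hs']
        simp [Function.update_comm (show (7 : Fin 12) ≠ 8 by decide)]
    · simp only [voteWeight]
      rw [add_assoc, ← mul_add]
      simp [two_thirds_add]

variable (Ms) in
/-- Empty the work stack `a`. -/
def clear (a : Fin 12) : Prog Ms := each a (prim (fun s => s) implementable_id)

lemma det_clear (a : Fin 12) (s : St Ms) : (clear Ms a).Det (2 * (s.w a).length + 1) s { s with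
    r1 := none
    w := Function.update s.w a [] } := by
  refine (Det.each_of (fun _ s => { s with
      r1 := none
      w := Function.update s.w a [] }) (fun _ => True) 1 ?_ ?_ s trivial).mono (by omega)
  · intro s _ h
    simp [Function.update_nil_of_eq h]
  · intro x l s _ h
    exact ⟨_, Det.prim, trivial, by simp, by simp⟩

variable (Ms) in
/-- Determine the answer of machine `i` on the work stack `3` by majority, push it on the work
stack `9` and proceed to the next string. -/
noncomputable def answerBit (i : I) : Prog Ms :=
  (copy Ms 6 7 10 none).seq ((trials Ms i).seq ((pop Ms 8).seq
    ((push Ms 9 fun r _ => some (r.getD false)).seq ((clear Ms 8).seq (succ Ms 3 10)))))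

/-- A Markov-type estimate: a wrong majority has weight at least `1`, so the surcharge `D` for it is
at most `D` times the final weight. -/
lemma wp_answerBit {i : I} {s : St Ms} {τ : ℕ} {a : Bool}
    (h : (Ms i).Answers (s.w 3) (s.w 4) τ a) (h7 : s.w 7 = []) (h8 : s.w 8 = [])
    (h10 : s.w 10 = []) {f : St Ms → ℝ≥0∞} {G : Bool → ℝ≥0∞} {D : ℝ≥0∞}
    (hf : ∀ b s', s'.w = Function.update (Function.update s.w 9 (b :: s.w 9)) 3 (bsucc (s.w 3)) →
      f s' ≤ G b)
    (hG : G (!a) ≤ G a + D) :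
    (answerBit Ms i).wp ((s.w 6).length * (5 * (s.w 3).length + 5 * (s.w 4).length + 15 + τ)
      + 4 * (s.w 3).length + 9) s f ≤ G a + D * (17 / 18) ^ (s.w 6).length := by
  set R := (s.w 6).length with hR
  set T := 5 * (s.w 3).length + 5 * (s.w 4).length + 8 + τ with hT
  refine (wp_anti (t := (5 * R + 2) + ((R * T + 1) + (1 + (1 + ((2 * R + 1)
    + (4 * (s.w 3).length + 3)))))) ?_ s f).trans ?_
  · rw [show 5 * (s.w 3).length + 5 * (s.w 4).length + 15 + τ = T + 7 by omega,
      show R * (T + 7) = R * T + 7 * R by ring]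
    clear_value T R
    omega
  refine ((det_copy (by decide) (by decide) (by decide) none s h10).wp_seq_le f).trans ?_
  refine (wp_seq _ _ _ _).trans ?_
  have := wp_trials (i := i) (s := { s with
      r1 := none
      w := Function.update s.w 7 ((s.w 6).map (fun x => (none : Option Bool).getD x) ++ s.w 7) })
    (τ := τ) (a := a) (c := false) (n := 0) (N := R) (by simpa using h) (by simpa using h10)
    (by simpa using h8) (by simp [h7, hR]) (A := G a) (D := D)
    (f := fun s' => ((pop Ms 8).seq ((push Ms 9 fun r _ => some (r.getD false)).seq
      ((clear Ms 8).seq (succ Ms 3 10)))).wp (1 + (1 + ((2 * R + 1)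
        + (4 * (s.w 3).length + 3)))) s' f) ?_
  · simp only [h7, h8, votesWeight, Option.getD_none, List.map_id', List.append_nil,
      Function.update_self, ne_eq, Fin.reduceEq, not_false_eq_true, Function.update_of_ne,
      List.map_nil, List.prod_nil, mul_one] at this
    simpa [h7, hT, hR] using this
  · intro n c s' hn hs'
    simp only [Function.update_idem] at hs'
    have hs8 : s'.w 8 = List.replicate n c := by simp [hs']
    refine ((Det.seq Det.prim (Det.seq Det.prim (Det.mono (det_clear 8 _) ?_ |>.seq
      (Det.conv (det_succ (by decide) _ ?_) ?_ rfl)))) f).trans ?_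
    · simp [St.push, St.pop, hs8]; omega
    · simp [St.push, St.pop, hs', h10]
    · simp [St.push, St.pop, hs']
    · refine (hf ((List.replicate n c).head?.getD false) _ ?_).trans ?_
      · ext1 z
        by_cases hz : z = 3
        · subst hz; simp [St.push, St.pop, hs']
        by_cases hz : z = 9
        · subst hz; simp [St.push, St.pop, hs']
        by_cases hz : z = 8
        · subst hz; simp [St.push, St.pop, h8]
        by_cases hz : z = 7
        · subst hz; simp [St.push, St.pop, hs', h7]
        simp [*, St.push, St.pop]
      · by_cases hb : (List.replicate n c).head?.getD false = a
        · rw [hb]; simp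
        · rw [Bool.eq_not_of_ne hb]
          refine hG.trans (add_le_add_right ?_ _)
          exact le_mul_of_one_le_right' (one_le_votesWeight hb)

variable (Ms) in
/-- Push the answers of machine `i` on the first strings (as many as the work stack `5` has
symbols), starting with the string on the work stack `3`, on the work stack `9`. -/
noncomputable def tabulate (i : I) : Prog Ms := each 5 (answerBit Ms i)

/-- The values of `L` on the `m` strings from `x` on. -/
def _root_.table (L : List Bool → Bool) (m : ℕ) (x : List Bool) : List Bool :=
  (List.range m).map fun j => L (bsucc^[j] x)

/-- Union bound over the entries, carried out inside the loop. The table arises in reverse order on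
the stack `9`, hence `o.reverse`. -/
lemma wp_tabulate {i : I} {s : St Ms} {τ N : ℕ} {L : List Bool → Bool}
    (h : ∀ j < (s.w 5).length, (Ms i).Answers (bsucc^[j] (s.w 3)) (s.w 4) τ (L (bsucc^[j] (s.w 3))))
    (hN : ∀ j < (s.w 5).length, (bsucc^[j] (s.w 3)).length ≤ N)
    (h7 : s.w 7 = []) (h8 : s.w 8 = []) (h10 : s.w 10 = []) {f : St Ms → ℝ≥0∞}
    (hδ : (s.w 5).length * (17 / 18 : ℝ≥0∞) ^ (s.w 6).length ≤ 1)
    (hf : ∀ s' o, o.length = (s.w 5).length →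
      s'.w = Function.update (Function.update (Function.update s.w 5 []) 3
        (bsucc^[(s.w 5).length] (s.w 3))) 9 (o.reverse ++ s.w 9) →
      f s' ≤ if o = table L (s.w 5).length (s.w 3) then 0 else 1) :
    (tabulate Ms i).wp ((s.w 5).length * ((s.w 6).length * (5 * N + 5 * (s.w 4).length + 15 + τ)
      + 4 * N + 10) + 1) s f ≤ (s.w 5).length * (17 / 18) ^ (s.w 6).length := by
  set T := (s.w 6).length * (5 * N + 5 * (s.w 4).length + 15 + τ) + 4 * N + 9 with hT
  have hT' : (s.w 6).length * (5 * N + 5 * (s.w 4).length + 15 + τ) + 4 * N + 10 = T + 1 := rfl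
  rw [hT']
  set δ : ℝ≥0∞ := (17 / 18) ^ (s.w 6).length with hδ'
  -- The flag `p` records whether all earlier entries are right; after the first error the bound is
  -- just `1`.
  suffices H : ∀ (p : Bool) (l : List Bool) (s₀ : St Ms) (f : St Ms → ℝ≥0∞), s₀.w 5 = l →
      s₀.w 4 = s.w 4 → s₀.w 6 = s.w 6 → l.length * δ ≤ 1 →
      (∀ j < l.length, (Ms i).Answers (bsucc^[j] (s₀.w 3)) (s₀.w 4) τ (L (bsucc^[j] (s₀.w 3)))) →
      (∀ j < l.length, (bsucc^[j] (s₀.w 3)).length ≤ N) →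
      s₀.w 7 = [] → s₀.w 8 = [] → s₀.w 10 = [] → (∀ s' o, o.length = l.length →
      s'.w = Function.update (Function.update (Function.update s₀.w 5 []) 3
        (bsucc^[l.length] (s₀.w 3))) 9 (o.reverse ++ s₀.w 9) →
        f s' ≤ if p ∧ o = table L l.length (s₀.w 3) then 0 else 1) →
      (tabulate Ms i).wp (l.length * (T + 1) + 1) s₀ f ≤ if p then l.length * δ else 1 by
    simpa using H true _ s f rfl rfl rfl hδ h hN h7 h8 h10 (by simpa using hf)
  intro p l
  induction l generalizing p with
  | nil =>
    intro s₀ f h5 _ _ _ _ _ _ _ _ hf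
    refine (wp_each_nil h5 f |> (wp_anti (by simp) s₀ f).trans).trans ((hf _ [] rfl ?_).trans ?_)
    · ext1 z
      by_cases hz : z = 9
      · subst hz; simp
      by_cases hz : z = 3
      · subst hz; simp
      by_cases hz : z = 5
      · subst hz; simp [h5]
      simp [*]
    · cases p <;> simp [table]
  | cons x l ih =>
    intro s₀ f h5 h4 h6 hδ h hN h7 h8 h10 hf
    refine (wp_anti (t := 1 + (T + (l.length * (T + 1) + 1))) ?_ s₀ f).trans
      ((wp_each_cons _ _ h5 f).trans ?_)
    · rw [List.length_cons]; exact le_of_eq (by ring)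
    have hlδ : l.length * δ ≤ 1 := le_trans (by gcongr; simp) hδ
    have h0 := h 0 (by simp)
    have hN0 := hN 0 (by simp)
    simp only [Function.iterate_zero, id_eq] at h0 hN0
    -- If all is right so far, a wrong entry raises the bound by at most `D = 1`; if an error has
    -- occurred already, there is nothing to add and `D = 0`.
    have := wp_answerBit (i := i) (s := { s₀ with r1 := some x, w := Function.update s₀.w 5 l })
      (τ := τ) (a := L (s₀.w 3)) (by simpa using h0) (by simpa using h7) (by simpa using h8)
      (by simpa using h10) (f := fun s' => (tabulate Ms i).wp (l.length * (T + 1) + 1) s' f)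
      (G := fun b => if p ∧ b = L (s₀.w 3) then l.length * δ else 1) (D := if p then 1 else 0)
      (fun b s' hs' => ?_) ?_
    · refine ((wp_anti ?_ _ _).trans this).trans (le_of_eq ?_)
      · simp only [ne_eq, Fin.reduceEq, not_false_eq_true, Function.update_of_ne, h4, h6]
        have : (s.w 6).length * (5 * (s₀.w 3).length + 5 * (s.w 4).length + 15 + τ)
          ≤ (s.w 6).length * (5 * N + 5 * (s.w 4).length + 15 + τ) := by gcongr
        omega
      · simp only [ne_eq, Fin.reduceEq, not_false_eq_true, Function.update_of_ne, h6]
        cases p <;> simp [add_mul, hδ']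
    · have h3' : s'.w 3 = bsucc (s₀.w 3) := by simp [hs']
      have h4' : s'.w 4 = s₀.w 4 := by simp [hs']
      refine (ih (p := p ∧ b = L (s₀.w 3)) s' f (by simp [hs']) (by rw [h4', h4])
        (by simp [hs', h6]) hlδ (fun j hj => ?_) (fun j hj => ?_) (by simp [hs', h7])
        (by simp [hs', h8]) (by simp [hs', h10]) (fun s'' o ho hs'' => ?_)).trans (by simp)
      · rw [h3', h4', ← Function.iterate_succ_apply]
        exact h (j + 1) (by simpa using hj)
      · rw [h3', ← Function.iterate_succ_apply]
        exact hN (j + 1) (by simpa using hj)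
      · refine (hf s'' (b :: o) (by simp [ho]) ?_).trans (le_of_eq ?_)
        · rw [hs'', h3', hs']
          ext1 z
          by_cases hz : z = 9
          · subst hz; simp
          by_cases hz : z = 3
          · subst hz; simp
          by_cases hz : z = 5
          · subst hz; simp
          simp [*]
        · congr 1
          simp [table, h3', List.range_succ_eq_map, and_assoc, Function.comp_def]
    · cases p <;> simp

end Prog

end Frame

/-! ### Enumeration of strings and binary values -/

section Strings

lemma bsucc_iterate_two_mul (k : ℕ) (y : List Bool) :
    bsucc^[2 * k] (false :: y) = false :: bsucc^[k] y := by
  induction k generalizing y with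
  | zero => rfl
  | succ k ih =>
    rw [show 2 * (k + 1) = 2 * k + 1 + 1 by ring, Function.iterate_succ_apply,
      Function.iterate_succ_apply, bsucc, bsucc, ih, Function.iterate_succ_apply]

lemma bsucc_iterate_bval (x : List Bool) :
    bsucc^[bval x] (List.replicate x.length false) = x := by
  induction x with
  | nil => rfl
  | cons b l ih =>
    rw [bval, List.length_cons, List.replicate_succ, Function.iterate_add_apply,
      bsucc_iterate_two_mul, ih]
    cases b <;> rfl

lemma bval_lt (x : List Bool) : bval x < 2 ^ x.length := by
  induction x with
  | nil => simp [bval]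
  | cons b l ih =>
    rw [bval, List.length_cons, pow_succ]
    have := b.toNat_le
    omega

lemma exists_bval_eq (n i : ℕ) (h : i < 2 ^ n) : ∃ x, x.length = n ∧ bval x = i := by
  induction n generalizing i with
  | zero => exact ⟨[], rfl, by simp at h; simp [bval, h]⟩
  | succ n ih =>
    obtain ⟨x, hx, hv⟩ := ih (i / 2) (by rw [pow_succ] at h; omega)
    refine ⟨decide (i % 2 = 1) :: x, by simp [hx], ?_⟩
    rw [bval, hv]
    by_cases hi : i % 2 = 1 <;> simp [hi] <;> omega

lemma bsucc_iterate_replicate {n i : ℕ} (h : i < 2 ^ n) :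
    (bsucc^[i] (List.replicate n false)).length = n ∧
      bval (bsucc^[i] (List.replicate n false)) = i := by
  obtain ⟨x, rfl, rfl⟩ := exists_bval_eq n i h
  rw [bsucc_iterate_bval]
  exact ⟨rfl, rfl⟩

/-- The quantity `bval x + 2 ^ x.length` is one more than the rank of `x` in the
length-lexicographic order, also when the length jumps. -/
lemma bval_bsucc (x : List Bool) :
    bval (bsucc x) + 2 ^ (bsucc x).length = bval x + 2 ^ x.length + 1 := by
  induction x with
  | nil => rfl
  | cons b l ih => cases b <;> simp [bsucc, bval, pow_succ] <;> omega

lemma bval_bsucc_iterate (j : ℕ) (x : List Bool) :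
    bval (bsucc^[j] x) + 2 ^ (bsucc^[j] x).length = bval x + 2 ^ x.length + j := by
  induction j generalizing x with
  | zero => rfl
  | succ j ih => rw [Function.iterate_succ_apply, ih, bval_bsucc]; omega

lemma table_length (L : List Bool → Bool) (m : ℕ) (x : List Bool) : (table L m x).length = m := by
  simp [table]

/-- If `L` at length `n` is given by the bits of `w`, the table restores `w`, since the `j`-th
string from `0ⁿ` on has the value `j` as long as `j < 2 ^ n`. -/
lemma table_eq {L : List Bool → Bool} {w : List Bool} {n : ℕ} (hw : w.length ≤ 2 ^ n)
    (h : ∀ x, x.length = n → L x = w.getD (bval x) false) :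
    table L w.length (List.replicate n false) = w := by
  refine List.ext_getElem (table_length _ _ _) fun j h1 h2 => ?_
  obtain ⟨h3, h4⟩ := bsucc_iterate_replicate (h2.trans_le hw)
  simp [table, h _ h3, h4, h2]

open Frame.Prog

lemma ofDigitsMSB_append (n : ℕ) (a b : List Bool) :
    ofDigitsMSB n (a ++ b) = ofDigitsMSB (ofDigitsMSB n a) b := by
  induction a generalizing n with
  | nil => rfl
  | cons c a ih => simp [ofDigitsMSB, ih]

lemma ofDigitsMSB_reverse (y : List Bool) : ofDigitsMSB 0 y.reverse = bval y := by
  induction y with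
  | nil => rfl
  | cons b y ih => simp [ofDigitsMSB_append, ih, ofDigitsMSB, bval]; ring

lemma ofDigitsMSB_replicate_false (m n : ℕ) :
    ofDigitsMSB m (List.replicate n false) = m * 2 ^ n := by
  induction n generalizing m with
  | zero => simp [ofDigitsMSB]
  | succ n ih => simp [List.replicate_succ, ofDigitsMSB, ih, pow_succ]; ring

lemma bval_bits (n : ℕ) : bval n.bits = n := by
  induction n using Nat.binaryRec' with
  | zero => rfl
  | bit b n h ih =>
    rw [Nat.bits_append_bit n b h, bval, ih, Nat.bit_val]
    ring

end Strings

/-! ### From expectations to compiled machines -/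

namespace Frame

variable {I : Type} {Ms : I → RTM} [DecidableEq I]

namespace Prog

section

variable [Fintype I] {P : Prog Ms} {x y : List Bool} {t : ℕ}

lemma wp_eq_ex_compile (f : St Ms → ℝ≥0∞) : P.wp t (initSt Ms x y) f
    = ex P.compile.step t (P.compile.initCfg x y)
      (fun c => halted f (c.l, view (Ms := Ms) c.var c.stk)) :=
  (P.ex_compile t x y _).symm

lemma haltsWithin_compile {f : St Ms → ℝ≥0∞} (h : P.wp t (initSt Ms x y) f < ⊤) :
    P.compile.HaltsWithin x y t := by
  intro r
  rw [wp_eq_ex_compile] at h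
  have := P.compile.ex_lt_top h r
  generalize P.compile.run x y r = c at *
  obtain ⟨_ | l, v, S⟩ := c
  · rfl
  · simp [halted] at this

/-- The interface between calculus and machines: the single inequality yields halting on all paths,
since `1/3 < ⊤`, and success with probability at least `2/3`. -/
lemma compile_spec {w : List Bool}
    (h : P.wp t (initSt Ms x y) (fun s => if s.w 2 = w then 0 else 1) ≤ 1 / 3) :
    P.compile.HaltsWithin x y t ∧ 2 / 3 ≤ P.compile.probOutput x y t w := by
  refine ⟨haltsWithin_compile (h.trans_lt (by simp)), ?_⟩
  rw [RTM.probOutput_iff]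
  refine le_trans ?_ h
  rw [wp_eq_ex_compile]
  refine ex_mono (fun c => ?_) _ _
  obtain ⟨_ | l, v, S⟩ := c
  · have e : (S (.inl 2) = w.map id) = (S (.inl 2) = w) := by rw [List.map_id]
    by_cases hS : S (.inl 2) = w
    · refine le_of_eq_of_le (if_pos ⟨rfl, e ▸ hS⟩) zero_le
    · refine le_of_le_of_eq ?_ (if_neg hS).symm
      split_ifs <;> simp
  · simp [halted]

lemma compile_det {s' : St Ms} (h : P.Det t (initSt Ms x y) s') (r : Fin t → Bool) :
    P.compile.OutputsOn x y r (s'.w 2) := by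
  -- Charging `⊤` for a wrong output makes finiteness equivalent to correctness on every single
  -- path.
  have h1 : P.wp t (initSt Ms x y) (fun s => if s.w 2 = s'.w 2 then 0 else ⊤) < ⊤ :=
    (h _).trans_lt (by rw [if_pos rfl]; exact ENNReal.zero_lt_top)
  refine ⟨haltsWithin_compile h1 r, ?_⟩
  rw [wp_eq_ex_compile] at h1
  have := P.compile.ex_lt_top h1 r
  generalize P.compile.run x y r = c at *
  obtain ⟨_ | l, v, S⟩ := c
  · change S (.inl 2) = (s'.w 2).map id
    simp only [halted, view] at this
    rw [List.map_id]
    by_contra hne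
    exact lt_irrefl _ (lt_of_eq_of_lt (if_neg hne).symm this)
  · simp [halted] at this

end

lemma _root_.Frame.Implementable.iterate {op : St Ms → St Ms} (h : Implementable op) (n : ℕ) :
    Implementable (op^[n]) := by
  induction n with
  | zero => exact implementable_id
  | succ n ih => rw [Function.iterate_succ]; exact h.comp ih

variable (Ms) in
/-- Push `n` symbols on the work stack `a`. -/
def pushMany (a : Fin 12) (n : ℕ) : Prog Ms :=
  prim (St.push a fun _ _ => some true)^[n] ((implementable_push a _).iterate n)

omit [DecidableEq I] in
lemma push_iterate (a : Fin 12) (n : ℕ) (s : St Ms) :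
    (St.push a fun _ _ => some true)^[n] s =
      { s with w := Function.update s.w a (List.replicate n true ++ s.w a) } := by
  induction n generalizing s with
  | zero => simp
  | succ n ih =>
    rw [Function.iterate_succ_apply, ih]
    simp [St.push, List.replicate_succ']

lemma det_pushMany (a : Fin 12) (n : ℕ) (s : St Ms) : (pushMany Ms a n).Det 1 s
    { s with w := Function.update s.w a (List.replicate n true ++ s.w a) } := by
  rw [← push_iterate]
  exact Det.prim

variable (Ms) in
/-- For every symbol of the output of machine `i` push `n` symbols on the work stack `a`. -/
noncomputable def measure (i : I) (a : Fin 12) (n : ℕ) : Prog Ms :=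
  (prim (St.spop i (Ms i).kOut (decode Ms i)) (implementable_spop i _ _)).loop
    (fun r _ => r.isSome) (pushMany Ms a n)

lemma det_measure (i : I) (a : Fin 12) (n : ℕ) (s : St Ms) : ∃ s', (measure Ms i a n).Det
    (2 * (s.s i (Ms i).kOut).length + 1) s s' ∧ s'.w = Function.update s.w a
      (List.replicate (n * (s.s i (Ms i).kOut).length) true ++ s.w a) := by
  generalize hl : s.s i (Ms i).kOut = l
  induction l generalizing s with
  | nil =>
    refine ⟨s.spop i (Ms i).kOut (decode Ms i), (Det.loop_exit Det.prim ?_).mono (by simp), ?_⟩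
    · simp [St.spop, hl]
    · simp [St.spop]
  | cons x l ih =>
    have hB := det_pushMany a n (s.spop i (Ms i).kOut (decode Ms i))
    obtain ⟨s', h1, h2⟩ := ih { s.spop i (Ms i).kOut (decode Ms i) with
      w := Function.update (s.spop i (Ms i).kOut (decode Ms i)).w a (List.replicate n true ++
        (s.spop i (Ms i).kOut (decode Ms i)).w a) } (by simp [St.spop, hl])
    refine ⟨s', (Det.loop_step Det.prim (by simp [St.spop, hl]) hB h1).mono ?_, ?_⟩
    · simp only [List.length_cons]; omega
    · rw [h2]
      simp only [St.spop, Function.update_self, Function.update_idem, List.length_cons, mul_add,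
        mul_one, List.replicate_add, List.append_assoc]

end Prog

/-! ### The decider for the language read off from a construction -/

section Decider

/-- Two machines. -/
def pair (T A : RTM) (b : Bool) : RTM := cond b A T

open Prog

/-- On the input `x`, run `T` on `1ⁿ`, where `n` is the length of `x`, then `A` on `1ᵐ`, where `m`
is `k` times the length of the output of `T`, and return the bit with the number `bval x` of the
output of `A`. -/
noncomputable def bitDecider (T A : RTM) (k : ℕ) : RTM :=
  ((Prog.copy (pair T A) 0 3 10 (some true)).seq ((call (pair T A) 3 4 10 false).seq
    ((measure (pair T A) false 5 k).seq ((call (pair T A) 5 4 10 true).seq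
      (lookup 0 5 10 2 true (pair T A true).kOut (decode (pair T A) true)))))).compile

/-- The input `1ᵐ` of `A` remains on the stack `5` and caps the look-up, so the cost is of order `m`
times `x.length`, although `bval x` may be close to `2 ^ x.length`. Beyond the table the answer is
`false`. -/
lemma bitDecider_spec {T A : RTM} {k τT τA : ℕ} {x bits w : List Bool}
    (hT : ∀ r : Fin τT → Bool, T.OutputsOn (List.replicate x.length true) [] r bits)
    (hA : A.HaltsWithin (List.replicate (k * bits.length) true) [] τA)
    (hA' : 2 / 3 ≤ A.probOutput (List.replicate (k * bits.length) true) [] τA w) :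
    (bitDecider T A k).Answers x [] ((5 * x.length + 2) + ((5 * x.length + 5 + τT) +
      ((2 * bits.length + 1) + ((5 * (k * bits.length) + 5 + τA) +
        (k * bits.length + 1) * (4 * x.length + 10)))))
      (decide (bval x < k * bits.length) && w.getD (bval x) false) := by
  classical
  set Ms := pair T A
  refine compile_spec ?_
  have e0 : (initSt Ms x []).w = Function.update (fun _ => []) 0 x := by
    ext1 z
    by_cases hz : z = 0
    · subst hz; simp [initSt]
    by_cases hz : z = 1
    · subst hz; simp [initSt]
    simp [initSt, *]
  refine ((det_copy (by decide) (by decide) (by decide) (some true) (initSt Ms x [])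
    (by simp [initSt])).mono (by simp [initSt]) |>.wp_seq_le _).trans ?_
  set s₁ : St Ms := _
  change wp _ _ s₁ _ ≤ _
  have hw₁ : s₁.w = Function.update (Function.update (fun _ => []) 0 x) 3
      (List.replicate x.length true) := by
    simp [s₁, e0, List.map_const']
  clear_value s₁
  refine (wp_seq _ _ _ _).trans ((wp_anti (by simp [hw₁]) _ _).trans
    ((wp_call (by decide) (by decide) false s₁ (by simp [hw₁]) τT _).trans ?_))
  rw [show s₁.w 3 = List.replicate x.length true by simp [hw₁], show s₁.w 4 = [] by simp [hw₁]]
  refine RTM.ex_le_of_forall_run _ fun r => ?_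
  obtain ⟨hr1, hr2⟩ : (Ms false).OutputsOn (List.replicate x.length true) [] r bits := hT r
  generalize (Ms false).run (List.replicate x.length true) [] r = c at *
  rw [RTM.onHalt, if_pos hr1]
  obtain ⟨s₂, hs₂, hw₂⟩ := det_measure false 5 k (({ s₁ with r1 := none } : St Ms).setSlot false c)
  have hc : (({ s₁ with r1 := none } : St Ms).setSlot false c).s false (Ms false).kOut
      = bits.map (Ms false).bitOut := by simp [St.setSlot, hr2]
  rw [hc, List.length_map] at hs₂ hw₂
  refine (hs₂.wp_seq_le _).trans ?_
  have hw₂' : s₂.w = Function.update (Function.update (Function.update (fun _ => []) 0 x) 3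
      (List.replicate x.length true)) 5 (List.replicate (k * bits.length) true) := by
    rw [hw₂]; simp [St.setSlot, hw₁]
  clear hs₂ hw₂
  refine (wp_seq _ _ _ _).trans ((wp_anti (by simp [hw₂']) _ _).trans
    ((wp_call (by decide) (by decide) true s₂ (by simp [hw₂']) τA _).trans ?_))
  rw [show s₂.w 5 = List.replicate (k * bits.length) true by simp [hw₂'],
    show s₂.w 4 = [] by simp [hw₂']]
  refine le_trans ?_ (RTM.ex_onHalt_le (Ms true) hA hA')
  refine ex_mono (fun c => ?_) _ _
  unfold RTM.onHalt
  by_cases hl : c.l = none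
  swap
  · simp [hl]
  rw [if_pos hl, if_pos hl]
  obtain ⟨s₃, hs₃, hw₃⟩ := det_lookup (a := 0) (g := 5) (t := 10) (o := 2) (by decide) (by decide)
    (by decide) (by decide) (by decide) (by decide) true (Ms true).kOut (decode Ms true)
    (({ s₂ with r1 := none } : St Ms).setSlot true c) (by simp [St.setSlot, hw₂'])
  refine ((hs₃.mono ?_) _).trans ?_
  · simp [St.setSlot, hw₂']
  · rw [hw₃]
    simp only [St.setSlot, hw₂', Function.update_self]
    split_ifs with h1 h2 h2
    · exact le_rfl
    · exact zero_le
    · refine absurd ?_ h1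
      rw [h2, map_decode]
      simp
    · exact le_rfl

end Decider

end Frame

/-- Eighteen trials halve the error bound, so `18 m + 36` trials per entry bring the union bound
over `m` entries below `m · 2^{-m} / 4`. -/
lemma mul_pow_le_third (m : ℕ) : (m : ℝ≥0∞) * (17 / 18) ^ (18 * m + 36) ≤ 1 / 3 := by
  have h : (m : NNReal) * (17 / 18) ^ (18 * m + 36) ≤ 1 / 3 := by
    have h1 : ((17 : NNReal) / 18) ^ 18 ≤ 1 / 2 := by
      rw [← NNReal.coe_le_coe]; push_cast; norm_num
    have h2 : (m : NNReal) ≤ 2 ^ m := by exact_mod_cast Nat.lt_two_pow_self.le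
    calc (m : NNReal) * (17 / 18) ^ (18 * m + 36)
        = m * (((17 / 18) ^ 18) ^ m * ((17 / 18) ^ 18) ^ 2) := by
          rw [← pow_mul, ← pow_mul, ← pow_add]
      _ ≤ 2 ^ m * ((1 / 2) ^ m * (1 / 2) ^ 2) := by gcongr
      _ = (1 / 2) ^ 2 := by rw [← mul_assoc, ← mul_pow]; norm_num
      _ ≤ 1 / 3 := by rw [← NNReal.coe_le_coe]; push_cast; norm_num
  have := ENNReal.coe_le_coe.2 h
  simpa using this

/-! ### The machine that prints a table from a short description -/

namespace Frame

variable {I : Type} {Ms : I → RTM} [DecidableEq I]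

namespace Prog

variable (Ms) in
/-- For every symbol of the work stack `a` push `k` symbols on the stack `b` and `j` symbols on the
stack `c`. -/
def tally (a b c : Fin 12) (k j : ℕ) : Prog Ms := each a ((pushMany Ms b k).seq (pushMany Ms c j))

lemma det_tally {a b c : Fin 12} (hab : a ≠ b) (hac : a ≠ c) (hbc : b ≠ c) (k j : ℕ) (s : St Ms) :
    (tally Ms a b c k j).Det (3 * (s.w a).length + 1) s { s with
      r1 := none
      w := Function.update (Function.update (Function.update s.w a []) b
        (List.replicate (k * (s.w a).length) true ++ s.w b)) c
        (List.replicate (j * (s.w a).length) true ++ s.w c) } := by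
  refine (Det.each_of (fun l s => { s with
      r1 := none
      w := Function.update (Function.update (Function.update s.w a []) b
        (List.replicate (k * l.length) true ++ s.w b)) c
        (List.replicate (j * l.length) true ++ s.w c) })
        (fun _ => True) 2 ?_ ?_ s trivial).mono (by omega)
  · intro s _ h
    simp [Function.update_nil_of_eq h]
  · intro x l s _ h
    refine ⟨_, (det_pushMany b k _).seq (det_pushMany c j _), trivial, ?_, ?_⟩
    · simp [hab, hac]
    · simp only [St.mk.injEq, true_and, and_true]
      ext1 z
      by_cases hz1 : z = c
      · subst hz1
        simp [hac.symm, hbc.symm, mul_add, List.replicate_add, -List.replicate_append_replicate]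
      by_cases hz2 : z = b
      · subst hz2
        simp [hz1, hab.symm, mul_add, List.replicate_add, -List.replicate_append_replicate]
      by_cases hz3 : z = a
      · subst hz3; simp [hz1, hz2]
      simp [hz1, hz2, hz3]

/-- A self-delimiting form of the string `y`. -/
def _root_.delimit (y : List Bool) : List Bool := y.flatMap (fun b => [true, b]) ++ [false]

lemma _root_.delimit_length (y : List Bool) : (delimit y).length = 2 * y.length + 1 := by
  induction y with
  | nil => rfl
  | cons b y ih => simp [delimit] at ih ⊢; omega

variable (Ms) in
/-- Move a self-delimiting string from the stack `a` to the stack `b`. -/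
def undelimit (a b : Fin 12) : Prog Ms :=
  (pop Ms a).loop (fun r _ => r == some true) ((pop Ms a).seq (push Ms b fun r _ => r))

lemma det_undelimit {a b : Fin 12} (hab : a ≠ b) (y rest : List Bool) (s : St Ms)
    (h : s.w a = delimit y ++ rest) : ∃ s', (undelimit Ms a b).Det (3 * y.length + 1) s s' ∧
      s'.w = Function.update (Function.update s.w a rest) b (y.reverse ++ s.w b) := by
  induction y generalizing s with
  | nil =>
    refine ⟨s.pop a, (Det.loop_exit Det.prim ?_).mono (by simp), ?_⟩
    · simp [St.pop, h, delimit]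
    · ext1 z
      by_cases hz : z = b
      · subst hz; simp [St.pop, hab.symm]
      simp [St.pop, h, delimit, hz]
  | cons c y ih =>
    have hB := Det.prim (h := implementable_pop a) (s := s.pop a) |>.seq
      (Det.prim (h := implementable_push b fun r _ => r))
    obtain ⟨s', h1, h2⟩ := ih (((s.pop a).pop a).push b fun r _ => r) (by
      simp [St.push, St.pop, hab, h, delimit])
    refine ⟨s', (Det.loop_step Det.prim (by simp [St.pop, h, delimit]) hB h1).mono ?_, ?_⟩
    · simp only [List.length_cons]; omega
    · rw [h2]
      ext1 z
      by_cases hz : z = b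
      · subst hz; simp [St.push, St.pop, h, delimit, hab.symm]
      by_cases hz1 : z = a
      · subst hz1; simp [hz]
      simp [St.push, St.pop, hz, hz1]

variable (Ms) in
/-- Replace the string on the stack `3` by its `j`-th successor, where `j` is the height of the
stack `4`. -/
def succMany : Prog Ms := each 4 (succ Ms 3 10)

lemma _root_.bsucc_length_le (x : List Bool) : (bsucc x).length ≤ x.length + 1 := by
  induction x with
  | nil => simp [bsucc]
  | cons b l ih => cases b <;> simp [bsucc, ih]

lemma _root_.bsucc_iterate_length_le (j : ℕ) (x : List Bool) :
    (bsucc^[j] x).length ≤ x.length + j := by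
  induction j generalizing x with
  | zero => simp
  | succ j ih =>
    rw [Function.iterate_succ_apply]
    have := ih (bsucc x)
    have := bsucc_length_le x
    omega

lemma det_succMany (s : St Ms) (h10 : s.w 10 = []) : (succMany Ms).Det
    ((s.w 4).length * (4 * ((s.w 3).length + (s.w 4).length) + 4) + 1) s { s with
      r1 := none
      w := Function.update (Function.update s.w 4 []) 3 (bsucc^[(s.w 4).length] (s.w 3)) } := by
  -- A successor lengthens the string by at most one while the counter loses a symbol, so the sum of
  -- the two heights never increases and bounds the cost of each round.
  refine (Det.each_of (fun l s => { s with
      r1 := none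
      w := Function.update (Function.update s.w 4 []) 3 (bsucc^[l.length] (s.w 3)) })
      (fun s' => s'.w 10 = [] ∧ (s'.w 3).length + (s'.w 4).length ≤
        (s.w 3).length + (s.w 4).length)
      (4 * ((s.w 3).length + (s.w 4).length) + 3) ?_ ?_ s ⟨h10, le_rfl⟩).mono
      (by simp only [add_assoc]; exact le_rfl)
  · intro s h' h
    simp [Function.update_nil_of_eq h]
  · intro x l s₁ h' h
    refine ⟨_, (det_succ (by decide) _ (by simpa using h'.1)).mono ?_, ?_, ?_, ?_⟩
    · simp; omega
    · have := bsucc_length_le (s₁.w 3)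
      rw [h, List.length_cons] at h'
      simp [h'.1]
      omega
    · simp
    · simp [Function.update_comm (show (3 : Fin 12) ≠ 4 by decide)]

end Prog

open Prog

section Describer

/-- The family with the only member `M`. -/
def single (M : RTM) (_ : Unit) : RTM := M

/-- Read `k * l`, `n` and `α` from the input and print the answers of the machine `M` with the
advice `α` on the first `k * l` strings of length `n`. -/
noncomputable def describer (M : RTM) (k : ℕ) : RTM :=
  ((pushMany (single M) 6 36).seq ((scan (single M) 0 11 true).seq
    ((tally (single M) 11 5 6 k (18 * k)).seq ((undelimit (single M) 0 1).seq
      ((move (single M) 0 4 none).seq ((unary (single M) 1 3 10).seq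
        ((tabulate (single M) ()).seq (move (single M) 9 2 none)))))))).compile

/-- The input of `describer` for the numbers `l` and `n` and the advice `α`. -/
def description (l n : ℕ) (α : List Bool) : List Bool :=
  List.replicate l true ++ false :: (delimit n.bits ++ α.reverse)

lemma description_length (l n : ℕ) (α : List Bool) :
    (description l n α).length = l + 2 * n.size + α.length + 2 := by
  simp [description, delimit_length, Nat.size_eq_bits_len]; omega

lemma takeWhile_replicate_append {c d : Bool} (h : d ≠ c) (l : ℕ) (r : List Bool) :
    (List.replicate l c ++ d :: r).takeWhile (· = c) = List.replicate l c := by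
  induction l with
  | zero => simp [h]
  | succ l ih => simp [List.replicate_succ, ih]

lemma dropWhile_replicate_append {c d : Bool} (h : d ≠ c) (l : ℕ) (r : List Bool) :
    (List.replicate l c ++ d :: r).dropWhile (· = c) = d :: r := by
  induction l with
  | zero => simp [h]
  | succ l ih => simp [List.replicate_succ, ih]

/-- The number `l` is given in unary: it serves as a counter for both the size of the table and the
number of trials. The bits of `n` are self-delimiting, and `α` takes the rest. Popping reverses the
strings, which explains `α.reverse` in `description` and yields `n.bits` with the most significant
bit on top, as `unary` requires. -/
lemma describer_spec {M : RTM} {k l n N τ : ℕ} {α : List Bool} {L : List Bool → Bool}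
    (h : ∀ j < k * l, M.Answers (bsucc^[j] (List.replicate n false)) α τ
      (L (bsucc^[j] (List.replicate n false))))
    (hN : ∀ j < k * l, (bsucc^[j] (List.replicate n false)).length ≤ N) :
    2 / 3 ≤ (describer M k).probOutput (description l n α) [] (1 +
      ((2 * (description l n α).length + 1) + ((3 * l + 1) + ((3 * n.size + 1) +
        ((2 * α.length + 1) + ((n.size * (5 * n + 6) + 1) +
          ((k * l * ((18 * (k * l) + 36) * (5 * N + 5 * α.length + 15 + τ) + 4 * N + 10) + 1) +
            (2 * (k * l) + 1))))))))
      (table L (k * l) (List.replicate n false)) := by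
  classical
  set Ms := single M
  refine (compile_spec ?_).2
  set p := description l n α with hp
  have e0 : (initSt Ms p []).w = Function.update (fun _ => []) 0 p := by
    ext1 z
    by_cases hz : z = 0
    · subst hz; simp [initSt]
    by_cases hz : z = 1
    · subst hz; simp [initSt]
    simp [initSt, *]
  generalize initSt Ms p [] = s₀ at *
  refine ((det_pushMany 6 36 s₀).wp_seq_le _).trans ?_
  refine ((det_scan (by decide) true _).mono ?_ |>.wp_seq_le _).trans ?_
  · simp [e0]
  generalize hs₁ : (St.mk _ _ _ _ _ : St Ms) = s₁
  have hw₁ : s₁.w = Function.update (Function.update (Function.update (fun _ => []) 6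
      (List.replicate 36 true)) 0 (delimit n.bits ++ α.reverse)) 11 (List.replicate l false) := by
    subst hs₁
    ext1 z
    by_cases hz : z = 11
    · subst hz
      simp only [e0, hp, description, ne_eq, Fin.reduceEq, not_false_eq_true,
        Function.update_of_ne, Function.update_self]
      rw [takeWhile_replicate_append Bool.false_ne_true]
      simp
    by_cases hz0 : z = 0
    · subst hz0
      simp only [e0, hp, description, ne_eq, Fin.reduceEq, not_false_eq_true,
        Function.update_of_ne, Function.update_self]
      rw [dropWhile_replicate_append Bool.false_ne_true]
      rfl
    by_cases hz6 : z = 6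
    · subst hz6; simp [e0]
    simp [e0, hz, hz0, hz6]
  clear hs₁
  refine ((det_tally (by decide) (by decide) (by decide) k (18 * k) s₁).mono ?_
    |>.wp_seq_le _).trans ?_
  · simp [hw₁]
  generalize hs₂ : (St.mk _ _ _ _ _ : St Ms) = s₂
  have hw₂ : s₂.w = Function.update (Function.update (Function.update (fun _ => []) 6
      (List.replicate (18 * (k * l) + 36) true)) 0 (delimit n.bits ++ α.reverse)) 5
        (List.replicate (k * l) true) := by
    subst hs₂
    ext1 z
    by_cases hz : z = 5
    · subst hz; simp [hw₁]
    by_cases hz6 : z = 6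
    · subst hz6
      simp only [hw₁, ne_eq, Fin.reduceEq, not_false_eq_true, Function.update_of_ne,
        Function.update_self, List.length_replicate, List.replicate_append_replicate, mul_assoc]
    by_cases hz11 : z = 11
    · subst hz11; simp
    simp [hw₁, hz, hz6, hz11, Function.update_apply]
  clear hs₂
  obtain ⟨s₃, hs₃, hw₃⟩ := det_undelimit (a := 0) (b := 1) (by decide) n.bits α.reverse s₂
    (by simp [hw₂])
  refine ((hs₃.mono ?_).wp_seq_le _).trans ?_
  · rw [Nat.size_eq_bits_len]
  have hw₃' : s₃.w = Function.update (Function.update (Function.update (Function.update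
      (fun _ => []) 6 (List.replicate (18 * (k * l) + 36) true)) 0 α.reverse) 5
        (List.replicate (k * l) true)) 1 n.bits.reverse := by
    rw [hw₃]
    ext1 z
    by_cases hz : z = 1
    · subst hz; simp [hw₂]
    by_cases hz0 : z = 0
    · subst hz0; simp
    simp [hw₂, hz, hz0, Function.update_apply]
  clear hs₃ hw₃
  refine (((det_move (by decide) none s₃).mono ?_).wp_seq_le _).trans ?_
  · simp [hw₃']
  generalize hs₄ : (St.mk _ _ _ _ _ : St Ms) = s₄
  have hw₄ : s₄.w = Function.update (Function.update (Function.update (Function.update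
      (fun _ => []) 6 (List.replicate (18 * (k * l) + 36) true)) 4 α) 5
        (List.replicate (k * l) true)) 1 n.bits.reverse := by
    subst hs₄
    ext1 z
    by_cases hz : z = 4
    · subst hz; simp [hw₃']
    by_cases hz0 : z = 0
    · subst hz0; simp
    simp [hw₃', hz, hz0, Function.update_apply]
  clear hs₄
  have hn : ofDigitsMSB 0 (s₄.w 1) = n := by
    simp [hw₄, ofDigitsMSB_reverse, bval_bits]
  refine (((det_unary (by decide) (by decide) (by decide) s₄ 0 (by simp [hw₄])
    (by simp [hw₄])).mono ?_).wp_seq_le _).trans ?_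
  · rw [hn]
    simp [hw₄, Nat.size_eq_bits_len]
  rw [hn]
  generalize hs₅ : (St.mk _ _ _ _ _ : St Ms) = s₅
  have hw₅ : s₅.w = Function.update (Function.update (Function.update (Function.update
      (fun _ => []) 6 (List.replicate (18 * (k * l) + 36) true)) 4 α) 5
        (List.replicate (k * l) true)) 3 (List.replicate n false) := by
    subst hs₅
    ext1 z
    by_cases hz : z = 3
    · subst hz; simp
    by_cases hz0 : z = 1
    · subst hz0; simp
    simp [hw₄, hz, hz0, Function.update_apply]
  clear hs₅
  refine (wp_seq _ _ _ _).trans ?_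
  have h5 : s₅.w 5 = List.replicate (k * l) true := by simp [hw₅]
  have h6 : s₅.w 6 = List.replicate (18 * (k * l) + 36) true := by simp [hw₅]
  have h3 : s₅.w 3 = List.replicate n false := by simp [hw₅]
  have h4 : s₅.w 4 = α := by simp [hw₅]
  have := wp_tabulate (i := ()) (s := s₅) (τ := τ) (N := N) (L := L)
    (by rw [h5, h3, h4, List.length_replicate]; exact h)
    (by rw [h5, h3, List.length_replicate]; exact hN) (by simp [hw₅]) (by simp [hw₅])
    (by simp [hw₅]) (f := fun s' => (move Ms 9 2 none).wp (2 * (k * l) + 1) s'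
      fun s => if s.w 2 = table L (k * l) (List.replicate n false) then 0 else 1)
    (by
      rw [h5, h6, List.length_replicate, List.length_replicate]
      exact (mul_pow_le_third _).trans (ENNReal.div_le_of_le_mul (by norm_num)))
    (by
      intro s' o ho hs'
      rw [h5, List.length_replicate] at ho hs'
      refine (((det_move (by decide) none s').mono ?_) _).trans ?_
      · simp [hs', hw₅, ho]
      · simp [hs', hw₅])
  rw [h4, h5, h6, List.length_replicate, List.length_replicate] at this
  exact this.trans (mul_pow_le_third _)

end Describer

end Frame

lemma RTM.run_halted {M : RTM} {x y : List Bool} {t t' : ℕ} (h : t ≤ t') (r : Fin t' → Bool)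
    (h' : (M.run x y fun i : Fin t => r (i.castLE h)).l = none) :
    M.run x y r = M.run x y fun i : Fin t => r (i.castLE h) := by
  obtain ⟨d, rfl⟩ := Nat.exists_eq_add_of_le h
  induction d with
  | zero => rfl
  | succ d ih =>
    have := ih (by omega) (fun i => r i.castSucc) h'
    have h'' : (M.run x y fun i => r i.castSucc).l = none := (congrArg (fun c => c.l) this).trans h'
    refine Eq.trans ?_ this
    change List.foldl _ _ (List.ofFn (n := t + d + 1) r) = _
    rw [List.ofFn_succ', List.concat_eq_append, List.foldl_append, List.foldl_cons, List.foldl_nil]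
    exact M.step_halted _ h''

lemma RTM.HaltsWithin.mono {M : RTM} {x y : List Bool} {t t' : ℕ} (h : M.HaltsWithin x y t)
    (htt : t ≤ t') : M.HaltsWithin x y t' := fun r => by
  rw [RTM.run_halted htt r (h _)]; exact h _

lemma RTM.Answers.mono {M : RTM} {x y : List Bool} {t t' : ℕ} {a : Bool} (h : M.Answers x y t a)
    (htt : t ≤ t') : M.Answers x y t' a := ⟨h.1.mono htt, M.probOutput_mono htt h.2⟩

/-! ### The construction of strings from a language -/

namespace Frame

lemma initSt_w {I : Type} {Ms : I → RTM} (x : List Bool) : (initSt Ms x []).w = Function.update (fun _ => []) 0 x := by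
  ext1 z
  by_cases hz : z = 1
  · subst hz; simp [initSt]
  simp [initSt, Function.update_apply]

open Prog

section Constructor

/-- On `1ᵐ`, where `m ≥ 1`, print `b` and the answers of `M` on the first `m - 1` strings of length
`n`, where `n` is about `log m`. -/
noncomputable def tableConstructor (M : RTM) (b : Bool) : RTM :=
  ((pop (single M) 0).seq ((push (single M) 11 fun r _ => r).seq ((pushMany (single M) 6 36).seq
    ((Prog.copy (single M) 0 4 10 none).seq ((succMany (single M)).seq
      ((tally (single M) 0 5 6 1 18).seq ((pop (single M) 3).seq
        ((move (single M) 3 7 (some false)).seq ((move (single M) 7 3 none).seq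
          ((tabulate (single M) ()).seq ((move (single M) 9 2 none).seq
            ((pop (single M) 11).seq
              (push (single M) 2 fun r _ => r.map fun _ => b))))))))))))).compile

/-- The length of the strings tabulated by `tableConstructor` on `1ᵐ⁺¹`. -/
def tableWidth (m : ℕ) : ℕ := (bsucc^[m] []).length - 1

/-- The width is found by counting `m - 1` successors from the empty string and dropping one symbol.
The stack `11` remembers whether `m` is positive, so that the leading bit is omitted for `m = 0`. -/
lemma tableConstructor_spec {M : RTM} {m n τ : ℕ} (b : Bool) {L : List Bool → Bool}
    (hn : tableWidth (m - 1) = n)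
    (h : ∀ j < m - 1, M.Answers (bsucc^[j] (List.replicate n false)) [] τ
      (L (bsucc^[j] (List.replicate n false)))) :
    let t := 1 + (1 + (1 + ((5 * m + 2) + ((m * (4 * m + 4) + 1) + ((3 * m + 1) + (1 +
      ((2 * m + 1) + ((2 * m + 1) + ((m * ((18 * m + 36) * (5 * (2 * m) + 15 + τ) + 4 * (2 * m) + 10)
        + 1) + ((2 * m + 1) + (1 + 1)))))))))))
    let w := if m = 0 then [] else b :: table L (m - 1) (List.replicate n false)
    (tableConstructor M b).HaltsWithin (List.replicate m true) [] t ∧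
    2 / 3 ≤ (tableConstructor M b).probOutput (List.replicate m true) [] t w := by
  intro t w
  have hnm : n ≤ m - 1 := by
    have := bsucc_iterate_length_le (m - 1) []
    simp only [tableWidth, List.length_nil, zero_add] at this hn
    omega
  set Ms := single M
  refine compile_spec ?_
  set s₀ := initSt Ms (List.replicate m true) [] with hs₀
  have e0 : s₀.w = Function.update (fun _ => []) 0 (List.replicate m true) := initSt_w _
  clear_value s₀
  refine (Det.prim.wp_seq_le _).trans ?_
  refine (Det.prim.wp_seq_le _).trans ?_
  generalize hs₁ : St.push _ _ _ = s₁
  set z : List Bool := if m = 0 then [] else [true]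
  have hw₁ : s₁.w = Function.update (Function.update (fun _ => []) 0 (List.replicate (m - 1) true))
      11 z := by
    subst hs₁
    ext1 k
    rcases m with _ | m <;> fin_cases k <;> simp [St.push, St.pop, e0, z, List.replicate_succ]
  clear hs₁
  refine ((det_pushMany 6 36 s₁).wp_seq_le _).trans ?_
  refine (((det_copy (by decide) (by decide) (by decide) none _ ?_).mono ?_).wp_seq_le _).trans ?_
  · simp [hw₁]
  · simp [hw₁]
  generalize hs₂ : (St.mk _ _ _ _ _ : St Ms) = s₂
  have hw₂ : s₂.w = Function.update (Function.update (Function.update (Function.update (fun _ => [])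
      0 (List.replicate (m - 1) true)) 11 z) 6 (List.replicate 36 true)) 4
      (List.replicate (m - 1) true) := by
    subst hs₂
    ext1 k
    fin_cases k <;> simp [hw₁, -List.reduceReplicate]
  clear hs₂
  refine (((det_succMany _ ?_).mono ?_).wp_seq_le _).trans ?_
  · simp [hw₂]
  · simp only [hw₂, ne_eq, Fin.reduceEq, not_false_eq_true, Function.update_of_ne,
      Function.update_self, List.length_replicate, List.length_nil, zero_add]
    gcongr <;> omega
  refine (((det_tally (by decide) (by decide) (by decide) 1 18 _).mono ?_).wp_seq_le _).trans ?_
  · simp [hw₂]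
  refine (Det.prim.wp_seq_le _).trans ?_
  generalize hs₃ : St.pop _ _ = s₃
  have hw₃ : s₃.w = Function.update (Function.update (Function.update (Function.update (fun _ => [])
      11 z) 6 (List.replicate (18 * (m - 1) + 36) true)) 5
      (List.replicate (m - 1) true)) 3 (bsucc^[m - 1] []).tail := by
    subst hs₃
    ext1 k
    fin_cases k <;> simp [hw₂, St.pop, -List.reduceReplicate]
  clear hs₃
  have hl3 : (s₃.w 3).length = n := by simp [hw₃, ← hn, tableWidth]
  refine (((det_move (by decide) (some false) _).mono ?_).wp_seq_le _).trans ?_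
  · rw [hl3]; omega
  refine (((det_move (by decide) none _).mono ?_).wp_seq_le _).trans ?_
  · simp only [Function.update_self, List.length_append, List.length_map, List.length_reverse, hl3]
    simp [hw₃]; omega
  generalize hs₄ : (St.mk _ _ _ _ _ : St Ms) = s₄
  have hw₄ : s₄.w = Function.update (Function.update (Function.update (Function.update (fun _ => [])
      11 z) 6 (List.replicate (18 * (m - 1) + 36) true)) 5
      (List.replicate (m - 1) true)) 3 (List.replicate n false) := by
    subst hs₄
    rw [← hl3]
    ext1 k
    fin_cases k <;> simp [hw₃, List.map_const']
  clear hs₄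
  refine (wp_seq _ _ _ _).trans ?_
  have h5 : s₄.w 5 = List.replicate (m - 1) true := by simp [hw₄]
  have h6 : s₄.w 6 = List.replicate (18 * (m - 1) + 36) true := by simp [hw₄]
  have h3 : s₄.w 3 = List.replicate n false := by simp [hw₄]
  have h4 : s₄.w 4 = [] := by simp [hw₄]
  have := wp_tabulate (i := ()) (s := s₄) (τ := τ) (N := 2 * m) (L := L)
    (by rw [h5, h3, h4, List.length_replicate]; exact h)
    (by
      rw [h5, h3, List.length_replicate]
      intro j hj
      have := bsucc_iterate_length_le j (List.replicate n false)
      rw [List.length_replicate] at this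
      omega) (by simp [hw₄]) (by simp [hw₄])
    (by simp [hw₄]) (f := fun s' => ((move Ms 9 2 none).seq ((pop Ms 11).seq
      (push Ms 2 fun r _ => r.map fun _ => b))).wp ((2 * m + 1) + (1 + 1)) s'
      fun s => if s.w 2 = w then 0 else 1)
    (by
      rw [h5, h6, List.length_replicate, List.length_replicate]
      exact (mul_pow_le_third _).trans (ENNReal.div_le_of_le_mul (by norm_num)))
    (by
      intro s' o ho hs'
      rw [h5, List.length_replicate] at ho hs'
      rw [h5, h3, List.length_replicate]
      refine ((((det_move (by decide) none s').mono ?_).seq (Det.prim.seq Det.prim)) _).trans ?_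
      · simp [hs', hw₄, ho]
      · simp only [St.push, St.pop]
        rcases m with _ | m
        · simp [hs', hw₄, z, w, table, List.length_eq_zero_iff.1 ho]
        · simp [hs', hw₄, z, w])
  rw [h4, h5, h6, List.length_replicate, List.length_replicate] at this
  refine (wp_anti ?_ _ _).trans (this.trans (mul_pow_le_third _))
  have : m - 1 ≤ m := by omega
  simp only [List.length_nil, mul_zero, add_zero]
  gcongr

end Constructor

/-! ### Deciding a language with a compressed table as advice -/

section AdvisedDecider

lemma spop_setSlot {I : Type} {Ms : I → RTM} [DecidableEq I] (i : I) (k : (Ms i).K) (d : (Ms i).Γ k → Bool) (s : St Ms) (c : (Ms i).Cfg) :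
    ((s.setSlot i c).spop i k d).s i k = (c.stk k).tail := by
  simp [St.spop, St.setSlot]

/-- The binary digits, most significant first, of the number of steps encoded in an advice string. -/
def adviceDigits (α : List Bool) : List Bool :=
  (if (α.dropWhile (· = true)).head? = some false then [true] else []) ++
    List.replicate (α.takeWhile (· = true)).length false

/-- Run `U` on the program and for the number of steps given by the advice, and return the bit with
the number `bval x + 1` of the output. -/
noncomputable def advisedDecider (U : RTM) : RTM :=
  ((scan (single U) 1 5 true).seq
    ((push (single U) 5 fun r _ => if r = some false then some true else none).seq
      ((unary (single U) 5 6 10).seq ((Prog.copy (single U) 0 7 10 (some false)).seq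
        ((push (single U) 7 fun _ _ => some true).seq ((unary (single U) 7 8 10).seq
          ((callClocked (single U) 1 4 10 6 ()).seq
            ((prim (St.spop () U.kOut (decode (single U) ()))
              (implementable_spop (Ms := single U) () U.kOut _)).seq
              (lookup 0 8 10 2 () U.kOut (decode (single U) ())))))))))).compile

/-- Advice `1ˡ0p` gives the digits `10ˡ`, i.e. `2 ^ l` steps; without the separator `0` the number
of steps is `0`. The clock makes the decider halt even where `U` does not. Removing the head of the
output skips the leading bit of the described string. -/
lemma advisedDecider_spec {U : RTM} {x α : List Bool} {a : Bool} {T : ℕ}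
    (hT : ofDigitsMSB 0 (adviceDigits α) = T)
    (h : ex U.step T (U.initCfg (α.dropWhile (· = true)).tail []) (fun c =>
      if ((c.stk U.kOut).tail.map (decode (single U) ())).getD (bval x) false = a then 0 else 1)
        ≤ 1 / 3) :
    (advisedDecider U).Answers x α ((2 * α.length + 1) + (1 + (((α.length + 1) * (5 * T + 6) + 1) +
      ((5 * x.length + 2) + (1 + (((x.length + 1) * (5 * 2 ^ x.length + 6) + 1) +
        ((5 * α.length + 5 + (T + 1)) + (1 + (2 ^ x.length + 1) * (4 * x.length + 10)))))))))
      a := by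
  classical
  set Ms := single U
  refine compile_spec ?_
  set p := (α.dropWhile (· = true)).tail with hp
  have hpl : p.length ≤ α.length := by
    have := (List.dropWhile_suffix (l := α) (· = true)).length_le
    simp only [hp, List.length_tail]
    omega
  have hyl : (adviceDigits α).length ≤ α.length + 1 := by
    have := (List.takeWhile_prefix (l := α) (· = true)).length_le
    simp only [adviceDigits, List.length_append, List.length_replicate]
    split_ifs <;> simp only [List.length_singleton, List.length_nil] <;> omega
  have e0 : (initSt Ms x α).w = Function.update (Function.update (fun _ => []) 1 α) 0 x := rfl
  generalize initSt Ms x α = s₀ at *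
  refine (((det_scan (by decide) true s₀).mono ?_).wp_seq_le _).trans ?_
  · simp [e0]
  refine (Det.prim.wp_seq_le _).trans ?_
  generalize hs₁ : St.push _ _ _ = s₁
  have hw₁ : s₁.w = Function.update (Function.update (Function.update (fun _ => []) 1 p) 0 x) 5
      (adviceDigits α) := by
    subst hs₁
    ext1 k
    fin_cases k <;> simp [St.push, e0, p, adviceDigits]
    split_ifs <;> rfl
  clear hs₁
  refine (((det_unary (by decide) (by decide) (by decide) s₁ 0 ?_ ?_).mono ?_).wp_seq_le _).trans ?_
  · simp [hw₁]
  · simp [hw₁]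
  · simp only [hw₁, Function.update_self, hT]
    gcongr
  refine (((det_copy (by decide) (by decide) (by decide) (some false) _ ?_).mono ?_).wp_seq_le
    _).trans ?_
  · simp [hw₁]
  · simp [hw₁]
  refine (Det.prim.wp_seq_le _).trans ?_
  generalize hs₂ : St.push _ _ _ = s₂
  have hw₂ : s₂.w = Function.update (Function.update (Function.update (Function.update (fun _ => [])
      1 p) 0 x) 6 (List.replicate T false)) 7 (true :: List.replicate x.length false) := by
    subst hs₂
    ext1 k
    fin_cases k <;> simp [St.push, hw₁, hT, List.map_const']
  clear hs₂
  have h7 : ofDigitsMSB 0 (s₂.w 7) = 2 ^ x.length := by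
    simp [hw₂, ofDigitsMSB, ofDigitsMSB_replicate_false]
  refine (((det_unary (by decide) (by decide) (by decide) s₂ 0 ?_ ?_).mono ?_).wp_seq_le _).trans ?_
  · simp [hw₂]
  · simp [hw₂]
  · rw [h7]
    simp [hw₂]
  rw [h7]
  generalize hs₃ : (St.mk _ _ _ _ _ : St Ms) = s₃
  have hw₃ : s₃.w = Function.update (Function.update (Function.update (Function.update (fun _ => [])
      1 p) 0 x) 6 (List.replicate T false)) 8 (List.replicate (2 ^ x.length) false) := by
    subst hs₃
    ext1 k
    fin_cases k <;> simp [hw₂]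
  clear hs₃
  refine (wp_seq _ _ _ _).trans ?_
  refine (wp_anti (t := 5 * (s₃.w 1).length + 5 * (s₃.w 4).length + 5 + ((s₃.w 6).length + 1))
    ?_ _ _).trans ?_
  · simp [hw₃]; omega
  refine (wp_callClocked (by decide) (by decide) () s₃ (by simp [hw₃]) _ (fun c =>
      if ((c.stk U.kOut).tail.map (decode (single U) ())).getD (bval x) false = a then 0 else 1)
      ?_).trans (le_trans (le_of_eq ?_) h)
  swap
  · rw [show (s₃.w 6).length = T by simp [hw₃], show s₃.w 1 = p by simp [hw₃],
      show s₃.w 4 = [] by simp [hw₃]]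
    rfl
  intro r l c
  refine (Det.prim.wp_seq_le _).trans ?_
  set s₄ : St Ms := St.spop (Ms := Ms) () U.kOut (decode (single U) ())
    (({ s₃ with r1 := r, w := Function.update s₃.w 6 l } : St Ms).setSlot () c) with hs₄
  have hw₄ : s₄.w = Function.update s₃.w 6 l := rfl
  have hc : s₄.s () U.kOut = (c.stk U.kOut).tail := by
    exact spop_setSlot () _ _ _ _
  clear_value s₄
  obtain ⟨s₅, hs₅, hw₅⟩ := det_lookup (a := 0) (g := 8) (t := 10) (o := 2) (by decide) (by decide)
    (by decide) (by decide) (by decide) (by decide) () U.kOut (decode Ms ()) s₄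
    (by simp [hw₄, hw₃])
  refine ((hs₅.mono ?_) _).trans ?_
  · simp [hw₄, hw₃]
  · rw [hw₅, hc]
    simp only [hw₄, hw₃, ne_eq, Fin.reduceEq, not_false_eq_true, Function.update_of_ne,
      Function.update_self, List.length_replicate, bval_lt, decide_true, Bool.true_and,
      List.cons.injEq, and_true]
    split_ifs with h1 h2 h2
    · exact le_rfl
    · exact zero_le
    · exact absurd h2 h1
    · exact le_rfl

end AdvisedDecider

/-! ### Constructivity of the doubly exponential time bound -/

section DoubleExp

/-- The family without members. -/
def noMachines : Empty → RTM := Empty.elim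

/-- A deterministic machine that prints `2 ^ 2 ^ (n - q)` on the input `1ⁿ`. -/
noncomputable def doubleExp (q : ℕ) : RTM :=
  ((prim (St.pop (Ms := noMachines) 0)^[q] ((implementable_pop 0).iterate q)).seq
    ((move noMachines 0 5 (some false)).seq ((push noMachines 5 fun _ _ => some true).seq
      ((unary noMachines 5 6 10).seq ((push noMachines 2 fun _ _ => some true).seq
        (move noMachines 6 2 none)))))).compile

lemma _root_.Nat.bits_two_pow (j : ℕ) : (2 ^ j).bits = List.replicate j false ++ [true] := by
  induction j with
  | zero => simp
  | succ j ih => rw [pow_succ', Nat.bit0_bits _ (by positivity), ih]; rfl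

lemma _root_.Nat.two_mul_le_two_pow (i : ℕ) : 2 * i ≤ 2 ^ i := by
  rcases i with _ | i
  · simp
  · have := Nat.lt_two_pow_self (n := i)
    rw [pow_succ]; omega

lemma _root_.Nat.mul_self_two_pow_le (i : ℕ) : 2 ^ i * 2 ^ i ≤ 2 ^ 2 ^ i := by
  rw [← pow_add, ← two_mul]
  exact Nat.pow_le_pow_right two_pos (Nat.two_mul_le_two_pow i)

lemma pop_iterate (q n : ℕ) (s : St noMachines) (h : s.w 0 = List.replicate n true) :
    ((St.pop 0)^[q] s).w = Function.update s.w 0 (List.replicate (n - q) true) := by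
  induction q generalizing s n with
  | zero => simp [← h]
  | succ q ih =>
    rw [Function.iterate_succ_apply, ih (n - 1) _ (by simp [St.pop, h])]
    simp [St.pop, Nat.sub_sub, add_comm]

lemma doubleExp_coinless (q : ℕ) : (doubleExp q).Deterministic :=
  ((prim_coinless _).seq ((move_coinless _ _ _).seq ((prim_coinless _).seq
    (Coinless.seq (Coinless.each ((prim_coinless _).seq (Coinless.seq (Coinless.each
      ((prim_coinless _).seq (prim_coinless _)) _) (move_coinless _ _ _))) _)
      ((prim_coinless _).seq (move_coinless _ _ _)))))).deterministic

/-- The output has only `2 ^ (n - q) + 1` bits, and `2^i · 2^i ≤ 2^{2^i}` absorbs the cost of the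
unary conversion. The `q` symbols are removed in one step, so the constant does not depend on `q`.
-/
lemma constructive_two_pow_two_pow (q : ℕ) : Constructive fun n => 2 ^ 2 ^ (n - q) := by
  refine ⟨doubleExp q, 30, doubleExp_coinless q, fun n r => ?_⟩
  set s₀ : St noMachines := initSt noMachines (List.replicate n true) [] with hs₀
  have e0 : s₀.w = Function.update (fun _ => []) 0 (List.replicate n true) := initSt_w _
  have e1 := pop_iterate q n s₀ (by simp [e0])
  have h1 : (prim (St.pop (Ms := noMachines) 0)^[q] ((implementable_pop 0).iterate q)).Det 1 s₀
    ((St.pop 0)^[q] s₀) := Det.prim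
  generalize (St.pop 0)^[q] s₀ = s₁ at e1 h1
  obtain ⟨s', s₂, h2, h3, e2⟩ : ∃ s' s₂ : St noMachines,
      (move noMachines 0 5 (some false)).Det (2 * (s₁.w 0).length + 1) s₁ s' ∧
      (push noMachines 5 fun _ _ => some true).Det 1 s' s₂ ∧
      s₂.w = Function.update (fun _ => []) 5 (true :: List.replicate (n - q) false) := by
    refine ⟨_, _, det_move (by decide) (some false) s₁, Det.prim, ?_⟩
    ext1 k
    fin_cases k <;> simp [St.push, e1, e0]
  have h6 : ofDigitsMSB 0 (s₂.w 5) = 2 ^ (n - q) := by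
    simp [e2, ofDigitsMSB, ofDigitsMSB_replicate_false]
  have h4 := det_unary (y := 5) (x := 6) (t := 10) (by decide) (by decide) (by decide) s₂ 0
    (by simp [e2]) (by simp [e2])
  have h5 := h1.seq (h2.seq (h3.seq (h4.seq
    ((Det.prim (h := implementable_push 2 fun _ _ => some true)).seq
      (det_move (a := 6) (b := 2) (by decide) none _)))))
  have h := compile_det (h5.mono ?_) r
  · refine Eq.subst (motive := fun w => (doubleExp q).OutputsOn _ _ r w) ?_ h
    rw [Nat.bits_two_pow]
    simp only [St.push, h6]
    simp [e2]
  · rw [h6]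
    simp only [St.push, e1, e2, Function.update_self, List.length_replicate, List.length_cons,
      ne_eq, Fin.reduceEq, not_false_eq_true, Function.update_of_ne]
    generalize n - q = i
    have h7 : i + 1 ≤ 2 ^ i := Nat.lt_two_pow_self
    have h8 := Nat.mul_self_two_pow_le i
    have h9 : 2 ^ i ≤ 2 ^ 2 ^ i := Nat.lt_two_pow_self.le
    have h10 := Nat.mul_le_mul_right (5 * 2 ^ i + 6) h7
    nlinarith

end DoubleExp

end Frame

/-! ### Bounds on complexity versus existence of programs -/

section Complexity

variable {U : RTM} {x : List Bool}

lemma RTM.exists_of_rK_le {t a : ℕ} (h : U.rK t x ≤ a) :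
    ∃ p : List Bool, p.length ≤ a ∧ 2 / 3 ≤ U.probOutput p [] t x := by
  by_contra! h'
  have : ((a + 1 : ℕ) : ℕ∞) ≤ U.rK t x := by
    refine le_iInf₂ fun p hp => ?_
    by_contra! hlt
    exact absurd hp (not_le.2 (h' p (by
      have := ENat.natCast_lt_natCast.1 hlt
      omega)))
  exact absurd (ENat.natCast_le_natCast.1 (this.trans h)) (by omega)

lemma RTM.rK_le {t : ℕ} {p : List Bool} (h : 2 / 3 ≤ U.probOutput p [] t x) :
    U.rK t x ≤ p.length := iInf₂_le p h

lemma RTM.le_of_ofReal_le_rKt {r : ℝ} {t : ℕ} {p : List Bool} (ht : 1 ≤ t)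
    (h : ENNReal.ofReal r ≤ (U.rKt x : ℝ≥0∞)) (h' : 2 / 3 ≤ U.probOutput p [] t x) :
    r ≤ p.length + Nat.clog 2 t := by
  have h1 : U.rKt x ≤ ((p.length + Nat.clog 2 t : ℕ) : ℕ∞) :=
    iInf_le_of_le p (iInf_le_of_le t (iInf_le_of_le ht (iInf_le _ h')))
  have h2 := h.trans (ENat.toENNReal_le.2 h1)
  rw [ENat.toENNReal_coe, ENNReal.ofReal_le_natCast] at h2
  exact_mod_cast h2

lemma RTM.exists_of_rKt_lt_ofReal {r : ℝ} (h : (U.rKt x : ℝ≥0∞) < ENNReal.ofReal r) :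
    ∃ (p : List Bool) (t : ℕ), 1 ≤ t ∧ 2 / 3 ≤ U.probOutput p [] t x ∧
      (p.length + Nat.clog 2 t : ℝ) < r := by
  by_contra! h'
  refine absurd h (not_lt.2 ?_)
  rcases eq_or_ne (U.rKt x) ⊤ with htop | htop
  · rw [htop]; exact le_top
  obtain ⟨a, ha⟩ := ENat.ne_top_iff_exists.1 htop
  rw [← ha, ENat.toENNReal_coe, ENNReal.ofReal_le_natCast]
  by_contra! hlt
  have : ((a + 1 : ℕ) : ℕ∞) ≤ U.rKt x := by
    refine le_iInf fun p => le_iInf fun t => le_iInf fun ht => le_iInf fun hp => ?_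
    have h1 := hlt.trans_le (h' p t ht hp)
    have h2 : a < p.length + Nat.clog 2 t := by exact_mod_cast h1
    exact ENat.natCast_le_natCast.2 h2
  rw [← ha, ENat.natCast_le_natCast] at this
  omega

end Complexity

/-! ### Running time estimates -/

section Growth

lemma eventually_mul_sq_le_two_pow (B : ℕ) : ∀ᶠ l : ℕ in atTop, B * (l + 1) ^ 2 ≤ 2 ^ l := by
  have h := tendsto_pow_const_div_const_pow_of_one_lt 2 (one_lt_two : (1 : ℝ) < 2)
  have h1 := h.comp (tendsto_add_atTop_nat 1)
  have h2 := (h1.eventually (gt_mem_nhds (show (0 : ℝ) < 1 / (2 * (B + 1)) by positivity)))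
  filter_upwards [h2] with l hl
  simp only [Function.comp_apply, Nat.cast_add, Nat.cast_one] at hl
  rw [div_lt_div_iff₀ (by positivity) (by positivity), pow_succ (2 : ℝ) l] at hl
  have : ((B * (l + 1) ^ 2 : ℕ) : ℝ) ≤ ((2 ^ l : ℕ) : ℝ) := by
    push_cast
    nlinarith [sq_nonneg ((l : ℝ) + 1)]
  exact_mod_cast this

/-- Here `T` is the value `t n` and `l` its bit length, so `2 ^ (c * K * l)` is of order `T ^ (c *
K)`; the exponent `+ 2` covers the product of `l` and `n` in the look-up. The summand `N` takes care
of the finitely many `n` with `n > t n`. -/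
lemma decider_time_bound (c K C N : ℕ) : ∃ B : ℕ, ∀ n T l : ℕ, n ≤ T + N → l ≤ T →
    2 ^ l ≤ 2 * T + 1 → (5 * n + 2) + ((5 * n + 5 + (C * T + C)) + ((2 * l + 1) +
      ((5 * (K * l) + 5 + 2 ^ (c * (K * l) + c)) + (K * l + 1) * (4 * n + 10)))) ≤
      B * T ^ (c * K + 2) + B := by
  set B := (5 * (N + 1) + 2) + ((5 * (N + 1) + 5 + (C + C)) + ((2 + 1) + ((5 * K + 5 +
    2 ^ (c * K + c)) + (K + 1) * (4 * (N + 1) + 10)))) with hB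
  refine ⟨B * 2 ^ (c * K + 2), fun n T l hn hl hT => ?_⟩
  set S := T + 1 with hS
  set Q := S ^ (c * K + 2) with hQ
  have hSQ : S ≤ Q := Nat.le_self_pow (by omega) _
  have hSS : S * S ≤ Q := by
    rw [hQ, pow_add, sq]
    exact Nat.le_mul_of_pos_left _ (by positivity)
  have h1Q : 1 ≤ Q := Nat.one_le_pow _ _ (by omega)
  have hn' : n ≤ (N + 1) * S := by rw [hS]; nlinarith
  have hp : 2 ^ (c * (K * l) + c) ≤ 2 ^ (c * K + c) * Q := by
    calc 2 ^ (c * (K * l) + c) = (2 ^ l) ^ (c * K) * 2 ^ c := by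
          rw [← pow_mul, ← pow_add]; ring_nf
      _ ≤ (2 * S) ^ (c * K) * 2 ^ c := by gcongr; omega
      _ = 2 ^ (c * K + c) * S ^ (c * K) := by rw [mul_pow, pow_add]; ring
      _ ≤ 2 ^ (c * K + c) * Q := by
          rw [hQ]
          exact Nat.mul_le_mul_left _ (Nat.pow_le_pow_right (by omega) (by omega))
  have hl' : l ≤ S := by omega
  have hprod : (K * l + 1) * (4 * n + 10) ≤ (K + 1) * (4 * (N + 1) + 10) * Q := by
    calc (K * l + 1) * (4 * n + 10) ≤ (K * S + S) * (4 * ((N + 1) * S) + 10 * S) := by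
          gcongr <;> omega
      _ = (K + 1) * (4 * (N + 1) + 10) * (S * S) := by ring
      _ ≤ _ := by gcongr
  have hQT : Q ≤ 2 ^ (c * K + 2) * T ^ (c * K + 2) + 2 ^ (c * K + 2) := by
    rcases Nat.eq_zero_or_pos T with h0 | h0
    · rw [hQ, hS, h0]
      simp only [zero_add, one_pow]
      exact (Nat.one_le_two_pow (n := c * K + 2)).trans (Nat.le_add_left _ _)
    · refine le_trans ?_ (Nat.le_add_right _ _)
      rw [hQ, ← mul_pow]
      gcongr
      omega
  calc _ ≤ (5 * ((N + 1) * Q) + 2 * Q) + ((5 * ((N + 1) * Q) + 5 * Q + (C * Q + C * Q)) +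
        ((2 * Q + 1 * Q) + ((5 * (K * Q) + 5 * Q + 2 ^ (c * K + c) * Q) +
          (K + 1) * (4 * (N + 1) + 10) * Q))) := by
        have : n ≤ (N + 1) * Q := hn'.trans (by gcongr)
        have : l ≤ Q := hl'.trans hSQ
        have : T ≤ Q := by omega
        have : C ≤ C * Q := Nat.le_mul_of_pos_right _ h1Q
        gcongr <;> omega
    _ = B * Q := by rw [hB]; ring
    _ ≤ B * (2 ^ (c * K + 2) * T ^ (c * K + 2) + 2 ^ (c * K + 2)) := by gcongr
    _ = _ := by ring

/-- The running time is of order `(l + 1)^2 · 2^l`: quadratically many simulations in `l`, each of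
time at most of order `2^l`. -/
lemma describer_time_bound (K C : ℕ) : ∀ᶠ l : ℕ in atTop, ∀ n a b T : ℕ, n ≤ 2 ^ l → T ≤ 2 ^ l →
    a ≤ l → b ≤ l → (1 + ((2 * (4 * l + 2) + 1) + ((3 * l + 1) + ((3 * b + 1) +
        ((2 * a + 1) + ((b * (5 * n + 6) + 1) +
          ((K * l * ((18 * (K * l) + 36) * (5 * n + 5 * a + 15 + (C * T + C)) + 4 * n + 10) + 1) +
            (2 * (K * l) + 1)))))))) ≤ 4 ^ l := by
  set B := 1 + ((2 * 6 + 1) + ((3 + 1) + ((3 + 1) + ((2 + 1) + ((11 + 1) +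
    ((K * ((18 * K + 36) * (5 + 5 + 15 + (C + C)) + 4 + 10) + 1) + (2 * K + 1))))))) with hB
  filter_upwards [eventually_mul_sq_le_two_pow B] with l hl n a b T hn hT ha hb
  set S := l + 1 with hS
  set P := 2 ^ l with hP
  have h1 : 1 ≤ P := Nat.one_le_two_pow
  have hSP : S ≤ P := Nat.lt_two_pow_self
  have h1S : 1 ≤ S := by omega
  have hSS : S ≤ S * S := Nat.le_mul_of_pos_right _ h1S
  have hQ1 : S ≤ S * S * P := hSS.trans (Nat.le_mul_of_pos_right _ h1)
  have hQ2 : S * P ≤ S * S * P := by gcongr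
  set Q := S * S * P with hQ
  have h4 : 4 ^ l = P * P := by rw [hP, ← mul_pow]; norm_num
  have hx : K * l * ((18 * (K * l) + 36) * (5 * n + 5 * a + 15 + (C * T + C)) + 4 * n + 10) ≤
      K * ((18 * K + 36) * (5 + 5 + 15 + (C + C)) + 4 + 10) * Q := by
    calc _ ≤ K * S * ((18 * (K * S) + 36 * S) * (5 * P + 5 * P + 15 * P + (C * P + C * P)) +
          4 * (S * P) + 10 * (S * P)) := by
          have : l ≤ S := by omega
          have : a ≤ P := by omega
          have : C ≤ C * P := Nat.le_mul_of_pos_right _ h1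
          have : n ≤ S * P := hn.trans (Nat.le_mul_of_pos_left _ h1S)
          have : 1 ≤ S * P := h1.trans (Nat.le_mul_of_pos_left _ h1S)
          gcongr <;> omega
      _ = _ := by rw [hQ]; ring
  have hy : b * (5 * n + 6) ≤ 11 * Q := by
    calc b * (5 * n + 6) ≤ S * (5 * P + 6 * P) := by gcongr <;> omega
      _ = 11 * (S * P) := by ring
      _ ≤ _ := by gcongr
  have h1Q : 1 ≤ Q := h1S.trans hQ1
  calc _ ≤ 1 * Q + ((2 * (6 * Q) + 1 * Q) + ((3 * Q + 1 * Q) + ((3 * Q + 1 * Q) +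
        ((2 * Q + 1 * Q) + ((11 * Q + 1 * Q) +
        ((K * ((18 * K + 36) * (5 + 5 + 15 + (C + C)) + 4 + 10) * Q + 1 * Q) +
          (2 * (K * Q) + 1 * Q))))))) := by
        have : l ≤ Q := by omega
        gcongr <;> omega
    _ = B * S ^ 2 * P := by rw [hB, hQ]; ring
    _ ≤ 4 ^ l := by rw [h4]; gcongr

end Growth

/-! ### From constructions to the hierarchy theorem -/

open Frame

lemma Nat.two_pow_size_le (n : ℕ) : 2 ^ n.size ≤ 2 * n + 1 := by
  rcases h : n.size with _ | s
  · simp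
  · have := Nat.lt_size.1 (h ▸ Nat.lt_succ_self s : s < n.size)
    rw [pow_succ]; omega

lemma Nat.size_le_self (n : ℕ) : n.size ≤ n := Nat.size_le.2 Nat.lt_two_pow_self

lemma Nat.log_le_size (n : ℕ) : Nat.log 2 n ≤ n.size := by
  rcases Nat.eq_zero_or_pos n with rfl | h
  · simp
  · exact (Nat.lt_size.2 (Nat.pow_log_le_self 2 h.ne')).le

lemma exists_language_of_construction {U : RTM} (hU : U.TimeOptimal) {ε : ℝ} (hε : 0 < ε) {A : RTM}
    {c : ℕ} (hA : ∀ m : ℕ, A.HaltsWithin (List.replicate m true) [] (2 ^ (c * m + c)) ∧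
      ∃ w : List Bool, w.length = m ∧
        2 / 3 ≤ A.probOutput (List.replicate m true) [] (2 ^ (c * m + c)) w ∧
        ENNReal.ofReal (ε * m) ≤ (U.rKt w : ℝ≥0∞)) :
    ∃ k : ℕ, 1 ≤ k ∧ ∃ lam : ℝ, 0 < lam ∧ ∀ t : ℕ → ℕ, Constructive t →
        (∀ᶠ n : ℕ in atTop, n ≤ t n ∧ (t n : ℝ) ≤ (2 : ℝ) ^ (lam * (2 : ℝ) ^ n)) →
        ∃ L : Language Bool, L ∈ BPTIME (fun n => t n ^ k) ∧
          L ∉ io (BPTIMEAdvice t (fun n => Nat.log 2 (t n))) := by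
  classical
  choose w hw hwp hwr using fun m => (hA m).2
  -- The assumed decider will give complexity at most `4l` (program) plus `3l` (logarithm of the
  -- time) plus `2 + c'`, which is below `8l` for large `l`.
  obtain ⟨K, hK1, hK⟩ : ∃ K : ℕ, 1 ≤ K ∧ 8 ≤ ε * K := by
    obtain ⟨K, hK⟩ := exists_nat_ge (8 / ε)
    rw [div_le_iff₀ hε] at hK
    refine ⟨K + 1, by omega, ?_⟩
    push_cast
    nlinarith
  have hK0 : (0 : ℝ) < K := by exact_mod_cast hK1
  -- The bound on `t` gives `K · log t ≤ 2^n / 2`, so that all `K * l` bits fit into a truth table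
  -- on `n` variables; the other half of `2^n` absorbs rounding.
  refine ⟨c * K + 2, by omega, 1 / (2 * K), by positivity, fun t ⟨T, C, _, hT⟩ ht => ?_⟩
  obtain ⟨N, hN⟩ := eventually_atTop.1 ht
  have hbits : ∀ n, (t n).bits.length = (t n).size := fun n => Nat.size_eq_bits_len _
  set L : Language Bool := {x | (w (K * (t x.length).size)).getD (bval x) false = true} with hL
  have hLx : ∀ x, x ∈ L ↔ (w (K * (t x.length).size)).getD (bval x) false = true := fun x => Iff.rfl
  refine ⟨L, ?_, ?_⟩
  · obtain ⟨B, hB⟩ := decider_time_bound c K C N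
    refine ⟨bitDecider T A K, B, fun x => ?_⟩
    have h1 := bitDecider_spec (k := K) (A := A) (hT x.length)
      (by rw [hbits]; exact (hA _).1) (by rw [hbits]; exact hwp _)
    rw [hbits] at h1
    have h2 : (decide (bval x < K * (t x.length).size) &&
        (w (K * (t x.length).size)).getD (bval x) false) = decide (x ∈ L) := by
      rw [Bool.eq_iff_iff]
      simp only [Bool.and_eq_true, decide_eq_true_eq, hLx, and_iff_right_iff_imp]
      intro h
      by_contra! hlt
      rw [List.getD_eq_default _ _ (by rw [hw]; exact hlt)] at h
      exact Bool.false_ne_true h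
    rw [h2] at h1
    refine h1.mono (hB _ _ _ ?_ (Nat.size_le_self _) (Nat.two_pow_size_le _))
    rcases le_total N x.length with h | h
    · exact (hN _ h).1.trans (Nat.le_add_right _ _)
    · exact h.trans (Nat.le_add_left _ _)
  · rintro ⟨L', ⟨M, C', α, hα, hM⟩, hfreq⟩
    obtain ⟨c', hc'⟩ := hU (describer M K)
    have hsize : Tendsto (fun n => (t n).size) atTop atTop := by
      refine tendsto_atTop.2 fun b => ?_
      filter_upwards [eventually_ge_atTop (max N (2 ^ b))] with n hn
      exact (Nat.lt_size.2 (((le_max_right _ _).trans hn).trans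
        (hN n ((le_max_left _ _).trans hn)).1)).le
    have hlarge := hsize.eventually ((describer_time_bound K C').and
      ((eventually_mul_sq_le_two_pow (2 * c' + K)).and (eventually_gt_atTop (c' + 2))))
    have hwide : ∀ᶠ n in atTop, K * (t n).size ≤ 2 ^ n := by
      filter_upwards [ht, eventually_ge_atTop (2 * K)] with n hn hKn
      have h0 : t n ≠ 0 := by omega
      have h1 : ((t n).size : ℝ) ≤ Nat.log 2 (t n) + 1 := by
        exact_mod_cast Nat.size_le.2 (Nat.lt_pow_succ_log_self one_lt_two _)
      have h2 : ((2 : ℝ) ^ (Nat.log 2 (t n) : ℝ)) ≤ (2 : ℝ) ^ (1 / (2 * K) * (2 : ℝ) ^ n) := by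
        refine le_trans ?_ hn.2
        rw [Real.rpow_natCast]
        exact_mod_cast Nat.pow_log_le_self 2 h0
      rw [Real.rpow_le_rpow_left_iff one_lt_two, div_mul_eq_mul_div, one_mul,
        le_div_iff₀ (by positivity)] at h2
      have h3 : (2 * K : ℝ) ≤ 2 ^ n := by exact_mod_cast hKn.trans Nat.lt_two_pow_self.le
      have h1 : (K : ℝ) * (t n).size ≤ 2 ^ n := by nlinarith
      exact_mod_cast h1
    obtain ⟨n, hagree, ⟨hbound, hsq, hsize'⟩, hwid, hnt, _⟩ :=
      (hfreq.and_eventually (hlarge.and (hwide.and ht))).exists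
    set l := (t n).size with hl
    have hmem : ∀ j < K * l, (bsucc^[j] (List.replicate n false)).length = n := fun j hj =>
      (bsucc_iterate_replicate (hj.trans_le hwid)).1
    have htab : table (fun x => decide (x ∈ L)) (K * l) (List.replicate n false) = w (K * l) := by
      have := table_eq (w := w (K * l)) (n := n) (L := fun x => decide (x ∈ L))
        (by rw [hw]; exact hwid) (fun x hx => by
          rw [Bool.eq_iff_iff, decide_eq_true_eq, hLx, hx])
      rwa [hw] at this
    -- All tabulated strings have length exactly `n`, where the advised machine `M` decides `L`.
    have hdesc := describer_spec (M := M) (k := K) (l := l) (n := n) (N := n) (α := α n)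
      (τ := C' * t n + C') (L := fun x => decide (x ∈ L))
      (fun j hj => by
        have h1 := hmem j hj
        have h2 := hM (bsucc^[j] (List.replicate n false))
        rw [h1] at h2
        simp only [hagree _ h1]
        exact h2)
      (fun j hj => (hmem j hj).le)
    rw [htab] at hdesc
    have hαl : (α n).length ≤ l := (hα n).trans (Nat.log_le_size _)
    have hnl : n.size ≤ l := Nat.size_le_size hnt
    have hlen : (description l n (α n)).length ≤ 4 * l + 2 := by
      rw [description_length]; omega
    have hdesc' := RTM.probOutput_mono _ (le_trans (by gcongr) (hbound n (α n).length n.size (t n)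
      (hnt.trans (Nat.lt_size_self _).le) (Nat.lt_size_self _).le hαl hnl)) hdesc
    have hx : (w (K * l)).length ≤ 4 ^ l := by
      rw [hw]
      refine le_trans ?_ (hsq.trans (Nat.pow_le_pow_left (by norm_num) l))
      gcongr
      · omega
      · nlinarith
    -- Time-optimality replaces `describer M K` by `U`, at the cost of `c'` further bits, where `c'`
    -- depends only on `M` and `K`.
    have h1 := (hc' (w (K * l)) (4 ^ l) hx).trans
      (add_le_add_left (RTM.rK_le hdesc') _)
    obtain ⟨p, hp, hpU⟩ := RTM.exists_of_rK_le (a := 4 * l + 2 + c')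
      (h1.trans (by exact_mod_cast Nat.add_le_add_right hlen c'))
    -- The overhead `c' * (2 * l + 1)` of the simulation is at most `2 ^ l`, so `4 ^ l` grows to at
    -- most `2 ^ (3 * l)`.
    have hpU' := U.probOutput_mono (t' := 2 ^ (3 * l)) (by
      have h2 : (4 : ℕ) ^ l = 2 ^ (2 * l) := by rw [pow_mul]; norm_num
      rw [h2, Nat.log_pow one_lt_two, show 3 * l = 2 * l + l by ring, pow_add]
      have h3 : c' * (2 * l + 1) ≤ 2 ^ l := by
        refine le_trans ?_ hsq
        calc c' * (2 * l + 1) ≤ c' * (2 * (l + 1) ^ 2) := by gcongr; nlinarith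
          _ = 2 * c' * (l + 1) ^ 2 := by ring
          _ ≤ _ := by gcongr; omega
      have h4 : 1 ≤ 2 ^ (2 * l) := Nat.one_le_two_pow
      calc _ ≤ c' * (2 ^ (2 * l) * (2 * l) + 2 ^ (2 * l)) := by gcongr
        _ = 2 ^ (2 * l) * (c' * (2 * l + 1)) := by ring
        _ ≤ _ := by gcongr) hpU
    have h2 := RTM.le_of_ofReal_le_rKt Nat.one_le_two_pow (hwr (K * l)) hpU'
    rw [Nat.clog_pow _ _ one_lt_two] at h2
    have h3 : ((K * l : ℕ) : ℝ) = K * l := by push_cast; rfl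
    have h4 : (8 : ℝ) * l ≤ ε * K * l := by gcongr
    have h5 : (p.length : ℝ) ≤ 4 * l + 2 + c' := by exact_mod_cast hp
    have h6 : (c' + 2 : ℝ) < l := by exact_mod_cast hsize'
    push_cast at h2
    nlinarith

/-! ### From the hierarchy theorem to constructions -/

lemma constructor_time_bound (k C : ℕ) : ∃ c : ℕ, ∀ m : ℕ, 1 + (1 + (1 + ((5 * m + 2) +
    ((m * (4 * m + 4) + 1) + ((3 * m + 1) + (1 + ((2 * m + 1) + ((2 * m + 1) +
      ((m * ((18 * m + 36) * (5 * (2 * m) + 15 + (C * (2 ^ (2 * m)) ^ k + C)) + 4 * (2 * m) + 10)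
        + 1) + ((2 * m + 1) + (1 + 1))))))))))) ≤ 2 ^ (c * m + c) := by
  set B := 1 + (1 + (1 + ((5 + 2) + (((4 + 4) + 1) + ((3 + 1) + (1 + ((2 + 1) + ((2 + 1) +
      (((18 + 36) * (5 * 2 + 15 + (C + C)) + 4 * 2 + 10)
        + 1) + ((2 + 1) + (1 + 1)))))))))) with hB
  refine ⟨2 * k + 3 + B, fun m => ?_⟩
  set P := 2 ^ m with hP
  set Z := (2 ^ (2 * m)) ^ k with hZ
  have hmP : m ≤ P := Nat.lt_two_pow_self.le
  have h1P : 1 ≤ P := Nat.one_le_two_pow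
  have h1Z : 1 ≤ Z := Nat.one_le_pow _ _ (by positivity)
  set Q := P * (P * (P * Z)) with hQ
  have hPZ : P ≤ P * Z := Nat.le_mul_of_pos_right _ h1Z
  have hZP : Z ≤ P * Z := Nat.le_mul_of_pos_left _ h1P
  have h1PZ : 1 ≤ P * Z := h1P.trans hPZ
  have hP2 : P * Z ≤ P * (P * Z) := Nat.le_mul_of_pos_left _ h1P
  have hP3 : P * (P * Z) ≤ Q := Nat.le_mul_of_pos_left _ h1P
  have hPQ : P ≤ Q := hPZ.trans (hP2.trans hP3)
  have h1Q : 1 ≤ Q := h1P.trans hPQ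
  have hPP : P * P ≤ Q := by rw [hQ]; gcongr; exact hPZ.trans hP2
  have hx : m * (4 * m + 4) ≤ (4 + 4) * Q := by
    calc m * (4 * m + 4) ≤ P * (4 * P + 4 * P) := by gcongr; omega
      _ = (4 + 4) * (P * P) := by ring
      _ ≤ _ := by gcongr
  have hy : m * ((18 * m + 36) * (5 * (2 * m) + 15 + (C * Z + C)) + 4 * (2 * m) + 10) ≤
      ((18 + 36) * (5 * 2 + 15 + (C + C)) + 4 * 2 + 10) * Q := by
    calc _ ≤ P * ((18 * P + 36 * P) * (5 * (2 * (P * Z)) + 15 * (P * Z) +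
          (C * (P * Z) + C * (P * Z))) + 4 * (2 * (P * (P * Z))) + 10 * (P * (P * Z))) := by
          have : C ≤ C * (P * Z) := Nat.le_mul_of_pos_right _ h1PZ
          gcongr <;> omega
      _ = _ := by rw [hQ]; ring
  calc _ ≤ 1 * Q + (1 * Q + (1 * Q + ((5 * Q + 2 * Q) + (((4 + 4) * Q + 1 * Q) +
        ((3 * Q + 1 * Q) + (1 * Q + ((2 * Q + 1 * Q) + ((2 * Q + 1 * Q) +
        ((((18 + 36) * (5 * 2 + 15 + (C + C)) + 4 * 2 + 10) * Q + 1 * Q) +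
          ((2 * Q + 1 * Q) + (1 * Q + 1 * Q))))))))))) := by
        gcongr <;> omega
    _ = B * Q := by rw [hB]; ring
    _ ≤ 2 ^ B * Q := by gcongr; exact Nat.lt_two_pow_self.le
    _ = 2 ^ (B + (2 * k + 3) * m) := by
        rw [hQ, hP, hZ, ← pow_mul, ← pow_add, ← pow_add, ← pow_add, ← pow_add]
        congr 1; ring
    _ ≤ _ := by
        refine Nat.pow_le_pow_right two_pos ?_
        nlinarith

/-- Terms of order `4^n` are harmless: `2^n ≤ 2^q · 2^{n-q}`, and the square of `2^{n-q}` is at most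
`2^{2^{n-q}}`. -/
lemma advisedDecider_time_bound (q : ℕ) : ∃ B : ℕ, ∀ n a T : ℕ, a ≤ 2 ^ 2 ^ (n - q) →
    (a + 1) * T ≤ 2 ^ 2 ^ (n - q) → (2 * a + 1) + (1 + (((a + 1) * (5 * T + 6) + 1) +
      ((5 * n + 2) + (1 + (((n + 1) * (5 * 2 ^ n + 6) + 1) +
        ((5 * a + 5 + (T + 1)) + (1 + (2 ^ n + 1) * (4 * n + 10)))))))) ≤
      B * 2 ^ 2 ^ (n - q) + B := by
  refine ⟨44 * 4 ^ q + 40, fun n a T ha hT => ?_⟩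
  have h1 := Nat.mul_self_two_pow_le (n - q)
  set X := 2 ^ 2 ^ (n - q) with hX
  set P := 2 ^ n with hP
  have hPP : P * P ≤ 4 ^ q * X := by
    have h2 : P ≤ 2 ^ q * 2 ^ (n - q) := by
      rw [hP, ← pow_add]
      exact Nat.pow_le_pow_right two_pos (by omega)
    calc P * P ≤ (2 ^ q * 2 ^ (n - q)) * (2 ^ q * 2 ^ (n - q)) := Nat.mul_le_mul h2 h2
      _ = (2 ^ q * 2 ^ q) * (2 ^ (n - q) * 2 ^ (n - q)) := by ring
      _ ≤ 4 ^ q * X := by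
        rw [← mul_pow]
        exact Nat.mul_le_mul (by norm_num) h1
  have hnP : n + 1 ≤ P := Nat.lt_two_pow_self
  have hP1 : P ≤ P * P := Nat.le_mul_of_pos_left _ (by omega)
  have hp1 : (n + 1) * (5 * P + 6) ≤ 11 * (P * P) := by
    calc (n + 1) * (5 * P + 6) ≤ P * (5 * P + 6 * P) := by gcongr; omega
      _ = _ := by ring
  have hp2 : (P + 1) * (4 * n + 10) ≤ 28 * (P * P) := by
    calc (P + 1) * (4 * n + 10) ≤ (P + P) * (4 * P + 10 * P) := by gcongr <;> omega
      _ = _ := by ring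
  have hp3 : (a + 1) * (5 * T + 6) = 5 * ((a + 1) * T) + 6 * a + 6 := by ring
  have hT' : T ≤ (a + 1) * T := Nat.le_mul_of_pos_left _ (by omega)
  have hB : (44 * 4 ^ q + 40) * X = 44 * (4 ^ q * X) + 40 * X := by ring
  rw [hB, hp3]
  omega

/-- By `bval_bsucc_iterate` the `m`-th string in length-lexicographic order has a length `s` with
`2^s ≤ m + 1 < 2^{s+1}`, and the width is `s - 1`. The decrement ensures that `m` entries cover all
strings of that length. -/
lemma tableWidth_spec {m : ℕ} (hm : 1 ≤ m) :
    2 ^ (tableWidth m + 1) ≤ m + 1 ∧ m + 1 < 2 ^ (tableWidth m + 2) := by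
  have h1 := bval_bsucc_iterate m []
  have h2 := bval_lt (bsucc^[m] [])
  simp only [bval, List.length_nil, pow_zero] at h1
  unfold tableWidth
  rcases h : (bsucc^[m] []).length with _ | l
  · rw [h] at h1 h2; simp at h1 h2; omega
  · rw [h] at h1 h2
    simp only [Nat.add_sub_cancel, pow_succ] at *
    omega

/-- An advice string that describes, within the length bound of `Frame.advisedDecider`, a table of
the language `L` for the strings of length `n`, preceded by the bit `b`. -/
def IsTableAdvice (U : RTM) (L : List Bool → Bool) (b : Bool) (q n : ℕ) (α : List Bool) : Prop :=
  2 * α.length ≤ 2 ^ (n - q) ∧ ∃ l p m, α = List.replicate l true ++ false :: p ∧ 2 ^ n ≤ m ∧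
    2 / 3 ≤ U.probOutput p [] (2 ^ l) (b :: table L m (List.replicate n false))

lemma IsTableAdvice.answers {U : RTM} {L : List Bool → Bool} {b : Bool} {q : ℕ} {x α : List Bool}
    (h : IsTableAdvice U L b q x.length α) : ∃ T, (α.length + 1) * T ≤ 2 ^ 2 ^ (x.length - q) ∧
    (advisedDecider U).Answers x α ((2 * α.length + 1) + (1 + (((α.length + 1) * (5 * T + 6) + 1) +
      ((5 * x.length + 2) + (1 + (((x.length + 1) * (5 * 2 ^ x.length + 6) + 1) +
        ((5 * α.length + 5 + (T + 1)) + (1 + (2 ^ x.length + 1) * (4 * x.length + 10)))))))))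
      (L x) := by
  classical
  obtain ⟨hα, l, p, m, hαe, hm, hp⟩ := h
  have hlen : α.length = l + p.length + 1 := by simp [hαe]; omega
  refine ⟨2 ^ l, ?_, advisedDecider_spec ?_ ?_⟩
  -- Both factors are at most `2 ^ α.length`; this is why `IsTableAdvice` demands a factor two in
  -- the length.
  · calc (α.length + 1) * 2 ^ l ≤ 2 ^ α.length * 2 ^ α.length := by
          gcongr
          · exact Nat.lt_two_pow_self
          · norm_num
          · omega
      _ ≤ 2 ^ 2 ^ (x.length - q) := by
          rw [← pow_add]
          exact Nat.pow_le_pow_right two_pos (by omega)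
  · rw [adviceDigits, hαe, dropWhile_replicate_append Bool.false_ne_true,
      takeWhile_replicate_append Bool.false_ne_true]
    simp [Prog.ofDigitsMSB, ofDigitsMSB_replicate_false]
  · rw [hαe, dropWhile_replicate_append Bool.false_ne_true, List.tail_cons]
    refine le_trans (ex_mono (fun c => ?_) _ _) ((U.probOutput_iff _ _ _ _).1 hp)
    split_ifs with h1 h2 h2
    · exact le_rfl
    · exact zero_le
    · refine absurd ?_ h1
      have hmap := map_decode (Ms := single U) () (table L m (List.replicate x.length false))
      rw [h2.2, List.map_cons, List.tail_cons]
      refine (congrArg (fun l => l.getD (bval x) false) hmap).trans ?_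
      have hb : bval x < m := (bval_lt x).trans_le hm
      simp [table, hb, bsucc_iterate_bval]
    · exact le_rfl

/-- Empty advice means zero steps of `U`, an empty output stack and hence rejection. -/
lemma advisedDecider_nil (U : RTM) (x : List Bool) : (advisedDecider U).Answers x []
    ((2 * ([] : List Bool).length + 1) + (1 + (((([] : List Bool).length + 1) * (5 * 0 + 6) + 1) +
      ((5 * x.length + 2) + (1 + (((x.length + 1) * (5 * 2 ^ x.length + 6) + 1) +
        ((5 * ([] : List Bool).length + 5 + (0 + 1)) +
          (1 + (2 ^ x.length + 1) * (4 * x.length + 10))))))))) false := by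
  refine advisedDecider_spec rfl ?_
  have : (U.initCfg [] []).stk U.kOut = [] := by
    simp [RTM.initCfg]
  refine le_trans (le_of_eq (if_pos ?_)) zero_le
  have h' : ∀ l : List (U.Γ U.kOut), l = [] →
      (l.tail.map (decode (single U) ())).getD (bval x) false = false := by
    rintro _ rfl
    rfl
  exact h' _ this

/-- Lengths without a suitable advice string are removed from the language; there the empty advice
makes the same machine reject everything, so the resource bounds hold at all lengths. -/
lemma language_mem_advice {U : RTM} {L : Language Bool} {b : Bool} {q : ℕ} {dec : List Bool → Bool}
    (hdec : ∀ x, dec x = true ↔ x ∈ L) :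
    ({x | x ∈ L ∧ ∃ α, IsTableAdvice U dec b q x.length α} : Language Bool) ∈
      BPTIMEAdvice (fun n => 2 ^ 2 ^ (n - q)) (fun n => Nat.log 2 (2 ^ 2 ^ (n - q))) := by
  classical
  obtain ⟨B, hB⟩ := advisedDecider_time_bound q
  set L' : Language Bool := {x | x ∈ L ∧ ∃ α, IsTableAdvice U dec b q x.length α} with hL'
  refine ⟨advisedDecider U, B, fun n => if h : ∃ α, IsTableAdvice U dec b q n α then h.choose
    else [], fun n => ?_, fun x => ?_⟩
  · dsimp only
    rw [Nat.log_pow one_lt_two]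
    split_ifs with h
    · have := h.choose_spec.1
      omega
    · simp
  · change (advisedDecider U).Answers x _ _ (decide (x ∈ L'))
    dsimp only
    split_ifs with h
    · obtain ⟨T, hT, hans⟩ := h.choose_spec.answers
      have e : dec x = decide (x ∈ L') := by
        rw [Bool.eq_iff_iff, hdec, decide_eq_true_eq]
        exact ⟨fun hx => ⟨hx, h⟩, fun hx => hx.1⟩
      rw [← e]
      refine hans.mono (hB _ _ _ ?_ hT)
      have := h.choose_spec.1
      exact (by omega : _ ≤ 2 ^ (x.length - q)).trans Nat.lt_two_pow_self.le
    · have e : decide (x ∈ L') = false := by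
        rw [decide_eq_false_iff_not]
        exact fun hx => h hx.2
      rw [e]
      exact (advisedDecider_nil U x).mono (hB _ _ _ (by simp) (by simp))

/-- Some bit is not the first bit of a string of complexity `0`. -/
lemma exists_bit_one_le_rKt (U : RTM) : ∃ b : Bool, ∀ w : List Bool, 1 ≤ U.rKt (b :: w) := by
  obtain ⟨b, hb⟩ : ∃ b : Bool, ∀ w, ¬ 2 / 3 ≤ U.probOutput [] [] 1 (b :: w) := by
    by_contra! h
    obtain ⟨w, hw⟩ := h true
    obtain ⟨w', hw'⟩ := h false
    simpa using U.probOutput_unique hw hw'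
  refine ⟨b, fun w => le_iInf fun p => le_iInf fun t => le_iInf fun ht => le_iInf fun hp => ?_⟩
  have : 1 ≤ p.length + Nat.clog 2 t := by
    by_contra! h
    obtain rfl : p = [] := List.length_eq_zero_iff.1 (by omega)
    have h1 : t ≤ 2 ^ Nat.clog 2 t := Nat.le_pow_clog one_lt_two t
    rw [show Nat.clog 2 t = 0 by omega] at h1
    obtain rfl : t = 1 := by omega
    exact hb w hp
  exact_mod_cast this

/-- With `n` the width, `m + 1 < 2^{n+2}`, so the complexity is below `2^{n-q-1}`, half of `log t
n`. -/
lemma isTableAdvice_of_rKt_lt {U : RTM} {L : List Bool → Bool} {b : Bool} {q m : ℕ} (hm : 1 ≤ m)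
    (hq : q + 1 ≤ tableWidth m)
    (h : (U.rKt (b :: table L m (List.replicate (tableWidth m) false)) : ℝ≥0∞) <
      ENNReal.ofReal ((2 ^ (q + 3))⁻¹ * (m + 1 : ℕ))) :
    ∃ α, IsTableAdvice U L b q (tableWidth m) α := by
  obtain ⟨h1, h2⟩ := tableWidth_spec hm
  set n := tableWidth m with hn
  obtain ⟨p, t, _, hp, hlt⟩ := RTM.exists_of_rKt_lt_ofReal h
  obtain ⟨i, hi⟩ := Nat.exists_eq_add_of_le hq
  -- The strict inequality between integers leaves room for the separator.
  have h3 : p.length + Nat.clog 2 t + 1 ≤ 2 ^ i := by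
    have h4 : (2 ^ (q + 3) : ℝ)⁻¹ * (m + 1 : ℕ) ≤ 2 ^ i := by
      rw [inv_mul_le_iff₀ (by positivity), ← pow_add]
      have h5 : q + 3 + i = n + 2 := by omega
      rw [h5]
      exact_mod_cast h2.le
    have h6 := hlt.trans_le h4
    have h7 : p.length + Nat.clog 2 t < 2 ^ i := by exact_mod_cast h6
    exact h7
  refine ⟨List.replicate (Nat.clog 2 t) true ++ false :: p, ?_, Nat.clog 2 t, p, m, rfl, ?_,
    U.probOutput_mono (Nat.le_pow_clog one_lt_two t) hp⟩
  · rw [hi, show q + 1 + i - q = i + 1 by omega, pow_succ]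
    simp
    omega
  · rw [pow_succ] at h1
    omega

lemma exists_construction_of_language {U : RTM} {k : ℕ} {lam : ℝ} (hlam : 0 < lam)
    (h : ∀ t : ℕ → ℕ, Constructive t →
      (∀ᶠ n : ℕ in atTop, n ≤ t n ∧ (t n : ℝ) ≤ (2 : ℝ) ^ (lam * (2 : ℝ) ^ n)) →
      ∃ L : Language Bool, L ∈ BPTIME (fun n => t n ^ k) ∧
        L ∉ io (BPTIMEAdvice t (fun n => Nat.log 2 (t n)))) :
    ∃ ε : ℝ, 0 < ε ∧ ∃ (A : RTM) (c : ℕ), ∀ m : ℕ,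
      A.HaltsWithin (List.replicate m true) [] (2 ^ (c * m + c)) ∧
      ∃ w : List Bool, w.length = m ∧
        2 / 3 ≤ A.probOutput (List.replicate m true) [] (2 ^ (c * m + c)) w ∧
        ENNReal.ofReal (ε * m) ≤ (U.rKt w : ℝ≥0∞) := by
  classical
  -- With `2^{-q} < lam` the function `2^{2^{n-q}}` is admissible in the hierarchy theorem.
  obtain ⟨q, hq⟩ := exists_pow_lt_of_lt_one hlam (by norm_num : (1 / 2 : ℝ) < 1)
  obtain ⟨L, ⟨M, C, hM⟩, hL⟩ := h (fun n => 2 ^ 2 ^ (n - q)) (constructive_two_pow_two_pow q) (by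
    filter_upwards [eventually_ge_atTop (2 * q)] with n hn
    constructor
    · obtain ⟨i, rfl⟩ := Nat.exists_eq_add_of_le (show q ≤ n by omega)
      rw [Nat.add_sub_cancel_left]
      calc q + i ≤ 2 * i := by omega
        _ ≤ 2 ^ i := Nat.two_mul_le_two_pow i
        _ ≤ 2 ^ 2 ^ i := Nat.lt_two_pow_self.le
    · push_cast
      rw [← Real.rpow_natCast 2 (2 ^ (n - q))]
      refine Real.rpow_le_rpow_of_exponent_le one_le_two ?_
      push_cast
      calc (2 : ℝ) ^ (n - q) = (1 / 2) ^ q * 2 ^ n := by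
            rw [pow_sub₀ _ two_ne_zero (by omega)]
            simp [mul_comm]
        _ ≤ lam * 2 ^ n := by gcongr)
  obtain ⟨b, hb⟩ := exists_bit_one_le_rKt U
  set dec : List Bool → Bool := fun x => decide (x ∈ L) with hdec
  set w : ℕ → List Bool := fun m => if m = 0 then [] else
    b :: table dec (m - 1) (List.replicate (tableWidth (m - 1)) false) with hw
  -- Otherwise there are arbitrarily long compressible tables, hence arbitrarily large widths at
  -- which `L` agrees with the advised language, contrary to its hardness.
  obtain ⟨m₀, hm₀⟩ : ∃ m₀ : ℕ, ∀ m : ℕ, m₀ < m →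
      ENNReal.ofReal ((2 ^ (q + 3))⁻¹ * m) ≤ (U.rKt (w m) : ℝ≥0∞) := by
    by_contra! hcon
    refine hL ⟨_, language_mem_advice (U := U) (b := b) (dec := dec)
      (fun x => decide_eq_true_iff), ?_⟩
    rw [frequently_atTop]
    intro n₀
    obtain ⟨m, hm, hlt⟩ := hcon (2 ^ (n₀ + q + 3))
    obtain ⟨m, rfl⟩ : ∃ m', m = m' + 1 := Nat.exists_eq_succ_of_ne_zero (Nat.ne_zero_of_lt hm)
    have h1 : 1 ≤ m := (Nat.one_le_two_pow).trans (Nat.lt_succ_iff.1 hm)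
    have h2 := (tableWidth_spec h1).2
    have h3 := (Nat.pow_lt_pow_iff_right one_lt_two).1 (hm.trans h2)
    refine ⟨tableWidth m, by omega, fun x hx => ⟨fun hxL => ⟨hxL, ?_⟩, fun hx => hx.1⟩⟩
    rw [hx]
    exact isTableAdvice_of_rKt_lt h1 (by omega) hlt
  obtain ⟨c, hc⟩ := constructor_time_bound k C
  -- The second term of the minimum makes `ε m ≤ 1` for `m ≤ m₀`, where only the bound from the
  -- leading bit `b` is available.
  refine ⟨min (2 ^ (q + 3))⁻¹ (1 / (m₀ + 1)), by positivity, tableConstructor M b, c, fun m => ?_⟩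
  have hspec := tableConstructor_spec (M := M) (m := m) (n := tableWidth (m - 1)) b (L := dec)
    (τ := C * (2 ^ (2 * m)) ^ k + C) rfl (fun j hj => by
      -- Tabulated strings may be longer than the width, but by their rank `2 ^ length ≤ 2 ^ width +
      -- j ≤ 2 * m`, so each costs `2^{O(m)}`.
      refine RTM.Answers.mono (hM _) ?_
      have h1 := (tableWidth_spec (m := m - 1) (by omega)).1
      have h2 := bval_bsucc_iterate j (List.replicate (tableWidth (m - 1)) false)
      have h3 := (bsucc_iterate_replicate (n := tableWidth (m - 1)) (i := 0) (by positivity)).2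
      rw [Function.iterate_zero_apply] at h3
      rw [h3, List.length_replicate] at h2
      dsimp only
      gcongr
      · norm_num
      · refine (Nat.pow_le_pow_right two_pos (Nat.sub_le _ q)).trans ?_
        rw [pow_succ] at h1
        omega)
  refine ⟨hspec.1.mono (hc m), w m, ?_, RTM.probOutput_mono _ (hc m) hspec.2, ?_⟩
  · rcases m with _ | m
    · rfl
    · simp [w, table_length]
  · rcases lt_or_ge m₀ m with hlt | hge
    · refine le_trans ?_ (hm₀ m hlt)
      gcongr
      exact min_le_left _ _
    · rcases m with _ | m
      · simp
      · have h1 : (1 : ℝ≥0∞) ≤ (U.rKt (w (m + 1)) : ℝ≥0∞) := by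
          have := ENat.toENNReal_le.2 (hb (table dec m (List.replicate (tableWidth m) false)))
          simpa [w] using this
        refine le_trans ?_ h1
        rw [ENNReal.ofReal_le_one]
        calc _ ≤ 1 / (m₀ + 1 : ℝ) * (m₀ + 1) := by
              refine mul_le_mul (min_le_right _ _) ?_ (by positivity) (by positivity)
              exact_mod_cast hge.trans (Nat.le_succ _)
          _ = 1 := by field_simp

theorem theorem18 (U : RTM) (hU : U.TimeOptimal) :
    (∃ ε : ℝ, 0 < ε ∧ ∃ (A : RTM) (c : ℕ), ∀ m : ℕ,
        A.HaltsWithin (List.replicate m true) [] (2 ^ (c * m + c)) ∧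
        ∃ w : List Bool, w.length = m ∧
          2 / 3 ≤ A.probOutput (List.replicate m true) [] (2 ^ (c * m + c)) w ∧
          ENNReal.ofReal (ε * m) ≤ (U.rKt w : ℝ≥0∞)) ↔
    (∃ k : ℕ, 1 ≤ k ∧ ∃ lam : ℝ, 0 < lam ∧ ∀ t : ℕ → ℕ, Constructive t →
        (∀ᶠ n : ℕ in atTop, n ≤ t n ∧ (t n : ℝ) ≤ (2 : ℝ) ^ (lam * (2 : ℝ) ^ n)) →
        ∃ L : Language Bool, L ∈ BPTIME (fun n => t n ^ k) ∧
          L ∉ io (BPTIMEAdvice t (fun n => Nat.log 2 (t n)))) := by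
  constructor
  · rintro ⟨ε, hε, A, c, hA⟩
    exact exists_language_of_construction hU hε hA
  · rintro ⟨k, _, lam, hlam, h⟩
    exact exists_construction_of_language hlam h
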